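/- Let $n\ge 3$, let $\mathbb B_n$ be the open unit ball of $\mathbb R^n$, and let $\sigma$ be the normalized surface measure on the sphere $\mathbb S^{n-1}$. For $l\in\mathbb N$ put $F_l(x)={}_2F_1\bigl(l,1-\tfrac n2;l+\tfrac n2;x\bigr)$ and let $\mathbb Z_l^\zeta(\xi)=\frac{2l+n-2}{n-2}\,C_l^{(n-2)/2}(\langle\zeta,\xi\rangle)$ be the zonal function of order $l$ with pole $\zeta\in\mathbb S^{n-1}$ ($C_l^\lambda$ the Gegenbauer polynomials). For $0<\delta<1$ let $$\mathbb P_{h,\delta}(r\zeta,\xi)=\sum_{l\ge0}\frac{F_l(\delta^2r^2)}{F_l(\delta^2)}\,r^l\,\mathbb Z_l^\zeta(\xi)\qquad(0\le r<1,\ \zeta,\xi\in\mathbb S^{n-1})$$ be the Poisson kernel on $\mathbb B_n$ of $D_\delta=(1-\delta^2|x|^2)^2\Delta+2(n-2)\delta^2(1-\delta^2|x|^2)\sum_i x_i\partial_i$, and let $\mathbb P_{h,\delta}[f](x)=\int_{\mathbb S^{n-1}}\mathbb P_{h,\delta}(x,\xi)f(\xi)\,d\sigma(\xi)$. Let $\mathbb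 P_e(x,\xi)=\frac{1-|x|^2}{|x-\xi|^n}$. For $0<\alpha<1$ and $\xi\in\mathbb S^{n-1}$ let $\mathcal A_\alpha(\xi)$ be the interior of the convex hull of $B(0,\alpha)\cup\{\xi\}$, and $\mathcal M_\alpha[u](\xi)=\sup_{x\in\mathcal A_\alpha(\xi)}|u(x)|$. The series defining $\mathbb P_{h,\delta}$ converges absolutely, and the following hold, where all constants may depend on $n$. 1. There is a constant $C$ such that for all $0<\delta<1$, $x\in\mathbb B_n$ and $\xi\in\mathbb S^{n-1}$, $$0\le \mathbb P_{h,\delta}(x,\xi)\le C\,\mathbb P_e(x,\xi).$$ 2. For every $0<\alpha<1$ there is a constant $C$ such that for all $0<\delta<1$ and all real $f\in L^2(\mathbb S^{n-1})$, the integral $u(x)=\mathbb P_{h,\delta}[f](x)$ converges absolutely for every $x\in\mathbb B_n$, and $\mathcal M_\alpha[u]\in L^2(\mathbb S^{n-1})$ with $$\|\mathcal M_\alpha[u]\|_{L^2(\mathbb S^{n-1})}\le C\,\|f\|_{L^2(\mathbb S^{n-1})}.$$ 3. There are $0<\eta<1$ and $C>0$ such that for all $0<\delta<1$, $\xi\in\mathbb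 S^{n-1}$ and $x\in\mathcal A_\eta(\xi)$, $$\mathbb P_{h,\delta}(x,\xi)\ge\frac{C}{(1-|x|^2)^{n-1}}.$$ -/

import Mathlib

open MeasureTheory Metric
open scoped ENNReal RealInnerProductSpace

noncomputable section

/-- The Gegenbauer (ultraspherical) polynomial `C_l^{lam}`, evaluated at the real number `t`. -/
def gegenbauerC (lam : ℝ) (l : ℕ) (t : ℝ) : ℝ :=
  ∑ k ∈ Finset.range (l / 2 + 1),
    (-1 : ℝ) ^ k * (ascPochhammer ℝ (l - k)).eval lam /
      ((k.factorial : ℝ) * ((l - 2 * k).factorial : ℝ)) * (2 * t) ^ (l - 2 * k)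

/-- The zonal function `Z_l^ζ(ξ)` of order `l` with pole `ζ` on the unit sphere of `ℝⁿ`, `n ≥ 3`,
for unit vectors `ζ`, `ξ`.  It is the reproducing kernel at `ζ` of the space of spherical harmonics
of degree `l` with respect to the normalized surface measure. -/
def zonal {n : ℕ} (l : ℕ) (ζ ξ : EuclideanSpace ℝ (Fin n)) : ℝ :=
  (2 * (l : ℝ) + (n : ℝ) - 2) / ((n : ℝ) - 2) * gegenbauerC (((n : ℝ) - 2) / 2) l ⟪ζ, ξ⟫

/-- `F_l(x) = ₂F₁(l, 1 - n/2; l + n/2; x)`. -/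
def hypF (n l : ℕ) (x : ℝ) : ℝ :=
  ordinaryHypergeometric (l : ℝ) (1 - (n : ℝ) / 2) ((l : ℝ) + (n : ℝ) / 2) x

/-- The `l`-th term of the spherical harmonic expansion of the Poisson kernel of
`D_δ = (1 - δ²|x|²)² Δ + 2 (n - 2) δ² (1 - δ²|x|²) ∑ xᵢ ∂ᵢ` on the unit ball, that is
`F_l(δ² r²) / F_l(δ²) * r ^ l * Z_l^ζ(ξ)` at `x = r ζ`.  (At `x = 0` the direction `ζ` is
immaterial: only the term `l = 0`, which is `1`, survives.) -/
def poissonHTerm {n : ℕ} (δ : ℝ) (x ξ : EuclideanSpace ℝ (Fin n)) (l : ℕ) : ℝ :=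
  hypF n l (δ ^ 2 * ‖x‖ ^ 2) / hypF n l (δ ^ 2) * ‖x‖ ^ l * zonal l (‖x‖⁻¹ • x) ξ

/-- The `ℋ_δ`-Poisson kernel. -/
def poissonH {n : ℕ} (δ : ℝ) (x ξ : EuclideanSpace ℝ (Fin n)) : ℝ :=
  ∑' l : ℕ, poissonHTerm δ x ξ l

/-- The Euclidean Poisson kernel of the unit ball, `|x| < 1`, `|ξ| = 1`. -/
def poissonE {n : ℕ} (x ξ : EuclideanSpace ℝ (Fin n)) : ℝ :=
  (1 - ‖x‖ ^ 2) / ‖x - ξ‖ ^ n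

/-- The surface measure on the unit sphere, normalized to total mass one. -/
def sphereMeasure (n : ℕ) : Measure (sphere (0 : EuclideanSpace ℝ (Fin n)) 1) :=
  ((volume : Measure (EuclideanSpace ℝ (Fin n))).toSphere Set.univ)⁻¹ •
    (volume : Measure (EuclideanSpace ℝ (Fin n))).toSphere

/-- The `ℋ_δ`-Poisson integral of a function on the unit sphere. -/
def poissonHIntegral {n : ℕ} (δ : ℝ) (f : sphere (0 : EuclideanSpace ℝ (Fin n)) 1 → ℝ)
    (x : EuclideanSpace ℝ (Fin n)) : ℝ :=
  ∫ ξ, poissonH δ x ξ * f ξ ∂(sphereMeasure n)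

/-- The non-tangential approach region: the interior of the convex hull of `B(0, α)` and `ζ`. -/
def approachRegion {n : ℕ} (α : ℝ) (ζ : EuclideanSpace ℝ (Fin n)) :
    Set (EuclideanSpace ℝ (Fin n)) :=
  interior (convexHull ℝ (insert ζ (ball 0 α)))

/-- The non-tangential maximal function, with values in `[0, ∞]`. -/
def ntMaximal {n : ℕ} (α : ℝ) (u : EuclideanSpace ℝ (Fin n) → ℝ)
    (ξ : sphere (0 : EuclideanSpace ℝ (Fin n)) 1) : ℝ≥0∞ :=
  ⨆ x ∈ approachRegion α (ξ : EuclideanSpace ℝ (Fin n)), ‖u x‖ₑ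

end

/-!
Poisson kernels of the operators `D_δ`: expansion, two-sided bounds and the maximal theorem.

Up to the factor `(1 - δ ^ 2 |x| ^ 2) ^ 2` the operator `D_δ` is `L = Δ + β x · ∇` with a drift
`β ≥ 0`, so it obeys the weak maximum principle (`le_of_subsolution`).  Each term of the series is a
solution of `L u = 0`, a hypergeometric function of `|x| ^ 2` times a solid harmonic
(`hasOp_hypF_mul_gegHom`).  Euler's transformation writes `F_l` as `(1 - x) ^ (n - 1)` times a power
series with positive coefficients (`hypF_eq`); it follows that `F_l` is positive and decreasing, and
that the ratio `F_l (δ ^ 2 r ^ 2) / F_l (δ ^ 2)` is at least `1` and at most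
`(1 + 2 l (1 - r)) ^ (n - 1)`, uniformly in `δ` (`hypF_div_monotone`, `hypF_ratio_le`).  Together
with the polynomial growth of the zonal functions this gives the absolute convergence
(`summable_abs_poissonHTerm`).

For the upper bound the series is regularized by factors `t ^ l`, `t < 1`.  By the generating
function of the zonal functions, the regularized kernel has the boundary values
`(1 - t ^ 2) / |t x - ξ| ^ n` on the sphere, and the maximum principle compares it
* with `0`, which gives positivity;
* with `((1 - δ ^ 2 |x| ^ 2) / (1 - δ ^ 2)) ^ (n / 2 - 1)` times the Euclidean Poisson kernel, a
  supersolution whose first factor is bounded for `1 - |x| ≤ 1 - δ` (`poissonH_le_rpow_mul`);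
* outside the ball of radius `1 - δ` about `ξ`, with a multiple of the hyperbolic Poisson kernel
  `((1 - δ ^ 2 |x| ^ 2) / |δ x - ξ| ^ 2) ^ (n - 1)`, an exact solution, which is comparable to the
  Euclidean kernel or smaller for `1 - |x| ≥ 1 - δ` (`poissonH_le_hyperbolic`).

For the lower bound, at a point on the radius to `ξ` all terms are positive and the ratios of
hypergeometric factors are at least `1`, so the kernel dominates
`(1 - r ^ 2) / (1 - r) ^ n ≥ (1 - r) ^ (1 - n)`.  Turning `x` by a small angle changes the terms by at
most `l ^ 2 (1 - cos θ)` times their value at the pole, and in a narrow approach region the sum of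
these changes is a small multiple of the main term (`poissonH_ge_sub`).

By the upper bound the nontangential maximal function is at most a constant times the supremum over
the dyadic scales `ε = 2 ^ (-j)` of the integrals of `|f|` against the kernels
`k_ε (ξ, η) = ε / (ε + |ξ - η|) ^ n`.  These kernels satisfy `k_ε * k_ε' ≤ C (k_ε + k_ε')`, an
inequality that survives the linearization of the supremum by a measurable choice of the scale.  For
the linearized operator `T` it says `T T* ≤ C (T + T*)`, whence `‖T‖ ^ 2 ≤ 2 C ‖T‖` and `‖T‖ ≤ 2 C`
(`lintegral_sq_kernel_step`, `lintegral_sq_iSup_kernel_le`).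
-/

open Filter Topology

/-! ### Power series on the unit interval -/

/-- The coefficients `a` of a power series converging absolutely in `(-1, 1)`. -/
def UnitSummable (a : ℕ → ℝ) : Prop :=
  ∀ ρ : ℝ, 0 ≤ ρ → ρ < 1 → Summable fun j => |a j| * ρ ^ j

/-- The sum of the power series with coefficients `a`. -/
noncomputable def powSum (a : ℕ → ℝ) (x : ℝ) : ℝ := ∑' j, a j * x ^ j

/-- The coefficients of the derivative of a power series. -/
def derivCoeff (a : ℕ → ℝ) (j : ℕ) : ℝ := (j + 1) * a (j + 1)

namespace UnitSummable

variable {a : ℕ → ℝ}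

theorem hasSum (ha : UnitSummable a) {x : ℝ} (hx : |x| < 1) :
    HasSum (fun j => a j * x ^ j) (powSum a x) := by
  refine (Summable.of_norm ?_).hasSum
  simpa [norm_mul, norm_pow] using ha |x| (abs_nonneg x) hx

theorem hasSum_mul_x (ha : UnitSummable a) {x : ℝ} (hx : |x| < 1) :
    HasSum (fun j => (if j = 0 then 0 else a (j - 1)) * x ^ j) (x * powSum a x) := by
  rw [← hasSum_nat_add_iff' 1]
  simp only [Finset.sum_range_one, if_true, zero_mul, sub_zero, Nat.add_eq_zero_iff, one_ne_zero,
    and_false, if_false, Nat.add_sub_cancel]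
  refine ((ha.hasSum hx).mul_left x).congr_fun ?_
  intro j
  ring

theorem of_abs_le {b : ℕ → ℝ} (ha : UnitSummable a) (h : ∀ j, |b j| ≤ |a j|) :
    UnitSummable b := fun ρ h0 h1 =>
  (ha ρ h0 h1).of_nonneg_of_le (fun j => by positivity) fun j => by
    have := h j
    gcongr

theorem natCast_mul (ha : UnitSummable a) : UnitSummable fun j => (j : ℝ) * a j := by
  intro ρ h0 h1
  obtain ⟨σ, h2, h3⟩ := exists_between h1
  have hσ : 0 < σ := h0.trans_lt h2
  obtain ⟨M, hM⟩ := (ha σ hσ.le h3).tendsto_atTop_zero.bddAbove_range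
  have hM' : ∀ j, |a j| * σ ^ j ≤ M := fun j => hM ⟨j, rfl⟩
  have hq : ‖ρ / σ‖ < 1 := by
    rw [Real.norm_of_nonneg (by positivity)]
    exact (div_lt_one hσ).2 h2
  refine ((summable_pow_mul_geometric_of_norm_lt_one 1 hq).mul_left M).of_nonneg_of_le
    (fun j => by positivity) fun j => ?_
  rw [abs_mul, Nat.abs_cast, pow_one, div_pow]
  have h4 : (j : ℝ) * |a j| * ρ ^ j = (|a j| * σ ^ j) * ((j : ℝ) * (ρ ^ j / σ ^ j)) := by
    field_simp
  rw [h4]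
  have := hM' j
  gcongr

theorem shift_left (ha : UnitSummable a) : UnitSummable fun j => a (j + 1) := by
  intro ρ h0 h1
  rcases h0.eq_or_lt with rfl | h0
  · refine summable_of_ne_finset_zero (s := {0}) fun j hj => ?_
    simp at hj
    simp [hj]
  · have := ((summable_nat_add_iff 1).2 (ha ρ h0.le h1)).mul_left ρ⁻¹
    refine this.congr fun j => ?_
    rw [pow_succ]
    field_simp

theorem shift_right (ha : UnitSummable a) :
    UnitSummable fun j => if j = 0 then 0 else a (j - 1) := by
  intro ρ h0 h1
  refine (summable_nat_add_iff 1).1 (((ha ρ h0 h1).mul_left ρ).congr fun j => ?_)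
  simp
  ring

theorem deriv (ha : UnitSummable a) : UnitSummable (derivCoeff a) := by
  refine ha.natCast_mul.shift_left.of_abs_le fun j => ?_
  simp [derivCoeff]

theorem hasDerivAt (ha : UnitSummable a) {x : ℝ} (hx : |x| < 1) :
    HasDerivAt (powSum a) (powSum (derivCoeff a) x) x := by
  obtain ⟨ρ, h1, h2⟩ := exists_between hx
  have hρ : 0 < ρ := (abs_nonneg x).trans_lt h1
  have key := hasDerivAt_tsum_of_isPreconnected (g := fun (j : ℕ) (y : ℝ) => a j * y ^ j)
    (g' := fun (j : ℕ) (y : ℝ) => a j * (j * y ^ (j - 1)))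
    (u := fun j : ℕ => (|(j : ℝ) * a j| * ρ ^ j) * ρ⁻¹) (t := ball (0 : ℝ) ρ) (y₀ := x) (y := x)
    ((ha.natCast_mul ρ hρ.le h2).mul_right _) isOpen_ball (convex_ball _ _).isPreconnected
    (fun j y _ => (hasDerivAt_pow j y).const_mul (a j)) ?_ (by simpa using h1)
    (ha.hasSum hx).summable (by simpa using h1)
  · suffices h : ∑' j : ℕ, a j * (j * x ^ (j - 1)) = powSum (derivCoeff a) x from h ▸ key
    rw [((summable_nat_add_iff 1).1 ?_ : Summable fun j : ℕ =>
      a j * (j * x ^ (j - 1))).tsum_eq_zero_add]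
    · simp only [powSum, derivCoeff, Nat.cast_zero, zero_mul, mul_zero, zero_add, Nat.cast_add,
        Nat.cast_one, Nat.add_sub_cancel]
      exact tsum_congr fun j => by ring
    · refine (ha.deriv.hasSum hx).summable.congr fun j => ?_
      simp only [derivCoeff, Nat.cast_add, Nat.cast_one, Nat.add_sub_cancel]
      ring
  · intro j y hy
    have hy' : |y| < ρ := by simpa using hy
    rcases j with _ | j
    · simp
    · rw [norm_mul, norm_mul, norm_pow, Real.norm_eq_abs, Real.norm_eq_abs, Real.norm_eq_abs,
        Nat.add_sub_cancel, pow_succ, abs_mul]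
      have : |y| ^ j ≤ ρ ^ j := by gcongr
      calc |a (j + 1)| * (|((j + 1 : ℕ) : ℝ)| * |y| ^ j)
          ≤ |a (j + 1)| * (|((j + 1 : ℕ) : ℝ)| * ρ ^ j) := by gcongr
        _ = _ := by field_simp

/-- The ratio test for coefficients with a hypergeometric recursion. -/
theorem of_hypergeometric {α β c : ℝ} (hc : 0 < c)
    (hrec : ∀ j : ℕ, (j + 1) * (c + j) * a (j + 1) = (α + j) * (β + j) * a j) :
    UnitSummable a := by
  intro ρ h0 h1
  obtain ⟨σ, h2, h3⟩ := exists_between h1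
  have lim : ∀ d : ℝ, Tendsto (fun j : ℕ => (d + j) / (j : ℝ)) atTop (𝓝 1) := fun d => by
    have h : Tendsto (fun j : ℕ => d / (j : ℝ) + 1) atTop (𝓝 (0 + 1)) :=
      (tendsto_const_div_atTop_nhds_zero_nat d).add_const 1
    rw [zero_add] at h
    refine h.congr' ?_
    filter_upwards [eventually_ne_atTop 0] with j hj
    field_simp
  have hl : Tendsto (fun j : ℕ => ρ * |((α + j) / (j : ℝ)) * ((β + j) / j) /
      (((1 + j) / j) * ((c + j) / j))|) atTop (𝓝 (ρ * |1 * 1 / (1 * 1)|)) :=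
    ((((lim α).mul (lim β)).div ((lim 1).mul (lim c)) (by norm_num)).abs).const_mul ρ
  simp only [mul_one, div_one, abs_one] at hl
  refine summable_of_ratio_norm_eventually_le h3 ?_
  filter_upwards [hl.eventually (gt_mem_nhds h2), eventually_gt_atTop 0] with j hj hj0
  have hj1 : (0 : ℝ) < j := by exact_mod_cast hj0
  have e1 : ((α + j) / (j : ℝ)) * ((β + j) / j) / (((1 + j) / j) * ((c + j) / j))
      = (α + j) * (β + j) / ((1 + j) * (c + j)) := by
    field_simp
  rw [e1] at hj
  have e2 : a (j + 1) = (α + j) * (β + j) / ((1 + j) * (c + j)) * a j := by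
    rw [div_mul_eq_mul_div, eq_div_iff (by positivity), ← hrec]
    ring
  rw [e2, abs_mul _ (a j), Real.norm_of_nonneg (by positivity),
    Real.norm_of_nonneg (by positivity)]
  rw [pow_succ]
  calc _ = (ρ * |(α + j) * (β + j) / ((1 + j) * (c + j))|) * (|a j| * ρ ^ j) := by ring
    _ ≤ σ * (|a j| * ρ ^ j) := by gcongr

/-- The hypergeometric differential equation. -/
theorem hypergeometric_ode (ha : UnitSummable a) {α β c : ℝ}
    (hrec : ∀ j : ℕ, (j + 1) * (c + j) * a (j + 1) = (α + j) * (β + j) * a j)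
    {x : ℝ} (hx : |x| < 1) :
    x * (1 - x) * powSum (derivCoeff (derivCoeff a)) x
      + (c - (α + β + 1) * x) * powSum (derivCoeff a) x - α * β * powSum a x = 0 := by
  have h0 := ha.hasSum hx
  have h1 := ha.deriv.hasSum hx
  have h1x := ha.deriv.hasSum_mul_x hx
  have h2x := ha.deriv.deriv.hasSum_mul_x hx
  have h2xx := ha.deriv.deriv.shift_right.hasSum_mul_x hx
  have e : powSum (fun j : ℕ => (if j = 0 then 0 else derivCoeff (derivCoeff a) (j - 1))) x
      = x * powSum (derivCoeff (derivCoeff a)) x := h2x.tsum_eq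
  rw [e] at h2xx
  · have key := ((((h2x.sub h2xx).add (h1.mul_left c)).sub (h1x.mul_left (α + β + 1))).sub
      (h0.mul_left (α * β)))
    have := key.unique (hasSum_zero.congr_fun ?_)
    · linear_combination this
    · intro j
      have := hrec j
      rcases j with _ | _ | j
      · simp [derivCoeff] at this ⊢
        linear_combination this
      · simp [derivCoeff] at this ⊢
        linear_combination x * this
      · simp [derivCoeff] at this ⊢
        linear_combination x ^ (j + 2) * this

end UnitSummable

/-- The coefficients of the hypergeometric series `₂F₁(a, b; c; ·)`. -/
noncomputable def hypCoeff (a b c : ℝ) (j : ℕ) : ℝ :=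
  (j.factorial : ℝ)⁻¹ * (ascPochhammer ℝ j).eval a * (ascPochhammer ℝ j).eval b *
    ((ascPochhammer ℝ j).eval c)⁻¹

theorem hypCoeff_zero (a b c : ℝ) : hypCoeff a b c 0 = 1 := by simp [hypCoeff]

theorem hypCoeff_succ {a b c : ℝ} (hc : 0 < c) (j : ℕ) :
    (j + 1) * (c + j) * hypCoeff a b c (j + 1) = (a + j) * (b + j) * hypCoeff a b c j := by
  have h1 : (ascPochhammer ℝ j).eval c ≠ 0 := (ascPochhammer_pos j c hc).ne'
  have h2 : c + j ≠ 0 := by positivity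
  have h3 : (j.factorial : ℝ) ≠ 0 := by positivity
  simp only [hypCoeff, ascPochhammer_succ_eval, Nat.factorial_succ]
  push_cast
  field_simp

theorem hypCoeff_pos {a b c : ℝ} (ha : 0 < a) (hb : 0 < b) (hc : 0 < c) (j : ℕ) :
    0 < hypCoeff a b c j := by
  have h1 := ascPochhammer_pos j a ha
  have h2 := ascPochhammer_pos j b hb
  have h3 := ascPochhammer_pos j c hc
  unfold hypCoeff
  positivity

theorem hypCoeff_unitSummable {a b c : ℝ} (hc : 0 < c) : UnitSummable (hypCoeff a b c) :=
  .of_hypergeometric hc (hypCoeff_succ hc)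

theorem powSum_nonneg {a : ℕ → ℝ} (ha : ∀ j, 0 ≤ a j) {x : ℝ} (hx : 0 ≤ x) : 0 ≤ powSum a x :=
  tsum_nonneg fun j => mul_nonneg (ha j) (pow_nonneg hx j)

theorem le_powSum {a : ℕ → ℝ} (ha : UnitSummable a) (h : ∀ j, 0 ≤ a j) {x : ℝ} (hx : 0 ≤ x)
    (hx1 : x < 1) : a 0 ≤ powSum a x := by
  have hx' : |x| < 1 := by rwa [abs_of_nonneg hx]
  simpa using le_hasSum (ha.hasSum hx') 0 fun j _ => mul_nonneg (h j) (pow_nonneg hx j)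

theorem powSum_zero (a : ℕ → ℝ) : powSum a 0 = a 0 := by
  unfold powSum
  rw [tsum_eq_single 0 fun j hj => by simp [hj]]
  simp

/-! ### The hypergeometric factors -/

section Euler

/-- The coefficients of `₂F₁(k + 1, l + 2k + 1; l + k + 1; ·)`, the positive series that Euler's
transformation attaches to `₂F₁(l, -k; l + k + 1; ·)`. -/
noncomputable def eulerCoeff (k : ℝ) (l : ℕ) : ℕ → ℝ :=
  hypCoeff (k + 1) (l + 2 * k + 1) (l + k + 1)

/-- The coefficients of the series `B` with
`((1 - x) ^ (2k + 1) * ∑ j, eulerCoeff k l j * x ^ j)' = -(1 - x) ^ (2k) * B x`. -/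
noncomputable def eulerDerivCoeff (k : ℝ) (l j : ℕ) : ℝ :=
  eulerCoeff k l j * (l * k / (l + k + 1 + j))

variable {k : ℝ} (hk : 0 < k) (l : ℕ)
include hk

theorem eulerCoeff_pos (j : ℕ) : 0 < eulerCoeff k l j :=
  hypCoeff_pos (by positivity) (by positivity) (by positivity) j

theorem eulerCoeff_unitSummable : UnitSummable (eulerCoeff k l) :=
  hypCoeff_unitSummable (by positivity)

theorem eulerCoeff_succ (j : ℕ) : (j + 1) * (l + k + 1 + j) * eulerCoeff k l (j + 1) =
    (k + 1 + j) * (l + 2 * k + 1 + j) * eulerCoeff k l j :=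
  hypCoeff_succ (by positivity) j

theorem eulerDerivCoeff_nonneg (j : ℕ) : 0 ≤ eulerDerivCoeff k l j := by
  have := eulerCoeff_pos hk l j
  unfold eulerDerivCoeff
  positivity

theorem eulerDerivCoeff_le (j : ℕ) : eulerDerivCoeff k l j ≤ k * eulerCoeff k l j := by
  have := eulerCoeff_pos hk l j
  unfold eulerDerivCoeff
  rw [mul_comm k]
  gcongr
  rw [div_le_iff₀ (by positivity)]
  nlinarith [mul_nonneg hk.le (Nat.cast_nonneg (α := ℝ) j), mul_pos hk hk]

theorem eulerDerivCoeff_unitSummable : UnitSummable (eulerDerivCoeff k l) := by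
  refine UnitSummable.of_abs_le (a := fun j => k * eulerCoeff k l j) ?_ fun j => ?_
  · intro ρ h0 h1
    refine ((eulerCoeff_unitSummable hk l ρ h0 h1).mul_left |k|).congr fun j => ?_
    rw [abs_mul, mul_assoc]
  · rw [abs_of_nonneg (eulerDerivCoeff_nonneg hk l j), abs_of_nonneg
      (mul_nonneg hk.le (eulerCoeff_pos hk l j).le)]
    exact eulerDerivCoeff_le hk l j

theorem one_sub_mul_deriv_euler {x : ℝ} (hx : |x| < 1) :
    (1 - x) * powSum (derivCoeff (eulerCoeff k l)) x - (2 * k + 1) * powSum (eulerCoeff k l) x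
      = -powSum (eulerDerivCoeff k l) x := by
  have ha := eulerCoeff_unitSummable hk l
  have key := (((ha.deriv.hasSum hx).sub (ha.deriv.hasSum_mul_x hx)).sub
    ((ha.hasSum hx).mul_left (2 * k + 1))).add ((eulerDerivCoeff_unitSummable hk l).hasSum hx)
  have := key.unique (hasSum_zero.congr_fun ?_)
  · linear_combination this
  · intro j
    have h := eulerCoeff_succ hk l j
    have h1 : (l : ℝ) + k + 1 + j ≠ 0 := by positivity
    have h2 : eulerDerivCoeff k l j * (l + k + 1 + j) = eulerCoeff k l j * (l * k) := by
      unfold eulerDerivCoeff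
      field_simp
    have h3 : (if j = 0 then 0 else derivCoeff (eulerCoeff k l) (j - 1))
        = j * eulerCoeff k l j := by
      rcases j with _ | j <;> simp [derivCoeff]
    rw [h3]
    apply mul_left_cancel₀ h1
    rw [derivCoeff]
    linear_combination x ^ j * h + x ^ j * h2

theorem eulerDeriv_ode {x : ℝ} (hx : |x| < 1) :
    (l + k + 1) * powSum (eulerDerivCoeff k l) x + x * powSum (derivCoeff (eulerDerivCoeff k l)) x
      = l * k * powSum (eulerCoeff k l) x := by
  have hb := eulerDerivCoeff_unitSummable hk l
  have key := ((hb.hasSum hx).mul_left ((l : ℝ) + k + 1)).add (hb.deriv.hasSum_mul_x hx)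
  refine key.unique ((((eulerCoeff_unitSummable hk l).hasSum hx).mul_left _).congr_fun ?_)
  intro j
  have h1 : (l : ℝ) + k + 1 + j ≠ 0 := by positivity
  have h2 : eulerDerivCoeff k l j * (l + k + 1 + j) = eulerCoeff k l j * (l * k) := by
    unfold eulerDerivCoeff
    field_simp
  have h3 : (if j = 0 then 0 else derivCoeff (eulerDerivCoeff k l) (j - 1))
      = j * eulerDerivCoeff k l j := by
    rcases j with _ | j <;> simp [derivCoeff]
  rw [h3]
  linear_combination x ^ j * h2

/-- One half of the bound for the logarithmic derivative of the hypergeometric factors, effective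
for `l (1 - x) ≥ 1`. -/
theorem eulerDeriv_le {x : ℝ} (hx : 0 ≤ x) (hx1 : x < 1) :
    powSum (eulerDerivCoeff k l) x ≤ k * powSum (eulerCoeff k l) x := by
  have hx' : |x| < 1 := by rwa [abs_of_nonneg hx]
  refine hasSum_le (fun j => ?_) ((eulerDerivCoeff_unitSummable hk l).hasSum hx')
    (((eulerCoeff_unitSummable hk l).hasSum hx').mul_left k)
  rw [← mul_assoc]
  exact mul_le_mul_of_nonneg_right (eulerDerivCoeff_le hk l j) (pow_nonneg hx j)

/-- The other half of the bound, effective for `l (1 - x) ≤ 1`: multiplication by `1 - x` turns the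
coefficients of the series into their increments. -/
theorem eulerDeriv_le' {x : ℝ} (hx : 0 ≤ x) (hx1 : x < 1) :
    powSum (eulerDerivCoeff k l) x ≤ (k + 1) * l * ((1 - x) * powSum (eulerCoeff k l) x) := by
  have hx' : |x| < 1 := by rwa [abs_of_nonneg hx]
  have ha := eulerCoeff_unitSummable hk l
  have key := ((ha.hasSum hx').sub (ha.hasSum_mul_x hx')).mul_left ((k + 1) * l)
  rw [sub_mul, one_mul]
  refine hasSum_le (fun j => ?_) ((eulerDerivCoeff_unitSummable hk l).hasSum hx') key
  rw [← sub_mul, ← mul_assoc]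
  refine mul_le_mul_of_nonneg_right ?_ (pow_nonneg hx j)
  have hl : (0 : ℝ) ≤ l := Nat.cast_nonneg l
  rcases j with _ | j
  · simp only [eulerDerivCoeff, eulerCoeff, hypCoeff_zero, if_true, sub_zero, mul_one, one_mul,
      Nat.cast_zero, add_zero]
    rw [div_le_iff₀ (by positivity)]
    nlinarith [mul_nonneg hl hl, mul_nonneg hl hk.le, mul_nonneg (mul_nonneg hl hk.le) hk.le,
      mul_nonneg (mul_nonneg hl hl) hk.le]
  · simp only [Nat.add_eq_zero_iff, one_ne_zero, and_false, if_false, Nat.add_sub_cancel]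
    have hj : (0 : ℝ) ≤ j := Nat.cast_nonneg j
    have h := eulerCoeff_succ hk l j
    have p1 := eulerCoeff_pos hk l (j + 1)
    set u := eulerCoeff k l (j + 1) with hu
    set v := eulerCoeff k l j
    -- the increments of the coefficients are comparable to the coefficients divided by the index
    have h4 : k * u ≤ (k + 1 + j) * (u - v) := by
      have h5 : (k + 1 + j) * (u - v) * (l + 2 * k + 1 + j) = u * k * (l + 2 * j + 2 + 2 * k) := by
        linear_combination h
      have h6 : k * u * (l + 2 * k + 1 + j) ≤ (k + 1 + j) * (u - v) * (l + 2 * k + 1 + j) := by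
        rw [h5]
        nlinarith [mul_pos hk p1, mul_nonneg (mul_pos hk p1).le hj]
      exact le_of_mul_le_mul_right h6 (by positivity)
    have h7 : 0 ≤ u - v := by
      by_contra! h8
      nlinarith [mul_pos hk p1, mul_pos (by positivity : (0 : ℝ) < k + 1 + j) (neg_pos.2 h8)]
    unfold eulerDerivCoeff
    rw [← hu, mul_div_assoc', div_le_iff₀ (by positivity)]
    push_cast
    have h9 : l * (k * u) ≤ l * ((k + 1 + j) * (u - v)) := by gcongr
    have h10 : l * ((k + 1 + j) * (u - v)) ≤ l * ((l + k + 1 + (j + 1)) * (u - v)) := by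
      gcongr ?_ * (?_ * ?_)
      linarith
    have h11 : 0 ≤ k * (l * ((l + k + 1 + (j + 1)) * (u - v))) := by positivity
    linarith

end Euler

/-- Two solutions of the hypergeometric equation `x (1 - x) y'' + (c (1 - x) + d x) y' = e y` that
are smooth at the origin are proportional: their Wronskian `w` satisfies
`x (1 - x) w' = -(c (1 - x) + d x) w`, so that `x ^ (2 c) (1 - x) ^ (-2 d) w ^ 2` is constant. -/
theorem wronskian_eq_zero {w w' : ℝ → ℝ} {p q : ℕ}
    (hw : ∀ x ∈ Set.Ico (0 : ℝ) 1, HasDerivAt w (w' x) x)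
    (h : ∀ x ∈ Set.Ico (0 : ℝ) 1,
      2 * x * (1 - x) * w' x + ((p + 2) * (1 - x) + q * x) * w x = 0)
    {x : ℝ} (hx : x ∈ Set.Ico (0 : ℝ) 1) : w x = 0 := by
  rcases hx.1.eq_or_lt with rfl | hx0
  · simpa [show (p : ℝ) + 2 ≠ 0 by positivity] using h 0 hx
  set ψ : ℝ → ℝ := fun y => y ^ (p + 2) * w y ^ 2 / (1 - y) ^ q with hψ
  have hd : ∀ y ∈ Set.Ico (0 : ℝ) 1, HasDerivAt ψ 0 y := by
    intro y hy
    have hy1 : 1 - y ≠ 0 := by linarith [hy.2]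
    have hpow : HasDerivAt (fun z : ℝ => (1 - z) ^ q) (q * (1 - y) ^ (q - 1) * (-1)) y :=
      ((hasDerivAt_id y).const_sub 1).pow q
    have h1 := (((hasDerivAt_pow (p + 2) y).mul ((hw y hy).pow 2)).div hpow (pow_ne_zero q hy1))
    refine HasDerivAt.congr_deriv h1 ?_
    rw [div_eq_zero_iff]
    left
    have h2 := h y hy
    have h3 : (q : ℝ) * (1 - y) ^ (q - 1) * (1 - y) = q * (1 - y) ^ q := by
      rcases q with _ | q
      · simp
      · rw [Nat.add_sub_cancel]; ring
    apply mul_left_cancel₀ hy1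
    simp only [Pi.mul_apply, Pi.pow_apply]
    rw [show p + 2 - 1 = p + 1 from rfl]
    push_cast
    linear_combination (y ^ (p + 1) * w y * (1 - y) ^ q) * h2 + y ^ (p + 2) * w y ^ 2 * h3
  have hc : ψ x = ψ 0 := by
    refine constant_of_has_deriv_right_zero (f := ψ) (a := 0) (b := x) ?_ ?_ x
      (Set.right_mem_Icc.2 hx.1)
    · exact fun y hy => (hd y ⟨hy.1, hy.2.trans_lt hx.2⟩).continuousAt.continuousWithinAt
    · exact fun y hy => (hd y ⟨hy.1, hy.2.trans hx.2⟩).hasDerivWithinAt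
  have h0 : ψ 0 = 0 := by simp [hψ]
  rw [h0, hψ] at hc
  have hx1 : (1 - x) ^ q ≠ 0 := pow_ne_zero _ (by linarith [hx.2])
  simpa [hx1, hx0.ne'] using hc

section HypF

variable {n : ℕ} (hn : 3 ≤ n) (l : ℕ)

/-- The power series coefficients of `hypF n l`. -/
noncomputable def hypFCoeff (n l : ℕ) : ℕ → ℝ := hypCoeff l (1 - (n : ℝ) / 2) (l + (n : ℝ) / 2)

theorem hypF_eq_powSum (n l : ℕ) : hypF n l = powSum (hypFCoeff n l) := by
  unfold hypF powSum
  funext x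
  rw [ordinaryHypergeometric_eq_tsum]
  rfl

/-- The first derivative of `hypF n l`. -/
noncomputable def hypFDeriv (n l : ℕ) : ℝ → ℝ := powSum (derivCoeff (hypFCoeff n l))

/-- The second derivative of `hypF n l`. -/
noncomputable def hypFDeriv2 (n l : ℕ) : ℝ → ℝ :=
  powSum (derivCoeff (derivCoeff (hypFCoeff n l)))

include hn

theorem hypFCoeff_unitSummable : UnitSummable (hypFCoeff n l) := by
  have : 0 < n := by omega
  exact hypCoeff_unitSummable (by positivity)

theorem hypF_hasDerivAt {x : ℝ} (hx : |x| < 1) : HasDerivAt (hypF n l) (hypFDeriv n l x) x := by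
  rw [hypF_eq_powSum]
  exact (hypFCoeff_unitSummable hn l).hasDerivAt hx

theorem hypFDeriv_hasDerivAt {x : ℝ} (hx : |x| < 1) :
    HasDerivAt (hypFDeriv n l) (hypFDeriv2 n l x) x :=
  (hypFCoeff_unitSummable hn l).deriv.hasDerivAt hx

theorem hypF_ode {x : ℝ} (hx : |x| < 1) :
    x * (1 - x) * hypFDeriv2 n l x
      + ((l + (n : ℝ) / 2) * (1 - x) + (n - 2) * x) * hypFDeriv n l x
      + l * ((n : ℝ) / 2 - 1) * hypF n l x = 0 := by
  have hn0 : 0 < n := by omega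
  have := (hypFCoeff_unitSummable hn l).hypergeometric_ode
    (hypCoeff_succ (a := l) (b := 1 - (n : ℝ) / 2) (by positivity)) hx
  rw [hypF_eq_powSum]
  unfold hypFDeriv hypFDeriv2
  linear_combination this

/-- Euler's transformation of `hypF n l`.  It makes the positivity and the monotonicity of `hypF n l`
visible, its own series having coefficients of both signs. -/
theorem hypF_eq {x : ℝ} (hx : 0 ≤ x) (hx1 : x < 1) :
    hypF n l x = (1 - x) ^ (n - 1) * powSum (eulerCoeff ((n : ℝ) / 2 - 1) l) x := by
  obtain ⟨m, rfl⟩ : ∃ m, n = m + 3 := ⟨n - 3, by omega⟩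
  set k : ℝ := ((m + 3 : ℕ) : ℝ) / 2 - 1 with hkdef
  have hk2 : 2 * k = m + 1 := by rw [hkdef]; push_cast; ring
  have hk : 0 < k := by
    have : (0 : ℝ) ≤ m := Nat.cast_nonneg m
    linarith
  rw [show m + 3 - 1 = m + 2 from rfl]
  have ha := eulerCoeff_unitSummable hk l
  have hb := eulerDerivCoeff_unitSummable hk l
  set A := powSum (eulerCoeff k l)
  set B := powSum (eulerDerivCoeff k l)
  set B' := powSum (derivCoeff (eulerDerivCoeff k l))
  set E : ℝ → ℝ := fun y => (1 - y) ^ (m + 2) * A y with hE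
  set E' : ℝ → ℝ := fun y => -((1 - y) ^ (m + 1) * B y) with hE'
  have habs : ∀ y ∈ Set.Ico (0 : ℝ) 1, |y| < 1 := fun y hy => by
    rw [abs_of_nonneg hy.1]; exact hy.2
  have hsub : ∀ (p : ℕ) (y : ℝ), HasDerivAt (fun z : ℝ => (1 - z) ^ (p + 1))
      ((p + 1 : ℕ) * (1 - y) ^ p * (-1)) y := fun p y =>
    ((hasDerivAt_id y).const_sub 1).pow (p + 1)
  have hEd : ∀ y ∈ Set.Ico (0 : ℝ) 1, HasDerivAt E (E' y) y := by
    intro y hy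
    refine ((hsub (m + 1) y).mul (ha.hasDerivAt (habs y hy))).congr_deriv ?_
    have := one_sub_mul_deriv_euler hk l (habs y hy)
    rw [hk2] at this
    change _ = -((1 - y) ^ (m + 1) * B y)
    push_cast
    linear_combination (1 - y) ^ (m + 1) * this
  have hE'd : ∀ y ∈ Set.Ico (0 : ℝ) 1, HasDerivAt E'
      (-(((m + 1 : ℕ) * (1 - y) ^ m * (-1)) * B y + (1 - y) ^ (m + 1) * B' y)) y :=
    fun y hy => ((hsub m y).mul (hb.hasDerivAt (habs y hy))).neg
  have hEpos : ∀ y ∈ Set.Ico (0 : ℝ) 1, 0 < E y := by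
    intro y hy
    have h1 : (1 : ℝ) ≤ A y := by
      have := le_powSum ha (fun j => (eulerCoeff_pos hk l j).le) hy.1 hy.2
      rwa [eulerCoeff, hypCoeff_zero] at this
    have h2 : 0 < 1 - y := by linarith [hy.2]
    simp only [hE]
    positivity
  set F := hypF (m + 3) l
  have hFd : ∀ y ∈ Set.Ico (0 : ℝ) 1, HasDerivAt F (hypFDeriv (m + 3) l y) y :=
    fun y hy => hypF_hasDerivAt hn l (habs y hy)
  have hF'd : ∀ y ∈ Set.Ico (0 : ℝ) 1,
      HasDerivAt (hypFDeriv (m + 3) l) (hypFDeriv2 (m + 3) l y) y :=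
    fun y hy => hypFDeriv_hasDerivAt hn l (habs y hy)
  have hW : ∀ y ∈ Set.Ico (0 : ℝ) 1, hypFDeriv (m + 3) l y * E y - F y * E' y = 0 := by
    intro y hy
    refine wronskian_eq_zero (p := 2 * l + m + 1) (q := 2 * (m + 1))
      (w := fun y => hypFDeriv (m + 3) l y * E y - F y * E' y)
      (fun z hz => ((hF'd z hz).mul (hEd z hz)).sub ((hFd z hz).mul (hE'd z hz))) ?_ hy
    intro z hz
    have h1 := hypF_ode hn l (habs z hz)
    have h2 := eulerDeriv_ode hk l (habs z hz)
    simp only [hE, hE']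
    have hk3 : k = (m + 1) / 2 := by linarith
    have h3 : (l + (m + 1) / 2 + 1) * B z + z * B' z = l * ((m + 1) / 2) * A z := by
      rw [← hk3]
      exact h2
    push_cast at h1 ⊢
    linear_combination 2 * (1 - z) ^ (m + 2) * A z * h1 + 2 * F z * (1 - z) ^ (m + 2) * h3
  have hq : ∀ y ∈ Set.Ico (0 : ℝ) 1, HasDerivAt (fun z => F z / E z) 0 y := by
    intro y hy
    refine ((hFd y hy).div (hEd y hy) (hEpos y hy).ne').congr_deriv ?_
    rw [hW y hy, zero_div]
  have hc := constant_of_has_deriv_right_zero (f := fun z => F z / E z) (a := 0) (b := x)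
    (fun y hy => (hq y ⟨hy.1, hy.2.trans_lt hx1⟩).continuousAt.continuousWithinAt)
    (fun y hy => (hq y ⟨hy.1, hy.2.trans hx1⟩).hasDerivWithinAt) x (Set.right_mem_Icc.2 hx)
  have h0 : F 0 / E 0 = 1 := by
    have h1 : F 0 = 1 := by simp [F, hypF]
    have h2 : E 0 = 1 := by simp [hE, A, powSum_zero, eulerCoeff, hypCoeff_zero]
    rw [h1, h2, div_one]
  simp only [h0] at hc
  exact (div_eq_one_iff_eq (hEpos x ⟨hx, hx1⟩).ne').1 hc

theorem hypFDeriv_eq {x : ℝ} (hx : 0 < x) (hx1 : x < 1) :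
    hypFDeriv n l x = -((1 - x) ^ (n - 2) * powSum (eulerDerivCoeff ((n : ℝ) / 2 - 1) l) x) := by
  have hn' : (3 : ℝ) ≤ n := by exact_mod_cast hn
  have hk : 0 < (n : ℝ) / 2 - 1 := by linarith
  have habs : |x| < 1 := by rwa [abs_of_pos hx]
  have h1 : HasDerivAt (fun y => (1 - y) ^ (n - 1) * powSum (eulerCoeff ((n : ℝ) / 2 - 1) l) y)
      (hypFDeriv n l x) x := by
    refine (hypF_hasDerivAt hn l habs).congr_of_eventuallyEq ?_
    filter_upwards [Ioo_mem_nhds hx hx1] with y hy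
    exact (hypF_eq hn l hy.1.le hy.2).symm
  have h2 := (((hasDerivAt_id x).const_sub 1).pow (n - 1)).mul
    ((eulerCoeff_unitSummable hk l).hasDerivAt habs)
  rw [h1.unique h2]
  have h3 := one_sub_mul_deriv_euler hk l habs
  obtain ⟨m, rfl⟩ : ∃ m, n = m + 3 := ⟨n - 3, by omega⟩
  simp only [show m + 3 - 1 = m + 2 from rfl, show m + 2 - 1 = m + 1 from rfl,
    show m + 3 - 2 = m + 1 from rfl, id, Pi.pow_apply]
  push_cast at h3 ⊢
  linear_combination (1 - x) ^ (m + 1) * h3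

theorem hypF_ge {x : ℝ} (hx : 0 ≤ x) (hx1 : x < 1) : (1 - x) ^ (n - 1) ≤ hypF n l x := by
  have hn' : (3 : ℝ) ≤ n := by exact_mod_cast hn
  have hk : 0 < (n : ℝ) / 2 - 1 := by linarith
  rw [hypF_eq hn l hx hx1]
  have h1 := le_powSum (eulerCoeff_unitSummable hk l) (fun j => (eulerCoeff_pos hk l j).le) hx hx1
  rw [eulerCoeff, hypCoeff_zero] at h1
  exact le_mul_of_one_le_right (pow_nonneg (by linarith) _) h1

theorem hypF_pos {x : ℝ} (hx : 0 ≤ x) (hx1 : x < 1) : 0 < hypF n l x :=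
  (pow_pos (by linarith) _).trans_le (hypF_ge hn l hx hx1)

theorem hypF_continuousOn : ContinuousOn (hypF n l) (Set.Ico 0 1) := fun x hx =>
  (hypF_hasDerivAt hn l (by rw [abs_of_nonneg hx.1]; exact hx.2)).continuousAt.continuousWithinAt

theorem hypF_antitone : AntitoneOn (hypF n l) (Set.Ico 0 1) := by
  have hn' : (3 : ℝ) ≤ n := by exact_mod_cast hn
  have hk : 0 < (n : ℝ) / 2 - 1 := by linarith
  refine antitoneOn_of_deriv_nonpos (convex_Ico 0 1) (hypF_continuousOn hn l) ?_ ?_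
  · rw [interior_Ico]
    exact fun x hx => (hypF_hasDerivAt hn l
      (by rw [abs_of_pos hx.1]; exact hx.2)).differentiableAt.differentiableWithinAt
  · rw [interior_Ico]
    intro x hx
    rw [(hypF_hasDerivAt hn l (by rw [abs_of_pos hx.1]; exact hx.2)).deriv,
      hypFDeriv_eq hn l hx.1 hx.2, neg_nonpos]
    exact mul_nonneg (pow_nonneg (by linarith [hx.2]) _)
      (powSum_nonneg (eulerDerivCoeff_nonneg hk l) hx.1.le)

/-- The logarithmic derivative of `hypF n l` at `x` is at most `(n - 1) l / (1 + l (1 - x))` in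
absolute value. -/
theorem hypF_div_monotone :
    MonotoneOn (fun x => hypF n l x / (1 + l * (1 - x)) ^ (n - 1)) (Set.Ico 0 1) := by
  have hn' : (3 : ℝ) ≤ n := by exact_mod_cast hn
  set k : ℝ := (n : ℝ) / 2 - 1 with hkdef
  have hk : 0 < k := by linarith
  have hpos : ∀ x : ℝ, x < 1 → 0 < 1 + l * (1 - x) := fun x hx => by
    have : 0 < 1 - x := by linarith
    positivity
  have hd : ∀ x ∈ Set.Ioo (0 : ℝ) 1,
      HasDerivAt (fun x => hypF n l x / (1 + l * (1 - x)) ^ (n - 1))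
        ((hypFDeriv n l x * (1 + l * (1 - x)) ^ (n - 1) - hypF n l x *
          ((n - 1 : ℕ) * (1 + l * (1 - x)) ^ (n - 1 - 1) * (l * -1))) /
            ((1 + l * (1 - x)) ^ (n - 1)) ^ 2) x := by
    intro x hx
    exact (hypF_hasDerivAt hn l (by rw [abs_of_pos hx.1]; exact hx.2)).div
      (((((hasDerivAt_id x).const_sub 1).const_mul (l : ℝ)).const_add 1).pow (n - 1))
      (pow_ne_zero _ (hpos x hx.2).ne')
  refine monotoneOn_of_deriv_nonneg (convex_Ico 0 1) ?_ ?_ ?_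
  · refine (hypF_continuousOn hn l).div (by fun_prop) fun x hx => ?_
    exact pow_ne_zero _ (hpos x hx.2).ne'
  · rw [interior_Ico]
    exact fun x hx => (hd x hx).differentiableAt.differentiableWithinAt
  · rw [interior_Ico]
    intro x hx
    rw [(hd x hx).deriv]
    refine div_nonneg ?_ (by positivity)
    rw [hypFDeriv_eq hn l hx.1 hx.2, hypF_eq hn l hx.1.le hx.2]
    have h1 := eulerDeriv_le hk l hx.1.le hx.2
    have h2 := eulerDeriv_le' hk l hx.1.le hx.2
    set A := powSum (eulerCoeff k l) x
    set B := powSum (eulerDerivCoeff k l) x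
    have hx1 : 0 < 1 - x := by linarith [hx.2]
    have h3 : (1 + l * (1 - x)) * B ≤ (n - 1) * l * ((1 - x) * A) := by
      have h4 : l * (1 - x) * B ≤ l * (1 - x) * (k * A) := by gcongr
      have h5 : (n : ℝ) - 1 = 2 * k + 1 := by rw [hkdef]; ring
      rw [h5]
      linarith
    have h6 := hpos x hx.2
    obtain ⟨m, rfl⟩ : ∃ m, n = m + 3 := ⟨n - 3, by omega⟩
    simp only [show m + 3 - 1 = m + 2 from rfl, show m + 2 - 1 = m + 1 from rfl,
      show m + 3 - 2 = m + 1 from rfl]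
    push_cast at h3 ⊢
    have h7 : 0 ≤ (1 - x) ^ (m + 1) * (1 + l * (1 - x)) ^ (m + 1) *
        ((m + 3 - 1) * l * ((1 - x) * A) - (1 + l * (1 - x)) * B) :=
      mul_nonneg (by positivity) (by linarith)
    refine h7.trans_eq ?_
    ring

end HypF

/-! ### Gegenbauer polynomials -/

/-- The homogeneous Gegenbauer polynomial of degree `l` (`a` has degree one, `s` degree two), whose
value at `s = 1` is `C_l^lam(a)`, given by the three-term recurrence. -/
noncomputable def gegHom (lam a s : ℝ) : ℕ → ℝ
  | 0 => 1
  | 1 => 2 * lam * a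
  | l + 2 => (2 * (l + 1 + lam) * a * gegHom lam a s (l + 1)
      - (l + 2 * lam) * s * gegHom lam a s l) / (l + 2)

theorem gegHom_succ_succ (lam a s : ℝ) (l : ℕ) :
    (l + 2) * gegHom lam a s (l + 2) = 2 * (l + 1 + lam) * a * gegHom lam a s (l + 1)
      - (l + 2 * lam) * s * gegHom lam a s l := by
  rw [gegHom, mul_div_cancel₀]
  positivity

theorem gegHom_smul (lam a s r : ℝ) (l : ℕ) :
    gegHom lam (r * a) (r ^ 2 * s) l = r ^ l * gegHom lam a s l := by
  induction l using Nat.twoStepInduction with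
  | zero => simp [gegHom]
  | one => simp [gegHom]; ring
  | more l h1 h2 =>
    rw [gegHom, gegHom, h1, h2]
    ring

/-- The `k`-th term of the explicit formula for `gegHom (x / 2) s l`. -/
noncomputable def gegTerm (lam x s : ℝ) (l k : ℕ) : ℝ :=
  if 2 * k ≤ l then (-1 : ℝ) ^ k * (ascPochhammer ℝ (l - k)).eval lam /
      ((k.factorial : ℝ) * ((l - 2 * k).factorial : ℝ)) * x ^ (l - 2 * k) * s ^ k else 0

theorem gegTerm_zero_succ (lam x s : ℝ) (l : ℕ) :
    (l + 1) * gegTerm lam x s (l + 1) 0 = (l + lam) * x * gegTerm lam x s l 0 := by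
  have h3 : (l.factorial : ℝ) ≠ 0 := by positivity
  simp only [gegTerm, mul_zero, zero_le, if_true, Nat.sub_zero, pow_zero, one_mul, mul_one,
    ascPochhammer_succ_eval, Nat.factorial_succ, Nat.factorial_zero, Nat.cast_one]
  push_cast
  field_simp
  ring

theorem gegTerm_succ_succ (lam x s : ℝ) (l k : ℕ) :
    (l + 2) * gegTerm lam x s (l + 2) (k + 1) = (l + 1 + lam) * x * gegTerm lam x s (l + 1) (k + 1)
      - (l + 2 * lam) * s * gegTerm lam x s l k := by
  rcases lt_trichotomy l (2 * k) with h | rfl | h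
  · simp [gegTerm, show ¬ (2 * (k + 1) ≤ l + 2) by omega, show ¬ (2 * (k + 1) ≤ l + 1) by omega,
      show ¬ (2 * k ≤ l) by omega]
  · have h3 : (k.factorial : ℝ) ≠ 0 := by positivity
    simp only [gegTerm, show 2 * (k + 1) ≤ 2 * k + 2 by omega,
      show ¬ (2 * (k + 1) ≤ 2 * k + 1) by omega, le_refl, if_true, if_false,
      show 2 * k + 2 - (k + 1) = k + 1 by omega, show 2 * k - k = k by omega,
      show 2 * k + 2 - 2 * (k + 1) = 0 by omega, Nat.sub_self, ascPochhammer_succ_eval,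
      Nat.factorial_succ, Nat.factorial_zero]
    push_cast
    field_simp
    ring
  · obtain ⟨m, rfl⟩ : ∃ m, l = 2 * k + 1 + m := ⟨l - (2 * k + 1), by omega⟩
    have h3 : (k.factorial : ℝ) ≠ 0 := by positivity
    have h4 : (m.factorial : ℝ) ≠ 0 := by positivity
    simp only [gegTerm, show 2 * (k + 1) ≤ 2 * k + 1 + m + 2 by omega,
      show 2 * (k + 1) ≤ 2 * k + 1 + m + 1 by omega, show 2 * k ≤ 2 * k + 1 + m by omega, if_true,
      show 2 * k + 1 + m + 2 - (k + 1) = k + m + 1 + 1 by omega,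
      show 2 * k + 1 + m + 1 - (k + 1) = k + m + 1 by omega,
      show 2 * k + 1 + m - k = k + m + 1 by omega,
      show 2 * k + 1 + m + 2 - 2 * (k + 1) = m + 1 by omega,
      show 2 * k + 1 + m + 1 - 2 * (k + 1) = m by omega,
      show 2 * k + 1 + m - 2 * k = m + 1 by omega,
      ascPochhammer_succ_eval (k + m + 1), Nat.factorial_succ]
    push_cast
    field_simp
    ring

theorem gegHom_eq_sum (lam a s : ℝ) (l : ℕ) :
    ∀ M : ℕ, l < 2 * M → gegHom lam a s l = ∑ k ∈ Finset.range M, gegTerm lam (2 * a) s l k := by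
  induction l using Nat.twoStepInduction with
  | zero =>
    intro M hM
    rw [Finset.sum_eq_single_of_mem 0 (by simp; omega)]
    · simp [gegHom, gegTerm]
    · intro k _ hk
      simp [gegTerm, hk]
  | one =>
    intro M hM
    rw [Finset.sum_eq_single_of_mem 0 (by simp; omega)]
    · simp [gegHom, gegTerm]; ring
    · intro k _ hk
      simp [gegTerm, show ¬ 2 * k ≤ 1 by omega]
  | more l h1 h2 =>
    intro M hM
    obtain ⟨M, rfl⟩ : ∃ M', M = M' + 1 := ⟨M - 1, by omega⟩
    have h0 : (l : ℝ) + 2 ≠ 0 := by positivity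
    apply mul_left_cancel₀ h0
    rw [gegHom_succ_succ, h1 M (by omega), h2 (M + 1) (by omega), Finset.sum_range_succ',
      Finset.sum_range_succ', mul_add (_ * a), mul_add ((l : ℝ) + 2), Finset.mul_sum,
      Finset.mul_sum, Finset.mul_sum]
    have h3 := gegTerm_zero_succ lam (2 * a) s (l + 1)
    push_cast at h3
    simp only [gegTerm_succ_succ, Finset.sum_sub_distrib]
    have h4 : ∀ k, 2 * (l + 1 + lam) * a * gegTerm lam (2 * a) s (l + 1) (k + 1) =
      (l + 1 + lam) * (2 * a) * gegTerm lam (2 * a) s (l + 1) (k + 1) := fun k => by ring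
    simp only [h4]
    linear_combination -h3

theorem gegenbauerC_eq (lam t : ℝ) (l : ℕ) : gegenbauerC lam l t = gegHom lam t 1 l := by
  rw [gegHom_eq_sum lam t 1 l (l / 2 + 1) (by omega), gegenbauerC]
  refine Finset.sum_congr rfl fun k hk => ?_
  rw [Finset.mem_range] at hk
  simp [gegTerm, show 2 * k ≤ l by omega]

theorem pow_mul_gegenbauerC {n : ℕ} (lam : ℝ) (l : ℕ) (x ξ : EuclideanSpace ℝ (Fin n)) :
    ‖x‖ ^ l * gegenbauerC lam l ⟪‖x‖⁻¹ • x, ξ⟫ = gegHom lam ⟪x, ξ⟫ (‖x‖ ^ 2) l := by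
  rw [gegenbauerC_eq, ← gegHom_smul, mul_one]
  congr 1
  rcases eq_or_ne x 0 with rfl | hx
  · simp
  · rw [real_inner_smul_left, mul_inv_cancel_left₀ (norm_ne_zero_iff.2 hx)]

section Positivity

/-- The coefficients `(lam)_i / i!` of the binomial series `(1 - x) ^ (-lam)`. -/
noncomputable def binomCoeff (lam : ℝ) (i : ℕ) : ℝ :=
  (ascPochhammer ℝ i).eval lam / i.factorial

theorem binomCoeff_succ (lam : ℝ) (i : ℕ) :
    (i + 1) * binomCoeff lam (i + 1) = (lam + i) * binomCoeff lam i := by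
  have h3 : (i.factorial : ℝ) ≠ 0 := by positivity
  simp only [binomCoeff, ascPochhammer_succ_eval, Nat.factorial_succ]
  push_cast
  field_simp

theorem binomCoeff_pos {lam : ℝ} (h : 0 < lam) (i : ℕ) : 0 < binomCoeff lam i :=
  div_pos (ascPochhammer_pos i lam h) (by positivity)

/-- The formal power series `(1 - z X) ^ (-lam)`. -/
noncomputable def binomSeries (lam : ℝ) (z : ℂ) : PowerSeries ℂ :=
  PowerSeries.mk fun i => (binomCoeff lam i : ℂ) * z ^ i

open PowerSeries in
theorem binomSeries_deriv (lam : ℝ) (z : ℂ) :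
    (1 - C z * X) * derivative ℂ (binomSeries lam z) = C (lam * z) * binomSeries lam z := by
  ext i
  rw [sub_mul, one_mul, map_sub, mul_assoc, coeff_C_mul, coeff_C_mul]
  have h : ∀ i : ℕ, ((i : ℂ) + 1) * (binomCoeff lam (i + 1) : ℂ)
      = (lam + i) * (binomCoeff lam i : ℂ) := fun i => by exact_mod_cast binomCoeff_succ lam i
  rcases i with _ | i
  · have := h 0
    simp [binomSeries, coeff_derivative] at this ⊢
    linear_combination z * this
  · have := h (i + 1)
    simp only [binomSeries, coeff_succ_X_mul, coeff_derivative, coeff_mk]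
    push_cast at this ⊢
    linear_combination z ^ (i + 2) * this

open PowerSeries in
/-- The generating function of the Gegenbauer polynomials, split into two binomial series. -/
theorem gegHom_eq_coeff (lam : ℝ) {z w : ℂ} {a s : ℝ} (ha : z + w = 2 * a) (hs : z * w = s)
    (l : ℕ) : (gegHom lam a s l : ℂ) = coeff l (binomSeries lam z * binomSeries lam w) := by
  set G := binomSeries lam z * binomSeries lam w with hG
  have hd : (1 - C (z + w) * X + C (z * w) * (X * X)) * derivative ℂ G
      = C (lam * (z + w)) * G - C (2 * lam * (z * w)) * (X * G) := by
    have h1 := binomSeries_deriv lam z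
    have h2 := binomSeries_deriv lam w
    rw [hG, Derivation.leibniz]
    simp only [smul_eq_mul, map_add, map_mul] at h1 h2 ⊢
    have h3 : (C (2 : ℂ) : PowerSeries ℂ) = 2 := map_ofNat C 2
    rw [h3]
    linear_combination (1 - C w * X) * binomSeries lam w * h1 +
      (1 - C z * X) * binomSeries lam z * h2
  have hG0 : coeff 0 G = 1 := by
    simp [hG, binomSeries, binomCoeff]
  have hc : ∀ j, coeff j ((1 - C (z + w) * X + C (z * w) * (X * X)) * derivative ℂ G) =
      coeff j (C (lam * (z + w)) * G - C (2 * lam * (z * w)) * (X * G)) := fun j => by rw [hd]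
  simp only [add_mul, sub_mul, one_mul, map_add, map_sub, mul_assoc, coeff_C_mul] at hc
  induction l using Nat.twoStepInduction with
  | zero => simp [gegHom, hG0]
  | one =>
    have h := hc 0
    simp [coeff_derivative] at h
    have hG0' : constantCoeff G = 1 := by simpa using hG0
    rw [h, hG0', gegHom]
    push_cast
    linear_combination (-(lam : ℂ)) * ha
  | more l h1 h2 =>
    have h := hc (l + 1)
    have h0 : (l : ℂ) + 2 ≠ 0 := by
      have : ((l + 2 : ℕ) : ℂ) ≠ 0 := by exact_mod_cast (by omega : l + 2 ≠ 0)
      simpa using this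
    have h4 := gegHom_succ_succ lam a s l
    have h5 : ((l : ℂ) + 2) * (gegHom lam a s (l + 2) : ℂ) = 2 * (l + 1 + lam) * a *
        (gegHom lam a s (l + 1) : ℂ) - (l + 2 * lam) * s * (gegHom lam a s l : ℂ) := by
      exact_mod_cast h4
    have h6 : coeff (l + 1) (X * (X * derivative ℂ G)) = l * coeff l G := by
      rcases l with _ | l
      · simp
      · rw [coeff_succ_X_mul, coeff_succ_X_mul, coeff_derivative]
        push_cast
        ring
    rw [h6] at h
    simp only [coeff_succ_X_mul, coeff_derivative] at h
    apply mul_left_cancel₀ h0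
    rw [h5, h1, h2]
    push_cast at h
    have h7 : (s : ℂ) = z * w := hs.symm
    have h8 : (2 * a : ℂ) = z + w := ha.symm
    linear_combination (-(1 : ℂ)) * h + ((l + 1 + lam) * coeff (l + 1) G) * h8
      - ((l + 2 * lam) * coeff l G) * h7

/-- The Gegenbauer polynomials are combinations of cosines, with positive coefficients if
`lam > 0`. -/
theorem gegHom_cos (lam θ : ℝ) (l : ℕ) : gegHom lam (Real.cos θ) 1 l =
    ∑ p ∈ Finset.HasAntidiagonal.antidiagonal l,
      binomCoeff lam p.1 * binomCoeff lam p.2 * Real.cos (((p.1 : ℝ) - p.2) * θ) := by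
  have h := gegHom_eq_coeff lam (z := Complex.exp (θ * Complex.I))
    (w := Complex.exp (-θ * Complex.I)) (a := Real.cos θ) (s := 1) ?_ ?_ l
  · have h2 := congrArg Complex.re h
    rw [Complex.ofReal_re, PowerSeries.coeff_mul, Complex.re_sum] at h2
    rw [h2]
    refine Finset.sum_congr rfl fun p _ => ?_
    simp only [binomSeries, PowerSeries.coeff_mk]
    rw [mul_mul_mul_comm, ← Complex.ofReal_mul, ← Complex.exp_nat_mul, ← Complex.exp_nat_mul,
      ← Complex.exp_add, Complex.re_ofReal_mul]
    congr 1
    rw [show (p.1 : ℂ) * (θ * Complex.I) + p.2 * (-θ * Complex.I)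
      = (((p.1 : ℝ) - p.2) * θ : ℝ) * Complex.I by push_cast; ring, Complex.exp_ofReal_mul_I_re]
  · rw [Complex.ofReal_cos, Complex.two_cos]
  · rw [← Complex.exp_add]
    simp

theorem abs_sin_nat_mul_le (m : ℕ) (φ : ℝ) : |Real.sin (m * φ)| ≤ m * |Real.sin φ| := by
  induction m with
  | zero => simp
  | succ m ih =>
    push_cast
    rw [add_mul, one_mul, Real.sin_add]
    refine (abs_add_le _ _).trans ?_
    rw [abs_mul, abs_mul]
    have h1 := Real.abs_cos_le_one φ
    have h2 := Real.abs_cos_le_one (m * φ)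
    nlinarith [abs_nonneg (Real.sin φ), abs_nonneg (Real.sin (m * φ))]

theorem one_sub_cos_mul_le {m : ℝ} {l : ℕ} (hm : ∃ j : ℕ, |m| = j ∧ j ≤ l) (θ : ℝ) :
    1 - Real.cos (m * θ) ≤ l ^ 2 * (1 - Real.cos θ) := by
  obtain ⟨j, hj, hjl⟩ := hm
  have e : ∀ y : ℝ, 1 - Real.cos y = 2 * Real.sin (y / 2) ^ 2 := fun y => by
    have h1 := Real.cos_sq' (y / 2)
    have h2 := Real.cos_sq (y / 2)
    rw [mul_div_cancel₀ y two_ne_zero] at h2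
    linarith
  have h1 : Real.cos (m * θ) = Real.cos (j * θ) := by
    rw [← hj]
    rcases abs_choice m with h | h <;> rw [h]
    rw [neg_mul, Real.cos_neg]
  rw [h1, e, e, mul_div_assoc]
  have h2 := abs_sin_nat_mul_le j (θ / 2)
  have h3 : (j : ℝ) ≤ l := by exact_mod_cast hjl
  have h4 : |Real.sin (j * (θ / 2))| ≤ l * |Real.sin (θ / 2)| := h2.trans (by gcongr)
  have h5 := pow_le_pow_left₀ (abs_nonneg _) h4 2
  rw [mul_pow, sq_abs, sq_abs] at h5
  linarith

theorem gegHom_one_eq (lam : ℝ) (l : ℕ) : gegHom lam 1 1 l =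
    ∑ p ∈ Finset.HasAntidiagonal.antidiagonal l, binomCoeff lam p.1 * binomCoeff lam p.2 := by
  have := gegHom_cos lam 0 l
  simpa using this

variable {lam : ℝ} (hlam : 0 < lam) {t : ℝ} (ht : |t| ≤ 1) (l : ℕ)
include hlam

theorem gegHom_one_pos : 0 < gegHom lam 1 1 l := by
  rw [gegHom_one_eq]
  exact Finset.sum_pos (fun p _ => mul_pos (binomCoeff_pos hlam _) (binomCoeff_pos hlam _))
    ⟨(0, l), by simp⟩

include ht

theorem abs_gegHom_le : |gegHom lam t 1 l| ≤ gegHom lam 1 1 l := by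
  rw [← Real.cos_arccos (abs_le.1 ht).1 (abs_le.1 ht).2, gegHom_cos, gegHom_one_eq]
  refine (Finset.abs_sum_le_sum_abs _ _).trans (Finset.sum_le_sum fun p _ => ?_)
  have := mul_pos (binomCoeff_pos hlam p.1) (binomCoeff_pos hlam p.2)
  rw [abs_mul, abs_of_pos this]
  exact mul_le_of_le_one_right this.le (Real.abs_cos_le_one _)

/-- The decrease of a Gegenbauer polynomial away from its maximum at `1`. -/
theorem gegHom_one_sub_le :
    gegHom lam 1 1 l - gegHom lam t 1 l ≤ l ^ 2 * (1 - t) * gegHom lam 1 1 l := by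
  have h : gegHom lam t 1 l = gegHom lam (Real.cos (Real.arccos t)) 1 l := by
    rw [Real.cos_arccos (abs_le.1 ht).1 (abs_le.1 ht).2]
  rw [h, gegHom_cos, gegHom_one_eq, ← Finset.sum_sub_distrib, Finset.mul_sum]
  refine Finset.sum_le_sum fun p hp => ?_
  have := mul_pos (binomCoeff_pos hlam p.1) (binomCoeff_pos hlam p.2)
  rw [← mul_one_sub, mul_comm _ (binomCoeff lam p.1 * binomCoeff lam p.2)]
  gcongr
  have hp' := Finset.HasAntidiagonal.mem_antidiagonal.1 hp
  have := one_sub_cos_mul_le (m := (p.1 : ℝ) - p.2) (l := l) ?_ (Real.arccos t)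
  · rwa [Real.cos_arccos (abs_le.1 ht).1 (abs_le.1 ht).2] at this
  · rcases le_total p.1 p.2 with h | h
    · refine ⟨p.2 - p.1, ?_, by omega⟩
      rw [Nat.cast_sub h, abs_sub_comm, abs_of_nonneg]
      rw [sub_nonneg]
      exact_mod_cast h
    · refine ⟨p.1 - p.2, ?_, by omega⟩
      rw [Nat.cast_sub h, abs_of_nonneg]
      rw [sub_nonneg]
      exact_mod_cast h

end Positivity

theorem unitSummable_pow (m : ℕ) : UnitSummable fun l : ℕ => ((l : ℝ) + 1) ^ m := by
  have h : UnitSummable fun l : ℕ => (l : ℝ) ^ m := fun ρ h0 h1 =>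
    (summable_pow_mul_geometric_of_norm_lt_one m
      (by rwa [Real.norm_of_nonneg h0] : ‖ρ‖ < 1)).congr fun l => by
        rw [abs_of_nonneg (by positivity)]
  simpa using h.shift_left

/-- The power sums `∑ (l + 1) ^ p r ^ l` grow at most like `(1 - r) ^ (-p - 1)`. -/
theorem powSum_pow_le (p : ℕ) {r : ℝ} (hr : 0 ≤ r) (hr1 : r < 1) :
    powSum (fun l : ℕ => ((l : ℝ) + 1) ^ p) r ≤ p.factorial / (1 - r) ^ (p + 1) := by
  have hr' : ‖r‖ < 1 := by rwa [Real.norm_of_nonneg hr]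
  have h1 := (unitSummable_pow p).hasSum (x := r) hr'
  have h2 := ((summable_choose_mul_geometric_of_norm_lt_one p hr').hasSum).mul_left
    (p.factorial : ℝ)
  rw [tsum_choose_mul_geometric_of_norm_lt_one p hr', mul_one_div] at h2
  refine hasSum_le (fun l => ?_) h1 h2
  rw [← mul_assoc]
  refine mul_le_mul_of_nonneg_right ?_ (pow_nonneg hr l)
  have h3 : (l + 1) ^ p ≤ p.factorial * (l + p).choose p := by
    rw [← Nat.ascFactorial_eq_factorial_mul_choose]
    exact Nat.pow_succ_le_ascFactorial (l + 1) p
  exact_mod_cast h3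

section Generating

theorem gegHom_one_succ (lam : ℝ) (l : ℕ) :
    (l + 1) * gegHom lam 1 1 (l + 1) = (l + 2 * lam) * gegHom lam 1 1 l := by
  induction l with
  | zero => simp [gegHom]
  | succ l ih =>
    have h := gegHom_succ_succ lam 1 1 l
    push_cast
    linear_combination h + ih

variable {lam : ℝ} (hlam : 0 < lam)
include hlam

theorem gegHom_one_le {m : ℕ} (hm : 2 * lam ≤ m + 1) (l : ℕ) :
    gegHom lam 1 1 l ≤ ((l : ℝ) + 1) ^ m := by
  induction l with
  | zero => simp [gegHom]
  | succ l ih =>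
    have h := gegHom_one_succ lam l
    have h1 : (0 : ℝ) < l + 1 := by positivity
    have h2 := one_add_mul_le_pow (a := 1 / ((l : ℝ) + 1)) (by
      have : 0 < 1 / ((l : ℝ) + 1) := by positivity
      linarith) m
    have h3 : (1 + 1 / ((l : ℝ) + 1)) * (l + 1) = l + 1 + 1 := by field_simp
    have h4 : (l + 2 * lam) ≤ (l + 1) * (1 + 1 / ((l : ℝ) + 1)) ^ m := by
      have h5 : (l + 1) * (1 + m * (1 / ((l : ℝ) + 1))) = l + 1 + m := by field_simp
      nlinarith
    push_cast
    rw [← h3, mul_pow]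
    refine le_of_mul_le_mul_left ?_ h1
    rw [h]
    calc (l + 2 * lam) * gegHom lam 1 1 l
        ≤ ((l + 1) * (1 + 1 / ((l : ℝ) + 1)) ^ m) * (l + 1) ^ m :=
          mul_le_mul h4 ih (gegHom_one_pos hlam l).le (by positivity)
      _ = _ := by ring

variable {a : ℝ} (ha : |a| ≤ 1)
include ha

theorem gegHom_unitSummable : UnitSummable (gegHom lam a 1) := by
  obtain ⟨m, hm⟩ := exists_nat_ge (2 * lam)
  refine (unitSummable_pow m).of_abs_le fun l => ?_
  rw [abs_of_nonneg (by positivity : (0 : ℝ) ≤ ((l : ℝ) + 1) ^ m)]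
  exact (abs_gegHom_le hlam ha l).trans (gegHom_one_le hlam (by linarith) l)

theorem gegHom_ode {t : ℝ} (ht : |t| < 1) :
    (1 - 2 * a * t + t ^ 2) * powSum (derivCoeff (gegHom lam a 1)) t
      = 2 * lam * (a - t) * powSum (gegHom lam a 1) t := by
  have hs := gegHom_unitSummable hlam ha
  have h1 := hs.deriv.hasSum_mul_x ht
  have h2 := hs.deriv.shift_right.hasSum_mul_x ht
  rw [show powSum (fun j : ℕ => (if j = 0 then 0 else derivCoeff (gegHom lam a 1) (j - 1))) t
      = t * powSum (derivCoeff (gegHom lam a 1)) t from h1.tsum_eq] at h2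
  have key := (((hs.deriv.hasSum ht).sub (h1.mul_left (2 * a))).add h2).sub
    (((hs.hasSum ht).mul_left (2 * lam * a)).sub ((hs.hasSum_mul_x ht).mul_left (2 * lam)))
  have := key.unique (hasSum_zero.congr_fun ?_)
  · linear_combination this
  · intro j
    rcases j with _ | _ | j
    · simp [derivCoeff, gegHom]
    · have := gegHom_succ_succ lam a 1 0
      simp [derivCoeff] at this ⊢
      linear_combination t * this
    · have := gegHom_succ_succ lam a 1 (j + 1)
      simp [derivCoeff] at this ⊢
      linear_combination t ^ (j + 2) * this

omit hlam in
theorem one_sub_two_mul_add_sq_pos {t : ℝ} (ht : |t| < 1) : 0 < 1 - 2 * a * t + t ^ 2 := by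
  have h1 : a * t ≤ |t| := by
    calc a * t ≤ |a * t| := le_abs_self _
      _ = |a| * |t| := abs_mul a t
      _ ≤ 1 * |t| := by gcongr
      _ = |t| := one_mul _
  nlinarith [sq_abs t, pow_pos (sub_pos.2 ht) 2]

theorem powSum_gegHom {t : ℝ} (ht0 : 0 ≤ t) (ht1 : t < 1) :
    powSum (gegHom lam a 1) t = (1 - 2 * a * t + t ^ 2) ^ (-lam) := by
  set g := powSum (gegHom lam a 1) with hg
  have habs : ∀ y ∈ Set.Ico (0 : ℝ) 1, |y| < 1 := fun y hy => by
    rw [abs_of_nonneg hy.1]; exact hy.2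
  have hd : ∀ y ∈ Set.Ico (0 : ℝ) 1,
      HasDerivAt (fun z => g z * (1 - 2 * a * z + z ^ 2) ^ lam) 0 y := by
    intro y hy
    have hq := one_sub_two_mul_add_sq_pos ha (habs y hy)
    have h1 : HasDerivAt (fun z : ℝ => 1 - 2 * a * z + z ^ 2) (-(2 * a) + 2 * y) y := by
      have := (((hasDerivAt_id y).const_mul (2 * a)).const_sub 1).add (hasDerivAt_pow 2 y)
      refine this.congr_deriv ?_
      push_cast
      ring
    refine (((gegHom_unitSummable hlam ha).hasDerivAt (habs y hy)).mul
      (h1.rpow_const (p := lam) (Or.inl hq.ne'))).congr_deriv ?_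
    have h2 := gegHom_ode hlam ha (habs y hy)
    rw [Real.rpow_sub_one hq.ne']
    field_simp
    linear_combination (1 - 2 * a * y + y ^ 2) ^ lam * h2
  have hc := constant_of_has_deriv_right_zero (a := 0) (b := t)
    (fun y hy => (hd y ⟨hy.1, hy.2.trans_lt ht1⟩).continuousAt.continuousWithinAt)
    (fun y hy => (hd y ⟨hy.1, hy.2.trans ht1⟩).hasDerivWithinAt) t (Set.right_mem_Icc.2 ht0)
  have hq := one_sub_two_mul_add_sq_pos ha (habs t ⟨ht0, ht1⟩)
  rw [Real.rpow_neg hq.le]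
  simp [hg, powSum_zero, gegHom] at hc
  exact eq_inv_of_mul_eq_one_left hc

/-- The generating function of the zonal harmonics. -/
theorem hasSum_zonal {t : ℝ} (ht0 : 0 ≤ t) (ht1 : t < 1) :
    HasSum (fun l : ℕ => (l + lam) / lam * gegHom lam a 1 l * t ^ l)
      ((1 - t ^ 2) * (1 - 2 * a * t + t ^ 2) ^ (-(lam + 1))) := by
  have ht : |t| < 1 := by rwa [abs_of_nonneg ht0]
  have hs := gegHom_unitSummable hlam ha
  have hq := one_sub_two_mul_add_sq_pos ha ht
  have h1 := gegHom_ode hlam ha ht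
  have h2 := ((hs.deriv.hasSum_mul_x ht).mul_left (1 / lam)).add (hs.hasSum ht)
  convert! h2 using 1
  · funext j
    rcases j with _ | j <;> simp [derivCoeff] <;> field_simp
  · have h3 : powSum (derivCoeff (gegHom lam a 1)) t
        = 2 * lam * (a - t) * powSum (gegHom lam a 1) t / (1 - 2 * a * t + t ^ 2) := by
      rw [eq_div_iff hq.ne', ← h1]
      ring
    rw [h3, powSum_gegHom hlam ha ht0 ht1, neg_add, ← sub_eq_add_neg, Real.rpow_sub_one hq.ne']
    have hq' := hq.ne'
    generalize (1 - 2 * a * t + t ^ 2) ^ (-lam) = v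
    rw [mul_div_assoc', div_eq_iff hq', add_mul, mul_div_assoc', mul_div_assoc',
      div_mul_cancel₀ _ hq']
    field_simp
    ring

end Generating

/-! ### Second order calculus and the maximum principle -/

/-- `φ` is twice differentiable at `0`, with first derivative `p` and second derivative `q`. -/
def HasJetTwo (φ : ℝ → ℝ) (p q : ℝ) : Prop :=
  ∃ φ' : ℝ → ℝ, (∀ᶠ τ in 𝓝 0, HasDerivAt φ (φ' τ) τ) ∧ φ' 0 = p ∧ HasDerivAt φ' q 0

namespace HasJetTwo

variable {φ ψ : ℝ → ℝ} {p q p' q' : ℝ}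

theorem hasDerivAt (h : HasJetTwo φ p q) : HasDerivAt φ p 0 := by
  obtain ⟨φ', h1, rfl, -⟩ := h
  exact h1.self_of_nhds

theorem const (c : ℝ) : HasJetTwo (fun _ => c) 0 0 :=
  ⟨fun _ => 0, .of_forall fun τ => hasDerivAt_const τ c, rfl, hasDerivAt_const 0 0⟩

theorem add (h : HasJetTwo φ p q) (h' : HasJetTwo ψ p' q') :
    HasJetTwo (fun τ => φ τ + ψ τ) (p + p') (q + q') := by
  obtain ⟨φ', h1, rfl, h2⟩ := h
  obtain ⟨ψ', h1', rfl, h2'⟩ := h'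
  refine ⟨fun τ => φ' τ + ψ' τ, ?_, rfl, h2.add h2'⟩
  filter_upwards [h1, h1'] with τ a b using a.add b

theorem mul (h : HasJetTwo φ p q) (h' : HasJetTwo ψ p' q') :
    HasJetTwo (fun τ => φ τ * ψ τ) (p * ψ 0 + φ 0 * p') (q * ψ 0 + 2 * (p * p') + φ 0 * q') := by
  have d := h.hasDerivAt
  have d' := h'.hasDerivAt
  obtain ⟨φ', h1, rfl, h2⟩ := h
  obtain ⟨ψ', h1', rfl, h2'⟩ := h'
  refine ⟨fun τ => φ' τ * ψ τ + φ τ * ψ' τ, ?_, rfl, ?_⟩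
  · filter_upwards [h1, h1'] with τ a b using a.mul b
  · refine ((h2.mul d').add (d.mul h2')).congr_deriv ?_
    ring

theorem comp {χ χ' : ℝ → ℝ} {c : ℝ} (h : HasJetTwo φ p q)
    (hχ : ∀ᶠ y in 𝓝 (φ 0), HasDerivAt χ (χ' y) y) (hχ' : HasDerivAt χ' c (φ 0)) :
    HasJetTwo (fun τ => χ (φ τ)) (χ' (φ 0) * p) (c * p ^ 2 + χ' (φ 0) * q) := by
  have d := h.hasDerivAt
  obtain ⟨φ', h1, rfl, h2⟩ := h
  refine ⟨fun τ => χ' (φ τ) * φ' τ, ?_, rfl, ?_⟩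
  · filter_upwards [h1, d.continuousAt.eventually hχ] with τ a b using b.comp τ a
  · refine ((hχ'.comp 0 d).mul h2).congr_deriv ?_
    simp only [Function.comp]
    ring

theorem of_isLocalMax (h : HasJetTwo φ p q) (hm : IsLocalMax φ 0) : p = 0 ∧ q ≤ 0 := by
  have hp : p = 0 := hm.hasDerivAt_eq_zero h.hasDerivAt
  refine ⟨hp, ?_⟩
  by_contra! hq
  obtain ⟨φ', h1, h0, h2⟩ := h
  have e : deriv φ =ᶠ[𝓝 0] φ' := h1.mono fun τ h => h.deriv
  have hmin : IsLocalMin φ 0 := by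
    refine isLocalMin_of_deriv_deriv_pos ?_ ?_ h1.self_of_nhds.continuousAt
    · rwa [e.deriv_eq, h2.deriv]
    · rw [h1.self_of_nhds.deriv, h0, hp]
  have hc : φ =ᶠ[𝓝 0] fun _ => φ 0 := by
    filter_upwards [hm, hmin] with τ a b using le_antisymm a b
  have e2 : deriv φ =ᶠ[𝓝 0] fun _ => 0 := by
    filter_upwards [hc.eventuallyEq_nhds] with τ hτ
    rw [hτ.deriv_eq, deriv_const]
  have e3 := (e.symm.trans e2).deriv_eq
  rw [h2.deriv, deriv_const] at e3
  exact hq.ne' e3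

end HasJetTwo

/-- `f` is twice differentiable at `x` along the coordinate axes, with gradient `g` and
Laplacian `d`. -/
def HasGradLap {n : ℕ} (f : EuclideanSpace ℝ (Fin n) → ℝ) (x g : EuclideanSpace ℝ (Fin n))
    (d : ℝ) : Prop :=
  ∃ q : Fin n → ℝ,
    (∀ i, HasJetTwo (fun τ => f (x + τ • EuclideanSpace.single i 1)) (g i) (q i)) ∧ ∑ i, q i = d

namespace HasGradLap

variable {n : ℕ} {f h : EuclideanSpace ℝ (Fin n) → ℝ} {x g g' ξ : EuclideanSpace ℝ (Fin n)}
  {d d' : ℝ}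

theorem inner_eq_sum (g g' : EuclideanSpace ℝ (Fin n)) : ⟪g, g'⟫ = ∑ i, g i * g' i := by
  rw [PiLp.inner_apply]
  exact Finset.sum_congr rfl fun i _ => by simp [mul_comm]

theorem congr_values (hf : HasGradLap f x g d) (hg : g = g') (hd : d = d') :
    HasGradLap f x g' d' := hg ▸ hd ▸ hf

theorem const (c : ℝ) : HasGradLap (fun _ => c) x 0 0 :=
  ⟨fun _ => 0, fun _ => .const c, by simp⟩

theorem add (hf : HasGradLap f x g d) (hh : HasGradLap h x g' d') :
    HasGradLap (fun y => f y + h y) x (g + g') (d + d') := by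
  obtain ⟨q, h1, rfl⟩ := hf
  obtain ⟨q', h1', rfl⟩ := hh
  exact ⟨fun i => q i + q' i, fun i => (h1 i).add (h1' i), Finset.sum_add_distrib⟩

theorem mul (hf : HasGradLap f x g d) (hh : HasGradLap h x g' d') :
    HasGradLap (fun y => f y * h y) x (h x • g + f x • g') (d * h x + 2 * ⟪g, g'⟫ + f x * d') := by
  obtain ⟨q, h1, rfl⟩ := hf
  obtain ⟨q', h1', rfl⟩ := hh
  refine ⟨fun i => q i * h x + 2 * (g i * g' i) + f x * q' i, fun i => ?_, ?_⟩
  · have := (h1 i).mul (h1' i)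
    simp only [zero_smul, add_zero] at this
    simpa [mul_comm (h x)] using this
  · rw [inner_eq_sum, Finset.sum_add_distrib, Finset.sum_add_distrib, Finset.sum_mul,
      Finset.mul_sum, Finset.mul_sum]

theorem const_mul (hf : HasGradLap f x g d) (c : ℝ) :
    HasGradLap (fun y => c * f y) x (c • g) (c * d) := by
  refine ((const c).mul hf).congr_values ?_ ?_ <;> simp

theorem sub (hf : HasGradLap f x g d) (hh : HasGradLap h x g' d') :
    HasGradLap (fun y => f y - h y) x (g - g') (d - d') := by
  have := hf.add (hh.const_mul (-1))
  simp only [neg_one_mul, neg_one_smul, ← sub_eq_add_neg] at this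
  exact this

theorem comp {χ χ' : ℝ → ℝ} {c : ℝ} (hf : HasGradLap f x g d)
    (hχ : ∀ᶠ y in 𝓝 (f x), HasDerivAt χ (χ' y) y) (hχ' : HasDerivAt χ' c (f x)) :
    HasGradLap (fun y => χ (f y)) x (χ' (f x) • g) (c * ⟪g, g⟫ + χ' (f x) * d) := by
  obtain ⟨q, h1, rfl⟩ := hf
  refine ⟨fun i => c * g i ^ 2 + χ' (f x) * q i, fun i => ?_, ?_⟩
  · have := (h1 i).comp (χ := χ) (χ' := χ') (c := c) (by simpa using hχ) (by simpa using hχ')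
    simp only [zero_smul, add_zero] at this
    simpa using this
  · rw [inner_eq_sum, Finset.sum_add_distrib, Finset.mul_sum, Finset.mul_sum]
    simp only [sq]

theorem sum {ι : Type*} (s : Finset ι) {f : ι → EuclideanSpace ℝ (Fin n) → ℝ}
    {g : ι → EuclideanSpace ℝ (Fin n)} {d : ι → ℝ} (hf : ∀ i, HasGradLap (f i) x (g i) (d i)) :
    HasGradLap (fun y => ∑ i ∈ s, f i y) x (∑ i ∈ s, g i) (∑ i ∈ s, d i) := by
  classical
  induction s using Finset.induction_on with
  | empty => simpa using const 0
  | insert i s hi ih =>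
    simp only [Finset.sum_insert hi]
    exact (hf i).add ih

theorem inner_right (x ξ : EuclideanSpace ℝ (Fin n)) : HasGradLap (fun y => ⟪y, ξ⟫) x ξ 0 := by
  refine ⟨fun _ => 0, fun i => ⟨fun _ => ξ i, .of_forall fun τ => ?_, rfl, hasDerivAt_const 0 _⟩,
    by simp⟩
  have e : (fun τ : ℝ => ⟪x + τ • EuclideanSpace.single i 1, ξ⟫) = fun τ => ⟪x, ξ⟫ + τ * ξ i := by
    funext τ
    rw [inner_add_left, real_inner_smul_left, EuclideanSpace.inner_single_left]
    simp
  rw [e]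
  simpa using ((hasDerivAt_id τ).mul_const (ξ i)).const_add ⟪x, ξ⟫

theorem norm_sq (x : EuclideanSpace ℝ (Fin n)) :
    HasGradLap (fun y => ‖y‖ ^ 2) x ((2 : ℝ) • x) (2 * n) := by
  refine ⟨fun _ => 2, fun i => ⟨fun τ => 2 * x i + 2 * τ, .of_forall fun τ => ?_, by simp, ?_⟩,
    by simp [mul_comm]⟩
  · have e : (fun τ : ℝ => ‖x + τ • EuclideanSpace.single i 1‖ ^ 2)
        = fun τ => ‖x‖ ^ 2 + 2 * x i * τ + τ ^ 2 := by
      funext τ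
      rw [norm_add_sq_real, real_inner_smul_right, EuclideanSpace.inner_single_right, norm_smul,
        PiLp.norm_single]
      simp
      ring
    rw [e]
    refine ((((hasDerivAt_id τ).const_mul (2 * x i)).const_add (‖x‖ ^ 2)).add
      (hasDerivAt_pow 2 τ)).congr_deriv ?_
    simp
  · simpa using ((hasDerivAt_id (0 : ℝ)).const_mul 2).const_add (2 * x i)

theorem of_isLocalMax (hf : HasGradLap f x g d) (hm : IsLocalMax f x) : g = 0 ∧ d ≤ 0 := by
  obtain ⟨q, h1, rfl⟩ := hf
  have key : ∀ i, g i = 0 ∧ q i ≤ 0 := fun i => by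
    refine (h1 i).of_isLocalMax ?_
    have hc : Tendsto (fun τ : ℝ => x + τ • (EuclideanSpace.single i 1 : EuclideanSpace ℝ (Fin n)))
        (𝓝 0) (𝓝 x) := by
      have : ContinuousAt
        (fun τ : ℝ => x + τ • (EuclideanSpace.single i 1 : EuclideanSpace ℝ (Fin n))) 0 := by
        fun_prop
      simpa [ContinuousAt] using this
    filter_upwards [hc.eventually hm] with τ hτ
    simpa using hτ
  exact ⟨by ext i; exact (key i).1, Finset.sum_nonpos fun i _ => (key i).2⟩

end HasGradLap

/-- The weak maximum principle for `Δ + β x · ∇`, `β ≥ 0`. -/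
theorem le_of_subsolution {n : ℕ} (hn : 0 < n) {D : Set (EuclideanSpace ℝ (Fin n))}
    (hD : IsCompact D) {β u : EuclideanSpace ℝ (Fin n) → ℝ} (hβ : ∀ x ∈ interior D, 0 ≤ β x)
    (hu : ContinuousOn u D)
    (hL : ∀ x ∈ interior D, ∃ g d, HasGradLap u x g d ∧ 0 ≤ d + β x * ⟪x, g⟫) {M : ℝ}
    (hM : ∀ x ∈ D, x ∉ interior D → u x ≤ M) : ∀ x ∈ D, u x ≤ M := by
  intro x hx
  by_contra! hlt
  obtain ⟨R, hR0, hR⟩ := hD.isBounded.exists_pos_norm_le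
  set ε := (u x - M) / (2 * R ^ 2) with hε
  have hε0 : 0 < ε := div_pos (by linarith) (by positivity)
  -- adding `ε |x| ^ 2` makes the subsolution strict
  obtain ⟨z, hz, hzm⟩ := hD.exists_isMaxOn (f := fun y => u y + ε * ‖y‖ ^ 2) ⟨x, hx⟩
    (hu.add (by fun_prop))
  have hzx : u x ≤ u z + ε * ‖z‖ ^ 2 := by
    have h1 : u x + ε * ‖x‖ ^ 2 ≤ u z + ε * ‖z‖ ^ 2 := hzm hx
    have : 0 ≤ ε * ‖x‖ ^ 2 := by positivity
    linarith
  by_cases hzi : z ∈ interior D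
  · obtain ⟨g, d, h1, h2⟩ := hL z hzi
    have hloc : IsLocalMax (fun y => u y + ε * ‖y‖ ^ 2) z :=
      hzm.isLocalMax (mem_interior_iff_mem_nhds.1 hzi)
    obtain ⟨h3, h4⟩ := (h1.add ((HasGradLap.norm_sq z).const_mul ε)).of_isLocalMax hloc
    have h5 : g = -(ε • (2 : ℝ) • z) := eq_neg_of_add_eq_zero_left h3
    rw [h5, inner_neg_right, inner_smul_right, inner_smul_right, real_inner_self_eq_norm_sq] at h2
    have h6 : 0 ≤ β z * (ε * (2 * ‖z‖ ^ 2)) := mul_nonneg (hβ z hzi) (by positivity)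
    have h7 : 0 < ε * (2 * n) := by positivity
    linarith
  · have h1 := hM z hz hzi
    have h2 : ε * ‖z‖ ^ 2 ≤ ε * R ^ 2 := by
      have := hR z hz
      gcongr
    have h3 : ε * R ^ 2 = (u x - M) / 2 := by
      rw [hε]
      field_simp
    linarith

/-! ### Solutions of the equation -/

/-- The homogeneous Gegenbauer polynomials of `(⟪x, ξ⟫, |x| ^ 2)` are harmonic.  The two identities
for the gradient carry the induction on the degree along the three-term recurrence; the first one is
Euler's relation. -/
theorem gegHom_hasGradLap {n : ℕ} {ξ : EuclideanSpace ℝ (Fin n)} (hξ : ‖ξ‖ = 1)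
    (x : EuclideanSpace ℝ (Fin n)) {lam : ℝ} (hlam : 2 * lam = n - 2) (l : ℕ) :
    ∃ g, HasGradLap (fun y => gegHom lam ⟪y, ξ⟫ (‖y‖ ^ 2) l) x g 0 ∧
      ⟪x, g⟫ = l * gegHom lam ⟪x, ξ⟫ (‖x‖ ^ 2) l ∧
      ⟪ξ, g⟫ = if l = 0 then 0 else
        (l - 1 + 2 * lam) * gegHom lam ⟪x, ξ⟫ (‖x‖ ^ 2) (l - 1) := by
  have hξ2 : ⟪ξ, ξ⟫ = 1 := by rw [real_inner_self_eq_norm_sq, hξ, one_pow]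
  have hx2 : ⟪x, x⟫ = ‖x‖ ^ 2 := real_inner_self_eq_norm_sq x
  have hn : (n : ℝ) = 2 * lam + 2 := by linarith
  induction l using Nat.twoStepInduction with
  | zero =>
    refine ⟨0, ?_, by simp, by simp⟩
    simpa [gegHom] using HasGradLap.const (x := x) (1 : ℝ)
  | one =>
    refine ⟨(2 * lam) • ξ, ?_, ?_, ?_⟩
    · simpa [gegHom] using (HasGradLap.inner_right x ξ).const_mul (2 * lam)
    · simp [gegHom, inner_smul_right]
    · simp [gegHom, inner_smul_right, hξ]
  | more l h1 h2 =>
    obtain ⟨g, hg, hg1, hg2⟩ := h1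
    obtain ⟨g', hg', hg1', hg2'⟩ := h2
    have h0 : (l : ℝ) + 2 ≠ 0 := by positivity
    have hrec := gegHom_succ_succ lam ⟪x, ξ⟫ (‖x‖ ^ 2) l
    set H := gegHom lam ⟪x, ξ⟫ (‖x‖ ^ 2)
    have hA := (((HasGradLap.inner_right x ξ).mul hg').const_mul (2 * (l + 1 + lam))).sub
      (((HasGradLap.norm_sq x).mul hg).const_mul (l + 2 * lam))
    have hB := hA.const_mul (1 / (l + 2))
    rw [if_neg (by omega)] at hg2'
    push_cast at hg1' hg2'
    have hf : (fun y : EuclideanSpace ℝ (Fin n) => gegHom lam ⟪y, ξ⟫ (‖y‖ ^ 2) (l + 2)) =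
        fun y => 1 / ((l : ℝ) + 2) *
          (2 * (l + 1 + lam) * (⟪y, ξ⟫ * gegHom lam ⟪y, ξ⟫ (‖y‖ ^ 2) (l + 1))
            - (l + 2 * lam) * (‖y‖ ^ 2 * gegHom lam ⟪y, ξ⟫ (‖y‖ ^ 2) l)) := by
      funext y
      rw [gegHom]
      ring
    rw [hf]
    refine ⟨_, (hB.congr_values rfl ?_ : HasGradLap _ x _ 0), ?_, ?_⟩
    · rw [hg2', inner_smul_left, hg1, hn]
      simp
      right
      ring
    · simp only [inner_smul_right, inner_sub_right, inner_add_right, hg1', hg1, hx2]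
      push_cast
      field_simp
      linear_combination (-(l + 2 : ℝ)) * hrec
    · rw [if_neg (by omega), show l + 2 - 1 = l + 1 from rfl]
      simp only [inner_smul_right, inner_sub_right, inner_add_right, hg2', hg2, hξ2,
        real_inner_comm x ξ, show gegHom lam ⟪x, ξ⟫ (‖x‖ ^ 2) = H from rfl]
      push_cast
      rcases l with _ | l
      · have e1 : H 1 = 2 * lam * ⟪x, ξ⟫ := rfl
        have e0 : H 0 = 1 := rfl
        simp [e1, e0]
        ring
      · have hrec' := gegHom_succ_succ lam ⟪x, ξ⟫ (‖x‖ ^ 2) l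
        rw [if_neg (by omega), show l + 1 - 1 = l from rfl]
        change _ = 2 * (l + 1 + lam) * ⟪x, ξ⟫ * H (l + 1) - (l + 2 * lam) * ‖x‖ ^ 2 * H l at hrec'
        push_cast at h0 ⊢
        rw [one_div, inv_mul_eq_iff_eq_mul₀ h0]
        linear_combination (-(l + 1 + 2 * lam)) * hrec'

theorem HasGradLap.rpow {n : ℕ} {f : EuclideanSpace ℝ (Fin n) → ℝ}
    {x g : EuclideanSpace ℝ (Fin n)} {d : ℝ} (hf : HasGradLap f x g d) (h0 : 0 < f x) (p : ℝ) :
    HasGradLap (fun y => f y ^ p) x ((p * f x ^ p / f x) • g)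
      (p * (p - 1) * f x ^ p / f x ^ 2 * ⟪g, g⟫ + p * f x ^ p / f x * d) := by
  have h1 : ∀ᶠ y in 𝓝 (f x), HasDerivAt (fun y : ℝ => y ^ p) (p * y ^ (p - 1)) y := by
    filter_upwards [lt_mem_nhds h0] with y hy
    exact Real.hasDerivAt_rpow_const (Or.inl hy.ne')
  have h2 : HasDerivAt (fun y : ℝ => p * y ^ (p - 1)) (p * ((p - 1) * f x ^ (p - 1 - 1))) (f x) :=
    (Real.hasDerivAt_rpow_const (Or.inl h0.ne')).const_mul p
  refine (hf.comp h1 h2).congr_values ?_ ?_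
  · rw [Real.rpow_sub_one h0.ne', mul_div_assoc]
  · rw [Real.rpow_sub_one h0.ne', Real.rpow_sub_one h0.ne']
    field_simp

theorem hasGradLap_pole {n : ℕ} (t : ℝ) (x ξ : EuclideanSpace ℝ (Fin n)) :
    HasGradLap (fun y => 1 - 2 * t * ⟪y, ξ⟫ + t ^ 2 * ‖y‖ ^ 2) x
      ((2 * t ^ 2) • x - (2 * t) • ξ) (2 * n * t ^ 2) := by
  refine (((HasGradLap.const 1).sub ((HasGradLap.inner_right x ξ).const_mul (2 * t))).add
    ((HasGradLap.norm_sq x).const_mul (t ^ 2))).congr_values ?_ (by ring)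
  module

theorem hasGradLap_one_sub {n : ℕ} (t : ℝ) (x : EuclideanSpace ℝ (Fin n)) :
    HasGradLap (fun y => 1 - t ^ 2 * ‖y‖ ^ 2) x ((-2 * t ^ 2) • x) (-2 * n * t ^ 2) := by
  refine ((HasGradLap.const 1).sub ((HasGradLap.norm_sq x).const_mul (t ^ 2))).congr_values ?_
    (by ring)
  module

/-- The drift coefficient `β` of `D_δ = (1 - δ ^ 2 |x| ^ 2) ^ 2 (Δ + β x · ∇)`. -/
noncomputable def drift {n : ℕ} (δ : ℝ) (x : EuclideanSpace ℝ (Fin n)) : ℝ :=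
  2 * (n - 2) * δ ^ 2 / (1 - δ ^ 2 * ‖x‖ ^ 2)

/-- `u` is twice differentiable at `x` along the coordinate axes and `(Δ u + β x · ∇ u)(x) = v`,
where `β = drift δ`. -/
def HasOp {n : ℕ} (δ : ℝ) (u : EuclideanSpace ℝ (Fin n) → ℝ) (x : EuclideanSpace ℝ (Fin n))
    (v : ℝ) : Prop :=
  ∃ g d, HasGradLap u x g d ∧ d + drift δ x * ⟪x, g⟫ = v

namespace HasOp

variable {n : ℕ} {δ : ℝ} {u w : EuclideanSpace ℝ (Fin n) → ℝ} {x : EuclideanSpace ℝ (Fin n)}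
  {a b : ℝ}

theorem sub (hu : HasOp δ u x a) (hw : HasOp δ w x b) :
    HasOp δ (fun y => u y - w y) x (a - b) := by
  obtain ⟨g, d, h, rfl⟩ := hu
  obtain ⟨g', d', h', rfl⟩ := hw
  refine ⟨_, _, h.sub h', ?_⟩
  rw [inner_sub_right]
  ring

theorem const_mul (hu : HasOp δ u x a) (c : ℝ) : HasOp δ (fun y => c * u y) x (c * a) := by
  obtain ⟨g, d, h, rfl⟩ := hu
  refine ⟨_, _, h.const_mul c, ?_⟩
  rw [inner_smul_right]
  ring

theorem sum {ι : Type*} (s : Finset ι) {f : ι → EuclideanSpace ℝ (Fin n) → ℝ}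
    (hf : ∀ i, HasOp δ (f i) x 0) : HasOp δ (fun y => ∑ i ∈ s, f i y) x 0 := by
  choose g d h h0 using hf
  refine ⟨_, _, HasGradLap.sum s h, ?_⟩
  rw [inner_sum, Finset.mul_sum, ← Finset.sum_add_distrib]
  exact Finset.sum_eq_zero fun i _ => h0 i

end HasOp

section Solutions

variable {n : ℕ} {δ : ℝ} (hδ : 0 < δ) (hδ1 : δ < 1) {x ξ : EuclideanSpace ℝ (Fin n)}
  (hξ : ‖ξ‖ = 1)

theorem sq_mul_sq_lt_one {t : ℝ} (ht : 0 ≤ t) (ht1 : t < 1) (hx : ‖x‖ ≤ 1) :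
    t ^ 2 * ‖x‖ ^ 2 < 1 := by
  have h1 : ‖x‖ ^ 2 ≤ 1 := pow_le_one₀ (norm_nonneg x) hx
  have h2 : t ^ 2 < 1 := pow_lt_one₀ ht ht1 two_ne_zero
  nlinarith [sq_nonneg t]

include hξ in
theorem norm_smul_sub_sq (t : ℝ) : ‖t • x - ξ‖ ^ 2 = 1 - 2 * t * ⟪x, ξ⟫ + t ^ 2 * ‖x‖ ^ 2 := by
  rw [norm_sub_sq_real, norm_smul, mul_pow, Real.norm_eq_abs, sq_abs, real_inner_smul_left, hξ]
  ring

include hξ in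
theorem norm_smul_sub_pos {t : ℝ} (ht : 0 ≤ t) (ht1 : t < 1) (hx : ‖x‖ ≤ 1) :
    0 < ‖t • x - ξ‖ := by
  rw [norm_pos_iff, sub_ne_zero]
  intro h
  have h1 := congrArg norm h
  rw [norm_smul, hξ, Real.norm_of_nonneg ht] at h1
  nlinarith [norm_nonneg x]

include hξ in
theorem pole_pos {t : ℝ} (ht : 0 ≤ t) (ht1 : t < 1) (hx : ‖x‖ ≤ 1) :
    0 < 1 - 2 * t * ⟪x, ξ⟫ + t ^ 2 * ‖x‖ ^ 2 := by
  rw [← norm_smul_sub_sq hξ]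
  have := norm_smul_sub_pos hξ ht ht1 hx
  positivity

theorem drift_nonneg (hn : 3 ≤ n) (hδ : 0 < δ) (hδ1 : δ < 1) (hx : ‖x‖ ≤ 1) : 0 ≤ drift δ x := by
  have h1 := sq_mul_sq_lt_one hδ.le hδ1 hx
  have h2 : (3 : ℝ) ≤ n := by exact_mod_cast hn
  unfold drift
  apply div_nonneg _ (by linarith)
  have : (0 : ℝ) ≤ n - 2 := by linarith
  positivity

include hδ hδ1 hξ

/-- The terms of the expansion solve the equation `Δ u + β x · ∇ u = 0`: on a radial function times
a harmonic function of degree `l` it reduces to the hypergeometric equation. -/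
theorem hasOp_hypF_mul_gegHom (hn : 3 ≤ n) (hx : ‖x‖ < 1) (l : ℕ) :
    HasOp δ (fun y => hypF n l (δ ^ 2 * ‖y‖ ^ 2) *
      gegHom (((n : ℝ) - 2) / 2) ⟪y, ξ⟫ (‖y‖ ^ 2) l) x 0 := by
  obtain ⟨g, hg, hxg, -⟩ := gegHom_hasGradLap hξ x (lam := ((n : ℝ) - 2) / 2) (by ring) l
  have hX := sq_mul_sq_lt_one hδ.le hδ1 hx.le
  have habs : |δ ^ 2 * ‖x‖ ^ 2| < 1 := by rwa [abs_of_nonneg (by positivity)]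
  have hF := ((HasGradLap.norm_sq x).const_mul (δ ^ 2)).comp (χ := hypF n l)
    (χ' := hypFDeriv n l)
    (by
      filter_upwards [(isOpen_lt continuous_abs continuous_const).mem_nhds habs] with y hy
      exact hypF_hasDerivAt hn l hy)
    (hypFDeriv_hasDerivAt hn l habs)
  refine ⟨_, _, hF.mul hg, ?_⟩
  have hode := hypF_ode hn l habs
  simp only [inner_smul_right, inner_smul_left, inner_add_right, hxg, real_inner_self_eq_norm_sq,
    drift]
  have h0 : 1 - δ ^ 2 * ‖x‖ ^ 2 ≠ 0 := by linarith
  simp only [conj_trivial]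
  rw [div_mul_eq_mul_div, ← eq_neg_iff_add_eq_zero, eq_comm, neg_eq_iff_eq_neg, div_eq_iff h0]
  linear_combination (4 * δ ^ 2 * gegHom (((n : ℝ) - 2) / 2) ⟪x, ξ⟫ (‖x‖ ^ 2) l) * hode

omit hδ hδ1 in
/-- The Poisson kernel `(1 - t ^ 2 |x| ^ 2) / |t x - ξ| ^ n` is harmonic. -/
theorem hasGradLap_poisson {t : ℝ} (ht : 0 ≤ t) (ht1 : t < 1) (hx : ‖x‖ < 1) :
    ∃ g, HasGradLap (fun y => (1 - t ^ 2 * ‖y‖ ^ 2) *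
      (1 - 2 * t * ⟪y, ξ⟫ + t ^ 2 * ‖y‖ ^ 2) ^ (-(n : ℝ) / 2)) x g 0 := by
  have hq := pole_pos hξ ht ht1 hx.le
  refine ⟨_, ((hasGradLap_one_sub t x).mul ((hasGradLap_pole t x ξ).rpow hq _)).congr_values rfl ?_⟩
  have hξ2 : ⟪ξ, ξ⟫ = 1 := by rw [real_inner_self_eq_norm_sq, hξ, one_pow]
  simp only [inner_smul_right, inner_smul_left, inner_sub_right, inner_sub_left, hξ2,
    real_inner_self_eq_norm_sq, real_inner_comm x ξ, conj_trivial]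
  generalize (1 - 2 * t * ⟪x, ξ⟫ + t ^ 2 * ‖x‖ ^ 2) ^ (-(n : ℝ) / 2) = Q
  obtain ⟨q, hq'⟩ : ∃ q, q = 1 - 2 * t * ⟪x, ξ⟫ + t ^ 2 * ‖x‖ ^ 2 := ⟨_, rfl⟩
  rw [← hq'] at hq ⊢
  field_simp
  rw [hq']
  ring

/-- The power of `1 - δ ^ 2 |x| ^ 2` that removes the first order term of the equation leaves a
negative potential, so its product with a positive harmonic function is a supersolution. -/
theorem hasOp_rpow_mul_poisson (hn : 3 ≤ n) {t : ℝ} (ht : 0 ≤ t) (ht1 : t < 1) (hx : ‖x‖ < 1) :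
    ∃ v ≤ 0, HasOp δ (fun y => (1 - δ ^ 2 * ‖y‖ ^ 2) ^ ((n : ℝ) / 2 - 1) *
      ((1 - t ^ 2 * ‖y‖ ^ 2) *
        (1 - 2 * t * ⟪y, ξ⟫ + t ^ 2 * ‖y‖ ^ 2) ^ (-(n : ℝ) / 2))) x v := by
  obtain ⟨g, hg⟩ := hasGradLap_poisson hξ ht ht1 hx
  have hq := pole_pos hξ ht ht1 hx.le
  have hp := sq_mul_sq_lt_one ht ht1 hx.le
  have hP : 0 ≤ (1 - t ^ 2 * ‖x‖ ^ 2) *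
      (1 - 2 * t * ⟪x, ξ⟫ + t ^ 2 * ‖x‖ ^ 2) ^ (-(n : ℝ) / 2) :=
    mul_nonneg (by linarith) (Real.rpow_nonneg hq.le _)
  have hρ : 0 < 1 - δ ^ 2 * ‖x‖ ^ 2 := by linarith [sq_mul_sq_lt_one hδ.le hδ1 hx.le]
  have hn' : (3 : ℝ) ≤ n := by exact_mod_cast hn
  refine ⟨-(n * (n - 2) * δ ^ 2 / (1 - δ ^ 2 * ‖x‖ ^ 2) ^ 2 *
    (1 - δ ^ 2 * ‖x‖ ^ 2) ^ ((n : ℝ) / 2 - 1) * ((1 - t ^ 2 * ‖x‖ ^ 2) *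
      (1 - 2 * t * ⟪x, ξ⟫ + t ^ 2 * ‖x‖ ^ 2) ^ (-(n : ℝ) / 2))), ?_,
    _, _, ((hasGradLap_one_sub δ x).rpow hρ _).mul hg, ?_⟩
  · have h3 : (0 : ℝ) ≤ n - 2 := by linarith
    rw [neg_nonpos]
    positivity
  · simp only [inner_smul_right, inner_smul_left, inner_add_right, real_inner_self_eq_norm_sq,
      conj_trivial, drift]
    generalize (1 - t ^ 2 * ‖x‖ ^ 2) *
      (1 - 2 * t * ⟪x, ξ⟫ + t ^ 2 * ‖x‖ ^ 2) ^ (-(n : ℝ) / 2) = P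
    generalize (1 - δ ^ 2 * ‖x‖ ^ 2) ^ ((n : ℝ) / 2 - 1) = M
    have hρ' := hρ.ne'
    field_simp
    ring

/-- The Poisson kernel of hyperbolic space, rescaled, solves the equation. -/
theorem hasOp_hyperbolic (hx : ‖x‖ < 1) :
    HasOp δ (fun y => (1 - δ ^ 2 * ‖y‖ ^ 2) ^ ((n : ℝ) - 1) *
      (1 - 2 * δ * ⟪y, ξ⟫ + δ ^ 2 * ‖y‖ ^ 2) ^ (-((n : ℝ) - 1))) x 0 := by
  have hq := pole_pos hξ hδ.le hδ1 hx.le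
  have hρ : 0 < 1 - δ ^ 2 * ‖x‖ ^ 2 := by linarith [sq_mul_sq_lt_one hδ.le hδ1 hx.le]
  refine ⟨_, _, ((hasGradLap_one_sub δ x).rpow hρ _).mul ((hasGradLap_pole δ x ξ).rpow hq _), ?_⟩
  have hξ2 : ⟪ξ, ξ⟫ = 1 := by rw [real_inner_self_eq_norm_sq, hξ, one_pow]
  simp only [inner_smul_right, inner_smul_left, inner_sub_right, inner_sub_left, inner_add_right,
    hξ2, real_inner_self_eq_norm_sq, real_inner_comm x ξ, conj_trivial, drift]
  generalize (1 - 2 * δ * ⟪x, ξ⟫ + δ ^ 2 * ‖x‖ ^ 2) ^ (-((n : ℝ) - 1)) = Q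
  generalize (1 - δ ^ 2 * ‖x‖ ^ 2) ^ ((n : ℝ) - 1) = R
  obtain ⟨q, hq'⟩ : ∃ q, q = 1 - 2 * δ * ⟪x, ξ⟫ + δ ^ 2 * ‖x‖ ^ 2 := ⟨_, rfl⟩
  obtain ⟨ρ, hρ'⟩ : ∃ ρ, ρ = 1 - δ ^ 2 * ‖x‖ ^ 2 := ⟨_, rfl⟩
  rw [← hq'] at hq ⊢
  rw [← hρ'] at hρ ⊢
  field_simp
  rw [hq', hρ']
  ring

end Solutions

/-! ### The expansion of the Poisson kernel -/

section Expansion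

variable {n : ℕ} (hn : 3 ≤ n)

/-- The value of the zonal function of order `l` at its pole: the dimension of the space of
spherical harmonics of degree `l`. -/
noncomputable def zonalOne (n l : ℕ) : ℝ :=
  (l + ((n : ℝ) - 2) / 2) / (((n : ℝ) - 2) / 2) * gegHom (((n : ℝ) - 2) / 2) 1 1 l

theorem half_sub_pos {n : ℕ} (hn : 3 ≤ n) : 0 < ((n : ℝ) - 2) / 2 := by
  have : (3 : ℝ) ≤ n := by exact_mod_cast hn
  linarith

theorem poissonHTerm_eq (hn : 3 ≤ n) (δ : ℝ) (x ξ : EuclideanSpace ℝ (Fin n)) (l : ℕ) :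
    poissonHTerm δ x ξ l = hypF n l (δ ^ 2 * ‖x‖ ^ 2) / hypF n l (δ ^ 2) *
      ((l + ((n : ℝ) - 2) / 2) / (((n : ℝ) - 2) / 2) *
        gegHom (((n : ℝ) - 2) / 2) ⟪x, ξ⟫ (‖x‖ ^ 2) l) := by
  have h := half_sub_pos hn
  have h' : (n : ℝ) - 2 ≠ 0 := by linarith
  rw [← pow_mul_gegenbauerC, poissonHTerm, zonal]
  field_simp
  ring

include hn

theorem zonalOne_pos (l : ℕ) : 0 < zonalOne n l := by
  have h := half_sub_pos hn
  have := gegHom_one_pos h l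
  unfold zonalOne
  positivity

theorem zonalOne_summable {t : ℝ} (ht : 0 ≤ t) (ht1 : t < 1) :
    Summable fun l => zonalOne n l * t ^ l :=
  (hasSum_zonal (half_sub_pos hn) (a := 1) (by simp) ht ht1).summable

omit hn in
theorem abs_inner_le_one {x ξ : EuclideanSpace ℝ (Fin n)} (hξ : ‖ξ‖ = 1) :
    |⟪‖x‖⁻¹ • x, ξ⟫| ≤ 1 := by
  refine (abs_real_inner_le_norm _ _).trans ?_
  rw [hξ, mul_one, norm_smul, norm_inv, norm_norm]
  exact inv_mul_le_one

theorem abs_zonal_le {x ξ : EuclideanSpace ℝ (Fin n)} (hξ : ‖ξ‖ = 1) (l : ℕ) :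
    |(l + ((n : ℝ) - 2) / 2) / (((n : ℝ) - 2) / 2) *
        gegHom (((n : ℝ) - 2) / 2) ⟪x, ξ⟫ (‖x‖ ^ 2) l| ≤ zonalOne n l * ‖x‖ ^ l := by
  have h := half_sub_pos hn
  have h1 := abs_gegHom_le h (abs_inner_le_one (x := x) hξ) l
  rw [← pow_mul_gegenbauerC, gegenbauerC_eq, abs_mul, abs_mul, abs_of_pos (by positivity),
    abs_of_nonneg (pow_nonneg (norm_nonneg x) l), zonalOne, mul_assoc, mul_comm (‖x‖ ^ l)]
  gcongr

variable {δ : ℝ} (hδ : 0 < δ) (hδ1 : δ < 1) {x ξ : EuclideanSpace ℝ (Fin n)} (hξ : ‖ξ‖ = 1)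
include hδ hδ1

theorem hypF_ratio_bounds (hx : ‖x‖ ≤ 1) (l : ℕ) :
    1 ≤ hypF n l (δ ^ 2 * ‖x‖ ^ 2) / hypF n l (δ ^ 2) ∧
      hypF n l (δ ^ 2 * ‖x‖ ^ 2) / hypF n l (δ ^ 2) ≤ 1 / (1 - δ ^ 2) ^ (n - 1) := by
  have h2 : δ ^ 2 < 1 := pow_lt_one₀ hδ.le hδ1 two_ne_zero
  have h1 := sq_mul_sq_lt_one hδ.le hδ1 hx
  have h3 : δ ^ 2 * ‖x‖ ^ 2 ≤ δ ^ 2 :=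
    mul_le_of_le_one_right (sq_nonneg δ) (pow_le_one₀ (norm_nonneg x) hx)
  have hp := hypF_pos hn l (sq_nonneg δ) h2
  have m1 : (0 : ℝ) ∈ Set.Ico (0 : ℝ) 1 := by simp
  have m2 : δ ^ 2 * ‖x‖ ^ 2 ∈ Set.Ico (0 : ℝ) 1 := ⟨by positivity, h1⟩
  constructor
  · rw [one_le_div hp]
    exact hypF_antitone hn l m2 ⟨sq_nonneg δ, h2⟩ h3
  · refine div_le_div₀ zero_le_one ?_ (pow_pos (by linarith) _) (hypF_ge hn l (sq_nonneg δ) h2)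
    refine (hypF_antitone hn l m1 m2 m2.1).trans ?_
    simp [hypF]

include hξ

theorem abs_poissonHTerm_le (hx : ‖x‖ ≤ 1) (l : ℕ) :
    |poissonHTerm δ x ξ l| ≤ 1 / (1 - δ ^ 2) ^ (n - 1) * (zonalOne n l * ‖x‖ ^ l) := by
  obtain ⟨h1, h2⟩ := hypF_ratio_bounds hn hδ hδ1 hx l
  rw [poissonHTerm_eq hn, abs_mul, abs_of_pos (zero_lt_one.trans_le h1)]
  have := abs_zonal_le hn (x := x) hξ l
  refine mul_le_mul h2 this (abs_nonneg _) (zero_le_one.trans (h1.trans h2))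

theorem summable_abs_poissonHTerm (hx : ‖x‖ < 1) :
    Summable fun l => |poissonHTerm δ x ξ l| :=
  ((zonalOne_summable hn (norm_nonneg x) hx).mul_left _).of_nonneg_of_le (fun _ => abs_nonneg _)
    fun l => abs_poissonHTerm_le hn hδ hδ1 hξ hx.le l

omit hn hδ hδ1 hξ in
/-- The Abel regularization of the kernel `poissonH`: the solution of the equation whose boundary
values are those of the Euclidean Poisson kernel `x ↦ poissonE (t x) ξ`.  For `t < 1` it is
continuous on the closed ball. -/
noncomputable def poissonAbel (δ t : ℝ) (ξ x : EuclideanSpace ℝ (Fin n)) : ℝ :=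
  ∑' l, t ^ l * poissonHTerm δ x ξ l

theorem tendsto_poissonAbel (hx : ‖x‖ < 1) :
    Tendsto (fun t => poissonAbel δ t ξ x) (𝓝[<] 1) (𝓝 (poissonH δ x ξ)) := by
  refine tendsto_tsum_of_dominated_convergence (summable_abs_poissonHTerm hn hδ hδ1 hξ hx)
    (fun l => ?_) ?_
  · have : Tendsto (fun t : ℝ => t ^ l * poissonHTerm δ x ξ l) (𝓝 1)
        (𝓝 (1 ^ l * poissonHTerm δ x ξ l)) := by
      apply Continuous.tendsto
      fun_prop
    rw [one_pow, one_mul] at this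
    exact this.mono_left nhdsWithin_le_nhds
  · filter_upwards [Ioo_mem_nhdsLT zero_lt_one] with t ht l
    rw [norm_mul, norm_pow, Real.norm_of_nonneg ht.1.le, Real.norm_eq_abs]
    exact mul_le_of_le_one_left (abs_nonneg _) (pow_le_one₀ ht.1.le ht.2.le)

theorem tendstoUniformlyOn_poissonAbel {t : ℝ} (ht : 0 ≤ t) (ht1 : t < 1) :
    TendstoUniformlyOn (fun N x => ∑ l ∈ Finset.range N, t ^ l * poissonHTerm δ x ξ l)
      (poissonAbel δ t ξ) atTop (closedBall 0 1) := by
  refine tendstoUniformlyOn_tsum_nat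
    ((zonalOne_summable hn ht ht1).mul_left (1 / (1 - δ ^ 2) ^ (n - 1))) fun l x hx => ?_
  have hx' : ‖x‖ ≤ 1 := by simpa using hx
  have h1 := abs_poissonHTerm_le hn hδ hδ1 hξ hx' l
  have h2 : ‖x‖ ^ l ≤ 1 := pow_le_one₀ (norm_nonneg x) hx'
  have h3 := zonalOne_pos hn l
  have h4 : 0 ≤ 1 / (1 - δ ^ 2) ^ (n - 1) := by
    have : δ ^ 2 < 1 := pow_lt_one₀ hδ.le hδ1 two_ne_zero
    have : 0 ≤ 1 - δ ^ 2 := by linarith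
    positivity
  rw [norm_mul, norm_pow, Real.norm_of_nonneg ht, Real.norm_eq_abs]
  calc t ^ l * |poissonHTerm δ x ξ l|
      ≤ t ^ l * (1 / (1 - δ ^ 2) ^ (n - 1) * (zonalOne n l * 1)) := by
        gcongr
        exact h1.trans (by gcongr)
    _ = _ := by ring

omit hn hδ hδ1 hξ in
theorem continuous_gegHom (lam : ℝ) (ξ : EuclideanSpace ℝ (Fin n)) (l : ℕ) :
    Continuous fun x : EuclideanSpace ℝ (Fin n) => gegHom lam ⟪x, ξ⟫ (‖x‖ ^ 2) l := by
  induction l using Nat.twoStepInduction with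
  | zero => simpa [gegHom] using continuous_const
  | one => simp only [gegHom]; fun_prop
  | more l h h' =>
    simp only [gegHom]
    fun_prop

omit hξ in
theorem continuousOn_poissonHTerm (l : ℕ) :
    ContinuousOn (fun x => poissonHTerm δ x ξ l) (closedBall 0 1) := by
  have h1 : ContinuousOn (fun x : EuclideanSpace ℝ (Fin n) => hypF n l (δ ^ 2 * ‖x‖ ^ 2))
      (closedBall 0 1) := by
    refine (hypF_continuousOn hn l).comp (by fun_prop) fun x hx => ?_
    exact ⟨by positivity, sq_mul_sq_lt_one hδ.le hδ1 (by simpa using hx)⟩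
  simp only [poissonHTerm_eq hn]
  exact (h1.div_const _).mul ((continuous_gegHom _ ξ l).const_mul _).continuousOn

theorem hasOp_poissonHTerm (hx : ‖x‖ < 1) (l : ℕ) :
    HasOp δ (fun y => poissonHTerm δ y ξ l) x 0 := by
  have h := (hasOp_hypF_mul_gegHom hδ hδ1 hξ hn hx l).const_mul
    ((l + ((n : ℝ) - 2) / 2) / (((n : ℝ) - 2) / 2) / hypF n l (δ ^ 2))
  rw [mul_zero] at h
  convert h using 2 with y
  rw [poissonHTerm_eq hn]
  ring

/-- Comparison with supersolutions, for the regularized kernel and for its negative. -/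
theorem mul_poissonAbel_le {t : ℝ} (ht : 0 ≤ t) (ht1 : t < 1) {c : ℝ} (hc : |c| ≤ 1)
    {D : Set (EuclideanSpace ℝ (Fin n))} (hD : IsCompact D) (hD1 : D ⊆ closedBall 0 1)
    {W : EuclideanSpace ℝ (Fin n) → ℝ} (hW : ContinuousOn W D)
    (hWop : ∀ x ∈ interior D, ∃ v ≤ 0, HasOp δ W x v)
    (hb : ∀ x ∈ D, x ∉ interior D → c * poissonAbel δ t ξ x ≤ W x) :
    ∀ x ∈ D, c * poissonAbel δ t ξ x ≤ W x := by
  intro x hx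
  refine le_of_forall_pos_le_add fun ε hε => ?_
  have hunif := Metric.tendstoUniformlyOn_iff.1
    (tendstoUniformlyOn_poissonAbel hn hδ hδ1 hξ ht ht1) (ε / 2) (half_pos hε)
  obtain ⟨N, hN⟩ := hunif.exists
  set S : EuclideanSpace ℝ (Fin n) → ℝ :=
    fun x => ∑ l ∈ Finset.range N, t ^ l * poissonHTerm δ x ξ l with hS
  have hSU : ∀ y ∈ D, |c * poissonAbel δ t ξ y - c * S y| ≤ ε / 2 := fun y hy => by
    have h1 := (hN y (hD1 hy)).le
    rw [Real.dist_eq] at h1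
    rw [← mul_sub, abs_mul]
    exact (mul_le_of_le_one_left (abs_nonneg _) hc).trans h1
  have hint : interior D ⊆ ball 0 1 := by
    refine (interior_mono hD1).trans ?_
    rw [interior_closedBall _ one_ne_zero]
  have key := le_of_subsolution (by omega : 0 < n) hD (β := drift δ)
    (u := fun y => c * S y - W y) (M := ε / 2)
    (fun y hy => drift_nonneg hn hδ hδ1 (by
      have := hint hy
      rw [mem_ball_zero_iff] at this
      exact this.le)) ?_ ?_ ?_ x hx
  · have := abs_le.1 (hSU x hx)
    linarith
  · refine ContinuousOn.sub (ContinuousOn.const_mul ?_ _) hW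
    exact continuousOn_finsetSum _ fun l _ =>
      ((continuousOn_poissonHTerm hn hδ hδ1 l).mono hD1).const_mul _
  · intro y hy
    have hy1 : ‖y‖ < 1 := by simpa using hint hy
    obtain ⟨v, hv, hv'⟩ := hWop y hy
    have h1 : HasOp δ S y 0 := HasOp.sum _ fun l => by
      have := (hasOp_poissonHTerm hn hδ hδ1 hξ hy1 l).const_mul (t ^ l)
      rwa [mul_zero] at this
    obtain ⟨g, d, h2, h3⟩ := (h1.const_mul c).sub hv'
    exact ⟨g, d, h2, by linarith⟩
  · intro y hy hy'
    have h1 := hb y hy hy'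
    have := abs_le.1 (hSU y hy)
    linarith

/-- On the unit sphere the regularized kernel is an explicit Poisson kernel. -/
theorem poissonAbel_sphere {t : ℝ} (ht : 0 ≤ t) (ht1 : t < 1) (hx : ‖x‖ = 1) :
    poissonAbel δ t ξ x = (1 - t ^ 2) * (1 - 2 * t * ⟪x, ξ⟫ + t ^ 2) ^ (-(n : ℝ) / 2) := by
  have hin : |⟪x, ξ⟫| ≤ 1 := by
    refine (abs_real_inner_le_norm _ _).trans ?_
    rw [hx, hξ, one_mul]
  have h := hasSum_zonal (half_sub_pos hn) hin ht ht1
  have h2 : δ ^ 2 < 1 := pow_lt_one₀ hδ.le hδ1 two_ne_zero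
  rw [show -(((n : ℝ) - 2) / 2 + 1) = -(n : ℝ) / 2 by ring,
    show 1 - 2 * ⟪x, ξ⟫ * t + t ^ 2 = 1 - 2 * t * ⟪x, ξ⟫ + t ^ 2 by ring] at h
  rw [← h.tsum_eq, poissonAbel]
  refine tsum_congr fun l => ?_
  rw [poissonHTerm_eq hn, hx, one_pow, mul_one, div_self (hypF_pos hn l (sq_nonneg δ) h2).ne']
  ring

end Expansion

/-! ### Two-sided control of the kernel -/

section Bounds

variable {n : ℕ} (hn : 3 ≤ n) {δ : ℝ} (hδ : 0 < δ) (hδ1 : δ < 1)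
  {x ξ : EuclideanSpace ℝ (Fin n)} (hξ : ‖ξ‖ = 1)

theorem continuousOn_pole_rpow {t : ℝ} (ht : 0 ≤ t) (ht1 : t < 1) (hξ : ‖ξ‖ = 1) (p : ℝ) :
    ContinuousOn (fun y : EuclideanSpace ℝ (Fin n) =>
      (1 - 2 * t * ⟪y, ξ⟫ + t ^ 2 * ‖y‖ ^ 2) ^ p) (closedBall 0 1) := by
  refine ContinuousOn.rpow_const (by fun_prop) fun y hy => Or.inl ?_
  exact (pole_pos hξ ht ht1 (by simpa using hy)).ne'

theorem continuousOn_one_sub_rpow {t : ℝ} (ht : 0 ≤ t) (ht1 : t < 1) (p : ℝ) :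
    ContinuousOn (fun y : EuclideanSpace ℝ (Fin n) => (1 - t ^ 2 * ‖y‖ ^ 2) ^ p)
      (closedBall 0 1) := by
  refine ContinuousOn.rpow_const (by fun_prop) fun y hy => Or.inl ?_
  have := sq_mul_sq_lt_one ht ht1 (x := y) (by simpa using hy)
  linarith

theorem pole_rpow_neg_half (t : ℝ) (hξ : ‖ξ‖ = 1) :
    (1 - 2 * t * ⟪x, ξ⟫ + t ^ 2 * ‖x‖ ^ 2) ^ (-(n : ℝ) / 2) = 1 / ‖t • x - ξ‖ ^ n := by
  rw [← norm_smul_sub_sq hξ, ← Real.rpow_natCast _ 2, ← Real.rpow_mul (norm_nonneg _),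
    show ((2 : ℕ) : ℝ) * (-(n : ℝ) / 2) = -(n : ℝ) by push_cast; ring,
    Real.rpow_neg (norm_nonneg _), Real.rpow_natCast, one_div]

theorem norm_sub_le_norm_smul_sub {t : ℝ} (ht1 : t ≤ 1) (hx : ‖x‖ ≤ 1) :
    ‖x - ξ‖ - (1 - t) ≤ ‖t • x - ξ‖ := by
  have h1 : ‖x - ξ‖ ≤ ‖t • x - ξ‖ + ‖(1 - t) • x‖ := by
    calc ‖x - ξ‖ = ‖(t • x - ξ) + (1 - t) • x‖ := by congr 1; module
      _ ≤ _ := norm_add_le _ _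
  rw [norm_smul, Real.norm_of_nonneg (by linarith)] at h1
  nlinarith [norm_nonneg x]

include hn hδ hδ1 hξ

theorem poissonAbel_nonneg {t : ℝ} (ht : 0 ≤ t) (ht1 : t < 1) (hx : ‖x‖ ≤ 1) :
    0 ≤ poissonAbel δ t ξ x := by
  have := mul_poissonAbel_le hn hδ hδ1 hξ ht ht1 (c := -1) (by simp)
    (isCompact_closedBall (0 : EuclideanSpace ℝ (Fin n)) 1) subset_rfl (W := fun _ => 0)
    continuousOn_const (fun x _ => ⟨0, le_rfl, 0, 0, HasGradLap.const 0, by simp⟩) ?_ x (by simpa)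
  · linarith
  · intro y hy hy'
    rw [interior_closedBall _ one_ne_zero] at hy'
    simp only [mem_closedBall_zero_iff, mem_ball_zero_iff, not_lt] at hy hy'
    rw [poissonAbel_sphere hn hδ hδ1 hξ ht ht1 (le_antisymm hy hy')]
    have h1 := pole_pos hξ ht ht1 hy
    rw [le_antisymm hy hy', one_pow, mul_one] at h1
    have h2 : t ^ 2 < 1 := pow_lt_one₀ ht ht1 two_ne_zero
    have h3 : 0 ≤ (1 - t ^ 2) * (1 - 2 * t * ⟪y, ξ⟫ + t ^ 2) ^ (-(n : ℝ) / 2) :=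
      mul_nonneg (by linarith) (Real.rpow_nonneg h1.le _)
    linarith

/-- The right-hand side is a supersolution with the boundary values of the regularized kernel.  Its
first factor is bounded in the layer `1 - |x| ≤ 1 - δ`. -/
theorem poissonAbel_le {t : ℝ} (ht : 0 ≤ t) (ht1 : t < 1) (hx : ‖x‖ ≤ 1) :
    poissonAbel δ t ξ x ≤ ((1 - δ ^ 2 * ‖x‖ ^ 2) / (1 - δ ^ 2)) ^ ((n : ℝ) / 2 - 1) *
      ((1 - t ^ 2 * ‖x‖ ^ 2) / ‖t • x - ξ‖ ^ n) := by
  have h2 : 0 < 1 - δ ^ 2 := by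
    have := pow_lt_one₀ hδ.le hδ1 two_ne_zero
    linarith
  have hpos := Real.rpow_pos_of_pos h2 ((n : ℝ) / 2 - 1)
  have key := mul_poissonAbel_le hn hδ hδ1 hξ ht ht1 (c := 1) (by simp)
    (isCompact_closedBall (0 : EuclideanSpace ℝ (Fin n)) 1) subset_rfl
    (W := fun y => ((1 - δ ^ 2) ^ ((n : ℝ) / 2 - 1))⁻¹ *
      ((1 - δ ^ 2 * ‖y‖ ^ 2) ^ ((n : ℝ) / 2 - 1) * ((1 - t ^ 2 * ‖y‖ ^ 2) *
        (1 - 2 * t * ⟪y, ξ⟫ + t ^ 2 * ‖y‖ ^ 2) ^ (-(n : ℝ) / 2)))) ?_ ?_ ?_ x (by simpa)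
  · rw [one_mul, pole_rpow_neg_half t hξ, mul_one_div, ← mul_assoc] at key
    rwa [Real.div_rpow (by linarith [sq_mul_sq_lt_one hδ.le hδ1 hx]) h2.le, div_eq_inv_mul]
  · exact ((continuousOn_one_sub_rpow hδ.le hδ1 _).mul (ContinuousOn.mul (by fun_prop)
      (continuousOn_pole_rpow ht ht1 hξ _))).const_mul _
  · intro y hy
    rw [interior_closedBall _ one_ne_zero, mem_ball_zero_iff] at hy
    obtain ⟨v, hv, hv'⟩ := hasOp_rpow_mul_poisson hδ hδ1 hξ hn ht ht1 hy
    exact ⟨_, mul_nonpos_of_nonneg_of_nonpos (inv_pos.2 hpos).le hv, hv'.const_mul _⟩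
  · intro y hy hy'
    rw [interior_closedBall _ one_ne_zero] at hy'
    simp only [mem_closedBall_zero_iff, mem_ball_zero_iff, not_lt] at hy hy'
    have hy1 := le_antisymm hy hy'
    rw [poissonAbel_sphere hn hδ hδ1 hξ ht ht1 hy1, hy1, one_mul, one_pow, mul_one, mul_one,
      inv_mul_cancel_left₀ hpos.ne']

omit hn hδ hξ in
theorem one_sub_sq_ratio_le (hδ : 0 < δ) (hx : ‖x‖ ≤ 1) (hx1 : 1 - ‖x‖ ≤ 1 - δ) :
    0 ≤ (1 - δ ^ 2 * ‖x‖ ^ 2) / (1 - δ ^ 2) ∧ (1 - δ ^ 2 * ‖x‖ ^ 2) / (1 - δ ^ 2) ≤ 4 := by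
  have h2 : 0 < 1 - δ ^ 2 := by
    have := pow_lt_one₀ hδ.le hδ1 two_ne_zero
    linarith
  have h3 := sq_mul_sq_lt_one hδ.le hδ1 hx
  refine ⟨div_nonneg (by linarith) h2.le, ?_⟩
  rw [div_le_iff₀ h2]
  have h4 : δ ≤ ‖x‖ := by linarith
  have h5 : δ ^ 2 * δ ^ 2 ≤ δ ^ 2 * ‖x‖ ^ 2 := by gcongr
  nlinarith

/-- At distance `1 - δ` from the pole the regularized kernel is bounded by the rescaled hyperbolic
Poisson kernel. -/
theorem poissonAbel_le_of_norm_sub_eq {t : ℝ} (ht : 0 ≤ t) (ht1 : t < 1)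
    (htκ : 1 - t ≤ (1 - δ) / 2) {y : EuclideanSpace ℝ (Fin n)} (hy1 : ‖y‖ ≤ 1)
    (hyκ' : ‖y - ξ‖ = 1 - δ) :
    poissonAbel δ t ξ y ≤ (4 : ℝ) ^ ((n : ℝ) / 2 - 1) * 2 * 8 ^ (n - 1) *
      ((1 - δ ^ 2 * ‖y‖ ^ 2) / ‖δ • y - ξ‖ ^ 2) ^ (n - 1) := by
  set κ := 1 - δ with hκ
  have hκ0 : 0 < κ := by linarith
  have hn1 : 1 ≤ n := by omega
  have hty := norm_sub_le_norm_smul_sub (ξ := ξ) ht1.le hy1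
  have hty2 : κ / 2 ≤ ‖t • y - ξ‖ := by linarith
  set A : ℝ := (4 : ℝ) ^ ((n : ℝ) / 2 - 1) * 2 * 8 ^ (n - 1) with hA
  have hA0 : 0 < A := by positivity
  set K := ((1 - δ ^ 2 * ‖y‖ ^ 2) / ‖δ • y - ξ‖ ^ 2) ^ (n - 1)
  have hy3 : 1 - ‖y‖ ≤ 1 - δ := by
    have := norm_sub_norm_le ξ y
    rw [norm_sub_rev, hξ] at this
    linarith
  have h1 := poissonAbel_le hn hδ hδ1 hξ ht ht1 hy1
  obtain ⟨r0, r1⟩ := one_sub_sq_ratio_le hδ1 hδ hy1 hy3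
  have hk : 0 ≤ (n : ℝ) / 2 - 1 := by linarith [half_sub_pos hn]
  have h2 := Real.rpow_le_rpow r0 r1 hk
  have hty0 : 0 < ‖t • y - ξ‖ := by linarith
  have hty1 : 1 - t * ‖y‖ ≤ ‖t • y - ξ‖ := by
    have := norm_sub_norm_le ξ (t • y)
    rwa [norm_sub_rev, hξ, norm_smul, Real.norm_of_nonneg ht] at this
  have hty3 : 0 ≤ t * ‖y‖ := by positivity
  have hty4 : t * ‖y‖ < 1 := by nlinarith [norm_nonneg y]
  have h3 : (1 - t ^ 2 * ‖y‖ ^ 2) / ‖t • y - ξ‖ ^ n ≤ 2 * (2 / κ) ^ (n - 1) := by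
    have e : ‖t • y - ξ‖ ^ n = ‖t • y - ξ‖ ^ (n - 1) * ‖t • y - ξ‖ := by
      rw [← pow_succ, Nat.sub_add_cancel hn1]
    rw [div_le_iff₀ (by positivity), e]
    have h4 : 1 ≤ (2 / κ) ^ (n - 1) * ‖t • y - ξ‖ ^ (n - 1) := by
      rw [← mul_pow]
      refine one_le_pow₀ ?_
      rw [div_mul_eq_mul_div, le_div_iff₀ hκ0]
      linarith
    have h5 : 1 - t ^ 2 * ‖y‖ ^ 2 ≤ 2 * ‖t • y - ξ‖ := by
      have : 1 - t ^ 2 * ‖y‖ ^ 2 = 2 * (1 - t * ‖y‖) - (1 - t * ‖y‖) ^ 2 := by ring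
      linarith [sq_nonneg (1 - t * ‖y‖)]
    calc 1 - t ^ 2 * ‖y‖ ^ 2 ≤ 2 * ‖t • y - ξ‖ := h5
      _ = 1 * (2 * ‖t • y - ξ‖) := (one_mul _).symm
      _ ≤ ((2 / κ) ^ (n - 1) * ‖t • y - ξ‖ ^ (n - 1)) * (2 * ‖t • y - ξ‖) := by gcongr
      _ = _ := by ring
  have h6 : (1 / (4 * κ)) ^ (n - 1) ≤ K := by
    refine pow_le_pow_left₀ (by positivity) ?_ _
    have h7 : 0 < ‖δ • y - ξ‖ := norm_smul_sub_pos hξ hδ.le hδ1 hy1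
    have h8 : ‖δ • y - ξ‖ ≤ 2 * κ := by
      calc ‖δ • y - ξ‖ = ‖δ • (y - ξ) - κ • ξ‖ := by rw [hκ]; congr 1; module
        _ ≤ ‖δ • (y - ξ)‖ + ‖κ • ξ‖ := norm_sub_le _ _
        _ = δ * κ + κ := by
          rw [norm_smul, norm_smul, hyκ', hξ, Real.norm_of_nonneg hδ.le,
            Real.norm_of_nonneg hκ0.le, mul_one]
        _ ≤ 2 * κ := by nlinarith
    have h9 : κ ≤ 1 - δ ^ 2 * ‖y‖ ^ 2 := by
      have : δ ^ 2 * ‖y‖ ^ 2 ≤ δ * 1 := by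
        have : ‖y‖ ^ 2 ≤ 1 := pow_le_one₀ (norm_nonneg y) hy1
        have : δ ^ 2 ≤ δ := by nlinarith
        gcongr
      linarith
    rw [div_le_div_iff₀ (by positivity) (by positivity), one_mul]
    calc ‖δ • y - ξ‖ ^ 2 ≤ (2 * κ) ^ 2 := by gcongr
      _ = κ * (4 * κ) := by ring
      _ ≤ (1 - δ ^ 2 * ‖y‖ ^ 2) * (4 * κ) := by gcongr
  calc poissonAbel δ t ξ y
      ≤ ((1 - δ ^ 2 * ‖y‖ ^ 2) / (1 - δ ^ 2)) ^ ((n : ℝ) / 2 - 1) *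
        ((1 - t ^ 2 * ‖y‖ ^ 2) / ‖t • y - ξ‖ ^ n) := h1
    _ ≤ 4 ^ ((n : ℝ) / 2 - 1) * (2 * (2 / κ) ^ (n - 1)) := by
      refine mul_le_mul h2 h3 (div_nonneg ?_ (by positivity)) (by positivity)
      linarith [sq_mul_sq_lt_one ht ht1 hy1]
    _ = A * (1 / (4 * κ)) ^ (n - 1) := by
      have e8 : (2 / κ) ^ (n - 1) = 8 ^ (n - 1) * (1 / (4 * κ)) ^ (n - 1) := by
        rw [← mul_pow]
        congr 1
        field_simp
        norm_num
      rw [e8, hA]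
      ring
    _ ≤ A * K := by gcongr

/-- Away from the pole the kernel is dominated by the rescaled hyperbolic Poisson kernel. -/
theorem poissonH_le_hyperbolic (hx : ‖x‖ < 1) (hxξ : 1 - δ ≤ ‖x - ξ‖) :
    poissonH δ x ξ ≤ (4 : ℝ) ^ ((n : ℝ) / 2 - 1) * 2 * 8 ^ (n - 1) *
      ((1 - δ ^ 2 * ‖x‖ ^ 2) / ‖δ • x - ξ‖ ^ 2) ^ (n - 1) := by
  set κ := 1 - δ with hκ
  have hκ0 : 0 < κ := by linarith
  have hn1 : 1 ≤ n := by omega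
  have h1n : ((n - 1 : ℕ) : ℝ) = (n : ℝ) - 1 := by push_cast [Nat.cast_sub hn1]; ring
  set A : ℝ := (4 : ℝ) ^ ((n : ℝ) / 2 - 1) * 2 * 8 ^ (n - 1) with hA
  have hA0 : 0 < A := by positivity
  set D : Set (EuclideanSpace ℝ (Fin n)) := closedBall 0 1 \ ball ξ κ with hD
  have hDc : IsCompact D := (isCompact_closedBall _ _).diff isOpen_ball
  have hD1 : D ⊆ closedBall 0 1 := Set.sdiff_subset
  set K : EuclideanSpace ℝ (Fin n) → ℝ := fun y => (1 - δ ^ 2 * ‖y‖ ^ 2) ^ ((n : ℝ) - 1) *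
      (1 - 2 * δ * ⟪y, ξ⟫ + δ ^ 2 * ‖y‖ ^ 2) ^ (-((n : ℝ) - 1)) with hK
  have hKeq : ∀ y, ‖y‖ ≤ 1 →
      K y = ((1 - δ ^ 2 * ‖y‖ ^ 2) / ‖δ • y - ξ‖ ^ 2) ^ (n - 1) := fun y hy => by
    have hρ := sq_mul_sq_lt_one hδ.le hδ1 hy
    rw [hK, ← Real.rpow_natCast _ (n - 1), h1n, Real.div_rpow (by linarith) (sq_nonneg _),
      norm_smul_sub_sq hξ]
    simp only
    rw [Real.rpow_neg (pole_pos hξ hδ.le hδ1 hy).le, div_eq_mul_inv]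
  -- comparison of the regularized kernel
  have key : ∀ t : ℝ, 0 ≤ t → t < 1 → 1 - t ≤ κ / 2 →
      poissonAbel δ t ξ x ≤ A * K x + (1 - t ^ 2) * (2 / κ) ^ n := by
    intro t ht ht1 htκ
    have ht2 : 0 < 1 - t ^ 2 := by
      have := pow_lt_one₀ ht ht1 two_ne_zero
      linarith
    have hc0 : 0 ≤ (1 - t ^ 2) * (2 / κ) ^ n := by positivity
    have := mul_poissonAbel_le hn hδ hδ1 hξ ht ht1 (c := 1) (by simp) hDc hD1
      (W := fun y => A * K y - (-((1 - t ^ 2) * (2 / κ) ^ n))) ?_ ?_ ?_ x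
      ⟨by simpa using hx.le, by simpa [dist_eq_norm] using hxξ⟩
    · linarith
    · refine ContinuousOn.sub (ContinuousOn.const_mul ?_ _) continuousOn_const
      exact ((continuousOn_one_sub_rpow hδ.le hδ1 _).mul
        (continuousOn_pole_rpow hδ.le hδ1 hξ _)).mono hD1
    · intro y hy
      have hy1 : y ∈ ball (0 : EuclideanSpace ℝ (Fin n)) 1 := by
        have := interior_mono hD1 hy
        rwa [interior_closedBall _ one_ne_zero] at this
      have h1 := (hasOp_hyperbolic hδ hδ1 hξ (by simpa using hy1)).const_mul A
      have h2 : HasOp δ (fun _ => -((1 - t ^ 2) * (2 / κ) ^ n)) y 0 :=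
        ⟨0, 0, HasGradLap.const _, by simp⟩
      exact ⟨_, by simp, h1.sub h2⟩
    · intro y hy hyi
      have hy1 : ‖y‖ ≤ 1 := by simpa using hD1 hy
      have hyκ : κ ≤ ‖y - ξ‖ := by simpa [dist_eq_norm] using hy.2
      have hty := norm_sub_le_norm_smul_sub (ξ := ξ) ht1.le hy1
      have hty2 : κ / 2 ≤ ‖t • y - ξ‖ := by linarith
      have hρ := sq_mul_sq_lt_one hδ.le hδ1 hy1
      have hK0 : 0 ≤ K y := by
        rw [hKeq y hy1]
        exact pow_nonneg (div_nonneg (by linarith) (sq_nonneg _)) _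
      rw [one_mul, sub_neg_eq_add]
      rcases hy1.eq_or_lt with hy2 | hy2
      · -- on the sphere the regularized kernel is small
        rw [poissonAbel_sphere hn hδ hδ1 hξ ht ht1 hy2]
        have h3 := pole_rpow_neg_half (x := y) t hξ
        rw [hy2, one_pow, mul_one] at h3
        rw [h3]
        have h4 : 1 / ‖t • y - ξ‖ ^ n ≤ (2 / κ) ^ n := by
          rw [one_div, ← inv_pow]
          refine pow_le_pow_left₀ (by positivity) ?_ n
          rw [← inv_div]
          exact inv_anti₀ (by positivity) hty2
        have := mul_le_mul_of_nonneg_left h4 ht2.le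
        have := mul_nonneg hA0.le hK0
        linarith
      · -- on the sphere of radius `1 - δ` about the pole the two kernels are comparable
        have hyκ' : ‖y - ξ‖ = κ := by
          refine le_antisymm ?_ hyκ
          by_contra! hlt
          refine hyi (mem_interior.2 ⟨ball 0 1 \ closedBall ξ κ, ?_, ?_, ?_, ?_⟩)
          · exact Set.sdiff_subset_sdiff ball_subset_closedBall ball_subset_closedBall
          · exact isOpen_ball.sdiff isClosed_closedBall
          · simpa using hy2
          · simpa [dist_eq_norm] using hlt
        have h1 := poissonAbel_le_of_norm_sub_eq hn hδ hδ1 hξ ht ht1 htκ hy1 hyκ'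
        rw [← hKeq y hy1] at h1
        linarith
  have hlim : Tendsto (fun t : ℝ => A * K x + (1 - t ^ 2) * (2 / κ) ^ n) (𝓝[<] 1)
      (𝓝 (A * K x)) := by
    have : Continuous fun t : ℝ => A * K x + (1 - t ^ 2) * (2 / κ) ^ n := by fun_prop
    have h := this.tendsto 1
    simp only [one_pow, sub_self, zero_mul, add_zero] at h
    exact h.mono_left nhdsWithin_le_nhds
  rw [← hKeq x hx.le]
  refine le_of_tendsto_of_tendsto (tendsto_poissonAbel hn hδ hδ1 hξ hx) hlim ?_
  have hm : max 0 (1 - κ / 2) < 1 := max_lt zero_lt_one (by linarith)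
  filter_upwards [Ioo_mem_nhdsLT hm] with t ht
  have h1 := (le_max_left _ _).trans ht.1.le
  have h2 := (le_max_right _ _).trans ht.1.le
  exact key t h1 ht.2 (by linarith)

theorem poissonH_nonneg (hx : ‖x‖ < 1) : 0 ≤ poissonH δ x ξ := by
  refine ge_of_tendsto (tendsto_poissonAbel hn hδ hδ1 hξ hx) ?_
  filter_upwards [Ioo_mem_nhdsLT zero_lt_one] with t ht
  exact poissonAbel_nonneg hn hδ hδ1 hξ ht.1.le ht.2 hx.le

theorem poissonH_le_rpow_mul (hx : ‖x‖ < 1) : poissonH δ x ξ ≤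
    ((1 - δ ^ 2 * ‖x‖ ^ 2) / (1 - δ ^ 2)) ^ ((n : ℝ) / 2 - 1) * poissonE x ξ := by
  have hne : ‖x - ξ‖ ^ n ≠ 0 := by
    refine pow_ne_zero _ (norm_ne_zero_iff.2 (sub_ne_zero.2 ?_))
    rintro rfl
    exact hx.ne hξ
  have hc : ContinuousAt (fun t : ℝ =>
      ((1 - δ ^ 2 * ‖x‖ ^ 2) / (1 - δ ^ 2)) ^ ((n : ℝ) / 2 - 1) *
        ((1 - t ^ 2 * ‖x‖ ^ 2) / ‖t • x - ξ‖ ^ n)) 1 := by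
    refine ContinuousAt.mul continuousAt_const (ContinuousAt.div (by fun_prop) (by fun_prop) ?_)
    simpa using hne
  have h := hc.tendsto
  simp only [one_pow, one_mul, one_smul] at h
  refine le_of_tendsto_of_tendsto (tendsto_poissonAbel hn hδ hδ1 hξ hx)
    (h.mono_left nhdsWithin_le_nhds) ?_
  filter_upwards [Ioo_mem_nhdsLT zero_lt_one] with t ht
  exact poissonAbel_le hn hδ hδ1 hξ ht.1.le ht.2 hx.le

/-- The layer `1 - |x| ≤ 1 - δ` and its complement are treated by the two comparison functions. -/
theorem poissonH_le (hx : ‖x‖ < 1) : poissonH δ x ξ ≤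
    ((4 : ℝ) ^ ((n : ℝ) / 2 - 1) * 2 * 8 ^ (n - 1) * 16 ^ (n - 1)) * poissonE x ξ := by
  have hd : 1 - ‖x‖ ≤ ‖x - ξ‖ := by
    have := norm_sub_norm_le ξ x
    rwa [norm_sub_rev, hξ] at this
  have hd0 : 0 < ‖x - ξ‖ := by linarith
  have hE : 0 ≤ poissonE x ξ := by
    have : ‖x‖ ^ 2 ≤ 1 := pow_le_one₀ (norm_nonneg x) hx.le
    exact div_nonneg (by linarith) (by positivity)
  have hA0 : (0 : ℝ) < 4 ^ ((n : ℝ) / 2 - 1) := by positivity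
  rcases le_or_gt (1 - ‖x‖) (1 - δ) with h | h
  · obtain ⟨r0, r1⟩ := one_sub_sq_ratio_le hδ1 hδ hx.le h
    have hk : 0 ≤ (n : ℝ) / 2 - 1 := by linarith [half_sub_pos hn]
    have h2 := Real.rpow_le_rpow r0 r1 hk
    refine (poissonH_le_rpow_mul hn hδ hδ1 hξ hx).trans ?_
    refine mul_le_mul_of_nonneg_right (h2.trans ?_) hE
    have h8 : (1 : ℝ) ≤ 8 ^ (n - 1) := one_le_pow₀ (by norm_num)
    have h16 : (1 : ℝ) ≤ 16 ^ (n - 1) := one_le_pow₀ (by norm_num)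
    have h9 : (1 : ℝ) ≤ 2 * 8 ^ (n - 1) * 16 ^ (n - 1) := by nlinarith
    nlinarith
  · refine (poissonH_le_hyperbolic hn hδ hδ1 hξ hx (by linarith)).trans ?_
    rw [mul_assoc _ ((16 : ℝ) ^ (n - 1))]
    refine mul_le_mul_of_nonneg_left ?_ (by positivity)
    have hs0 : 0 < ‖δ • x - ξ‖ := norm_smul_sub_pos hξ hδ.le hδ1 hx.le
    have hs1 : 1 - δ * ‖x‖ ≤ ‖δ • x - ξ‖ := by
      have := norm_sub_norm_le ξ (δ • x)
      rwa [norm_sub_rev, hξ, norm_smul, Real.norm_of_nonneg hδ.le] at this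
    have hs : ‖x - ξ‖ ≤ 2 * ‖δ • x - ξ‖ := by
      have h1 := norm_sub_le_norm_smul_sub (ξ := ξ) hδ1.le hx.le
      nlinarith [norm_nonneg x]
    have hx0 := norm_nonneg x
    have hy0 : 0 < 1 - ‖x‖ := by linarith
    have hbase : (1 - δ ^ 2 * ‖x‖ ^ 2) / ‖δ • x - ξ‖ ^ 2 ≤ 16 * ((1 - ‖x‖) / ‖x - ξ‖ ^ 2) := by
      have hρ : 1 - δ ^ 2 * ‖x‖ ^ 2 ≤ 4 * (1 - ‖x‖) := by
        have h1 : ‖x‖ * (1 - δ) ≤ 1 * (1 - δ) := by gcongr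
        have h2 : 1 - δ ^ 2 * ‖x‖ ^ 2 = 2 * (1 - δ * ‖x‖) - (1 - δ * ‖x‖) ^ 2 := by ring
        linarith [sq_nonneg (1 - δ * ‖x‖)]
      rw [mul_div_assoc', div_le_div_iff₀ (by positivity) (by positivity)]
      calc (1 - δ ^ 2 * ‖x‖ ^ 2) * ‖x - ξ‖ ^ 2
          ≤ (4 * (1 - ‖x‖)) * (2 * ‖δ • x - ξ‖) ^ 2 := by gcongr
        _ = _ := by ring
    have hρ0 := sq_mul_sq_lt_one hδ.le hδ1 hx.le
    refine (pow_le_pow_left₀ (div_nonneg (by linarith) (sq_nonneg _)) hbase _).trans ?_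
    rw [mul_pow]
    refine mul_le_mul_of_nonneg_left ?_ (by positivity)
    obtain ⟨m, rfl⟩ : ∃ m, n = m + 2 := ⟨n - 2, by omega⟩
    rw [show m + 2 - 1 = m + 1 from rfl, poissonE, div_pow, div_le_div_iff₀ (by positivity)
      (by positivity)]
    have h1 : (1 - ‖x‖) ^ m ≤ ‖x - ξ‖ ^ m := by gcongr
    have h2 : 1 - ‖x‖ ≤ 1 - ‖x‖ ^ 2 := by nlinarith
    calc (1 - ‖x‖) ^ (m + 1) * ‖x - ξ‖ ^ (m + 2)
        = (1 - ‖x‖) ^ m * (1 - ‖x‖) * ‖x - ξ‖ ^ (m + 2) := by ring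
      _ ≤ ‖x - ξ‖ ^ m * (1 - ‖x‖ ^ 2) * ‖x - ξ‖ ^ (m + 2) := by gcongr
      _ = _ := by ring

end Bounds

/-! ### Non-tangential approach regions -/

/-- The approach region is the union of the balls `B(s ξ, (1 - s) α)`, `0 ≤ s < 1`. -/
theorem mem_approachRegion {n : ℕ} {α : ℝ} (hα : 0 < α) (hα1 : α < 1)
    {ξ : EuclideanSpace ℝ (Fin n)} (hξ : ‖ξ‖ = 1) {x : EuclideanSpace ℝ (Fin n)} :
    x ∈ approachRegion α ξ ↔ ∃ s : ℝ, 0 ≤ s ∧ s < 1 ∧ ‖x - s • ξ‖ < (1 - s) * α := by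
  have hhull : convexHull ℝ (insert ξ (ball (0 : EuclideanSpace ℝ (Fin n)) α))
      = convexJoin ℝ {ξ} (ball 0 α) := by
    rw [convexHull_insert ⟨0, by simpa using hα⟩, (convex_ball _ _).convexHull_eq]
  constructor
  · intro hx
    have hx1 : x ∈ ball (0 : EuclideanSpace ℝ (Fin n)) 1 := by
      have hsub : convexHull ℝ (insert ξ (ball (0 : EuclideanSpace ℝ (Fin n)) α))
          ⊆ closedBall 0 1 := by
        refine convexHull_min ?_ (convex_closedBall _ _)
        refine Set.insert_subset (by simp [hξ]) ?_
        exact (ball_subset_ball hα1.le).trans ball_subset_closedBall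
      have := interior_mono hsub hx
      rwa [interior_closedBall _ one_ne_zero] at this
    have hx2 := interior_subset hx
    rw [hhull, mem_convexJoin] at hx2
    obtain ⟨ζ, hζ, y, hy, a, b, ha, hb, hab, rfl⟩ := hx2
    rw [Set.mem_singleton_iff.1 hζ] at *
    rcases hb.eq_or_lt with rfl | hb
    · rw [show a = 1 by linarith] at hx1
      simp [hξ] at hx1
    · refine ⟨a, ha, by linarith, ?_⟩
      rw [add_sub_cancel_left, norm_smul, Real.norm_of_nonneg hb.le, show 1 - a = b by linarith]
      have : ‖y‖ < α := by simpa using hy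
      gcongr
  · rintro ⟨s, hs, hs1, h⟩
    have hs0 : 0 < 1 - s := by linarith
    refine mem_interior.2 ⟨ball (s • ξ) ((1 - s) * α), fun y hy => ?_, isOpen_ball,
      by rwa [mem_ball, dist_eq_norm]⟩
    rw [hhull, mem_convexJoin]
    refine ⟨ξ, rfl, (1 - s)⁻¹ • (y - s • ξ), ?_, s, 1 - s, hs, hs0.le, by ring, ?_⟩
    · rw [mem_ball, dist_eq_norm] at hy
      rw [mem_ball_zero_iff, norm_smul, norm_inv, Real.norm_of_nonneg hs0.le,
        inv_mul_lt_iff₀ hs0]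
      exact hy
    · rw [smul_inv_smul₀ hs0.ne']
      abel

theorem one_sub_norm_of_approach {n : ℕ} {α : ℝ} {x ξ : EuclideanSpace ℝ (Fin n)} (hξ : ‖ξ‖ = 1)
    {s : ℝ} (hs : 0 ≤ s) (h : ‖x - s • ξ‖ < (1 - s) * α) :
    (1 - s) * (1 - α) < 1 - ‖x‖ := by
  have h1 : ‖x‖ ≤ ‖x - s • ξ‖ + ‖s • ξ‖ := by
    simpa using norm_add_le (x - s • ξ) (s • ξ)
  rw [norm_smul, hξ, Real.norm_of_nonneg hs] at h1
  linarith

/-- In a narrow approach region the angle to the pole is of the order of the distance to the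
sphere, with a small constant. -/
theorem norm_sub_inner_le {n : ℕ} {η : ℝ} (hη : 0 < η) (hη1 : η ≤ 1 / 4)
    {x ξ : EuclideanSpace ℝ (Fin n)} (hξ : ‖ξ‖ = 1) (hx : x ∈ approachRegion η ξ) :
    ‖x‖ - ⟪x, ξ⟫ ≤ 8 * η * (1 - ‖x‖) ^ 2 := by
  obtain ⟨s, hs, hs1, h⟩ := (mem_approachRegion hη (by linarith) hξ).1 hx
  have hr := one_sub_norm_of_approach hξ hs h
  set r := ‖x‖ with hrdef
  set a := ⟪x, ξ⟫ with hadef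
  set e := ‖x - s • ξ‖ with hedef
  have he0 : 0 ≤ e := norm_nonneg _
  have hξ2 : ⟪ξ, ξ⟫ = 1 := by rw [real_inner_self_eq_norm_sq, hξ, one_pow]
  have hesq : e ^ 2 = r ^ 2 - 2 * s * a + s ^ 2 := by
    rw [hedef, norm_sub_sq_real, inner_smul_right, norm_smul, hξ, Real.norm_of_nonneg hs]
    ring
  have ha : s - e ≤ a := by
    have h1 := abs_le.1 (abs_real_inner_le_norm (x - s • ξ) ξ)
    rw [inner_sub_left, real_inner_smul_left, hξ2, hξ] at h1
    linarith [h1.1]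
  have har : a ≤ r := by
    have h1 := real_inner_le_norm x ξ
    rwa [hξ, mul_one] at h1
  have hs0 : 0 < 1 - s := by linarith
  have key : r - a ≤ 4 * η * (1 - s) ^ 2 := by
    rcases le_or_gt (1 / 2) s with h2 | h2
    · have h3 : 3 / 8 ≤ a := by nlinarith
      have h4 : (r - a) * (r + a) ≤ e ^ 2 := by nlinarith [sq_nonneg (s - a)]
      have h5 : e ^ 2 ≤ ((1 - s) * η) ^ 2 := by gcongr
      have h6 : (r - a) * (3 / 4) ≤ (r - a) * (r + a) := by
        apply mul_le_mul_of_nonneg_left <;> linarith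
      have h7 : ((1 - s) * η) ^ 2 ≤ η * (1 - s) ^ 2 := by
        rw [mul_pow, mul_comm]
        apply mul_le_mul_of_nonneg_right _ (sq_nonneg _)
        nlinarith
      have h8 : 0 ≤ η * (1 - s) ^ 2 := by positivity
      linarith
    · have h3 : r ≤ e + s := by
        have h1 : ‖x‖ ≤ ‖x - s • ξ‖ + ‖s • ξ‖ := by
          simpa using norm_add_le (x - s • ξ) (s • ξ)
        rwa [norm_smul, hξ, Real.norm_of_nonneg hs, mul_one] at h1
      have h4 : 1 / 2 * ((1 - s) * η) ≤ (1 - s) * ((1 - s) * η) := by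
        apply mul_le_mul_of_nonneg_right _ (by positivity)
        linarith
      linarith
  have h9 : 3 / 4 * (1 - s) ≤ 1 - r := by nlinarith
  have h10 : (3 / 4 * (1 - s)) ^ 2 ≤ (1 - r) ^ 2 := by gcongr
  have h11 : 0 ≤ η * ((1 - r) ^ 2 - (3 / 4 * (1 - s)) ^ 2) :=
    mul_nonneg hη.le (by linarith)
  have h12 : 0 ≤ η * (1 - s) ^ 2 := by positivity
  linarith

/-! ### The lower bound -/

section Lower

variable {n : ℕ} (hn : 3 ≤ n)
include hn

theorem zonalOne_le (l : ℕ) : zonalOne n l ≤ 2 * ((l : ℝ) + 1) ^ (n - 2) := by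
  have h := half_sub_pos hn
  have hn' : (3 : ℝ) ≤ n := by exact_mod_cast hn
  have h1 := gegHom_one_le h (m := n - 3) (by
    rw [Nat.cast_sub hn]; push_cast; linarith) l
  have h2 : (l + ((n : ℝ) - 2) / 2) / (((n : ℝ) - 2) / 2) ≤ 2 * (l + 1) := by
    rw [div_le_iff₀ h]
    nlinarith [mul_nonneg (Nat.cast_nonneg (α := ℝ) l) (by linarith : (0 : ℝ) ≤ n - 3)]
  rw [show n - 2 = n - 3 + 1 by omega, pow_succ']
  calc zonalOne n l ≤ (2 * (l + 1)) * ((l : ℝ) + 1) ^ (n - 3) :=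
        mul_le_mul h2 h1 (gegHom_one_pos h l).le (by positivity)
    _ = _ := by ring

variable {δ : ℝ} (hδ : 0 < δ) (hδ1 : δ < 1)
include hδ hδ1

/-- A bound for the ratios of hypergeometric factors that is uniform in `δ`. -/
theorem hypF_ratio_le {r : ℝ} (hr : 0 ≤ r) (hr1 : r ≤ 1) (l : ℕ) :
    hypF n l (δ ^ 2 * r ^ 2) / hypF n l (δ ^ 2) ≤ (1 + 2 * l * (1 - r)) ^ (n - 1) := by
  have h2 : δ ^ 2 < 1 := pow_lt_one₀ hδ.le hδ1 two_ne_zero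
  have hr2 : r ^ 2 ≤ 1 := pow_le_one₀ hr hr1
  have h3 : δ ^ 2 * r ^ 2 ≤ δ ^ 2 := mul_le_of_le_one_right (sq_nonneg δ) hr2
  have hp := hypF_pos hn l (sq_nonneg δ) h2
  have hmono := hypF_div_monotone hn l (a := δ ^ 2 * r ^ 2) (b := δ ^ 2)
    ⟨by positivity, h3.trans_lt h2⟩ ⟨sq_nonneg δ, h2⟩ h3
  simp only at hmono
  have hl : (0 : ℝ) ≤ l := Nat.cast_nonneg l
  have q1 : 0 < 1 + l * (1 - δ ^ 2) := by
    have : 0 < 1 - δ ^ 2 := by linarith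
    positivity
  have q2 : 0 < 1 + l * (1 - δ ^ 2 * r ^ 2) := by
    have : 0 < 1 - δ ^ 2 * r ^ 2 := by linarith
    positivity
  have q3 : 1 + l * (1 - δ ^ 2 * r ^ 2) ≤ (1 + 2 * l * (1 - r)) * (1 + l * (1 - δ ^ 2)) := by
    have e1 : δ ^ 2 * (1 - r ^ 2) ≤ 1 * (1 - r ^ 2) := by
      apply mul_le_mul_of_nonneg_right h2.le
      linarith
    have e2 : 1 - δ ^ 2 * r ^ 2 ≤ (1 - δ ^ 2) + 2 * (1 - r) := by nlinarith [sq_nonneg (1 - r)]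
    have e3 : l * (1 - δ ^ 2 * r ^ 2) ≤ l * ((1 - δ ^ 2) + 2 * (1 - r)) := by gcongr
    have e4 : 0 ≤ (2 * l * (1 - r)) * (l * (1 - δ ^ 2)) := by
      have : 0 ≤ 1 - r := by linarith
      have : 0 ≤ 1 - δ ^ 2 := by linarith
      positivity
    linarith
  rw [div_le_iff₀ hp]
  rw [div_le_div_iff₀ (pow_pos q2 _) (pow_pos q1 _)] at hmono
  have q4 := pow_le_pow_left₀ q2.le q3 (n - 1)
  rw [mul_pow] at q4
  have q5 := pow_pos q1 (n - 1)
  refine le_of_mul_le_mul_right ?_ q5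
  calc _ ≤ hypF n l (δ ^ 2) * (1 + l * (1 - δ ^ 2 * r ^ 2)) ^ (n - 1) := hmono
    _ ≤ hypF n l (δ ^ 2) *
        ((1 + 2 * l * (1 - r)) ^ (n - 1) * (1 + l * (1 - δ ^ 2)) ^ (n - 1)) := by gcongr
    _ = _ := by ring

/-- The weighted sum that controls the variation of the kernel with the angle. -/
theorem tsum_sq_mul_le {r : ℝ} (hr : 0 ≤ r) (hr1 : r < 1) :
    Summable (fun l : ℕ => hypF n l (δ ^ 2 * r ^ 2) / hypF n l (δ ^ 2) * zonalOne n l *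
      (l ^ 2 * r ^ (l - 1))) ∧
    ∑' l : ℕ, hypF n l (δ ^ 2 * r ^ 2) / hypF n l (δ ^ 2) * zonalOne n l * (l ^ 2 * r ^ (l - 1)) ≤
      4 ^ (n - 1) * (n.factorial + 2 ^ (n - 1) * (2 * n - 1).factorial) / (1 - r) ^ (n + 1) := by
  have hy : 0 < 1 - r := by linarith
  have habs : |r| < 1 := by rwa [abs_of_nonneg hr]
  have h2 : δ ^ 2 < 1 := pow_lt_one₀ hδ.le hδ1 two_ne_zero
  have hratio0 : ∀ l, 0 ≤ hypF n l (δ ^ 2 * r ^ 2) / hypF n l (δ ^ 2) := fun l => by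
    have hr2 : r ^ 2 ≤ 1 := pow_le_one₀ hr hr1.le
    have h3 : δ ^ 2 * r ^ 2 ≤ δ ^ 2 := mul_le_of_le_one_right (sq_nonneg δ) hr2
    exact div_nonneg (hypF_pos hn l (by positivity) (h3.trans_lt h2)).le
      (hypF_pos hn l (sq_nonneg δ) h2).le
  set f : ℕ → ℝ := fun l => hypF n l (δ ^ 2 * r ^ 2) / hypF n l (δ ^ 2) * zonalOne n l *
      (l ^ 2 * r ^ (l - 1)) with hf
  have hf0 : ∀ l, 0 ≤ f l := fun l => by
    have := hratio0 l
    have := zonalOne_pos hn l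
    positivity
  have hfle : ∀ m : ℕ, f (m + 1) ≤ 4 ^ (n - 1) * (((m : ℝ) + 1) ^ n * r ^ m +
      2 ^ (n - 1) * (1 - r) ^ (n - 1) * (((m : ℝ) + 1) ^ (2 * n - 1) * r ^ m)) := by
    intro m
    have e1 := hypF_ratio_le hn hδ hδ1 hr hr1.le (m + 1)
    have e2 := zonalOne_le hn (m + 1)
    push_cast at e1 e2
    have e3 : (1 + 2 * ((m : ℝ) + 1) * (1 - r)) ^ (n - 1) ≤
        2 ^ (n - 2) * (1 + (2 * ((m : ℝ) + 1) * (1 - r)) ^ (n - 1)) := by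
      have := add_pow_le zero_le_one (by positivity : 0 ≤ 2 * ((m : ℝ) + 1) * (1 - r)) (n - 1)
      rwa [one_pow, show n - 1 - 1 = n - 2 from rfl] at this
    have e4 : 2 * ((m : ℝ) + 1 + 1) ^ (n - 2) ≤ 2 * (2 * ((m : ℝ) + 1)) ^ (n - 2) := by
      have : (m : ℝ) + 1 + 1 ≤ 2 * (m + 1) := by linarith [Nat.cast_nonneg (α := ℝ) m]
      gcongr
    have e5 : f (m + 1) = hypF n (m + 1) (δ ^ 2 * r ^ 2) / hypF n (m + 1) (δ ^ 2) *
        zonalOne n (m + 1) * (((m : ℝ) + 1) ^ 2 * r ^ m) := by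
      simp [hf]
    rw [e5]
    calc _ ≤ (2 ^ (n - 2) * (1 + (2 * ((m : ℝ) + 1) * (1 - r)) ^ (n - 1))) *
          (2 * (2 * ((m : ℝ) + 1)) ^ (n - 2)) * (((m : ℝ) + 1) ^ 2 * r ^ m) := by
          refine mul_le_mul_of_nonneg_right ?_ (by positivity)
          exact mul_le_mul (e1.trans e3) (e2.trans e4) (zonalOne_pos hn _).le (by positivity)
      _ ≤ _ := by
          obtain ⟨k, rfl⟩ : ∃ k, n = k + 2 := ⟨n - 2, by omega⟩
          simp only [show k + 2 - 2 = k from rfl, show k + 2 - 1 = k + 1 from rfl,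
            show 2 * (k + 2) - 1 = 2 * k + 3 from by omega]
          have e6 : (2 ^ k * (1 + (2 * ((m : ℝ) + 1) * (1 - r)) ^ (k + 1))) *
            (2 * (2 * ((m : ℝ) + 1)) ^ k) * (((m : ℝ) + 1) ^ 2 * r ^ m) =
            2 * (2 ^ k * 2 ^ k) * (((m : ℝ) + 1) ^ (k + 2) * r ^ m +
              2 ^ (k + 1) * (1 - r) ^ (k + 1) * (((m : ℝ) + 1) ^ (2 * k + 3) * r ^ m)) := by
            simp only [mul_pow]
            ring
          rw [e6]
          refine mul_le_mul_of_nonneg_right ?_ (by positivity)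
          have e7 : (4 : ℝ) ^ (k + 1) = 4 * (2 ^ k * 2 ^ k) := by
            rw [← mul_pow, pow_succ]
            norm_num
            ring
          rw [e7]
          have : (0 : ℝ) < 2 ^ k * 2 ^ k := by positivity
          linarith
  have hs1 := (unitSummable_pow n).hasSum habs
  have hs2 := (unitSummable_pow (2 * n - 1)).hasSum habs
  have hbound := (hs1.add (hs2.mul_left (2 ^ (n - 1) * (1 - r) ^ (n - 1)))).mul_left
    ((4 : ℝ) ^ (n - 1))
  have hsum1 : Summable fun m => f (m + 1) :=
    hbound.summable.of_nonneg_of_le (fun m => hf0 _) hfle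
  have hsum : Summable f := (summable_nat_add_iff 1).1 hsum1
  refine ⟨hsum, ?_⟩
  rw [hsum.tsum_eq_zero_add, show f 0 = 0 by simp [hf], zero_add]
  refine (hasSum_le hfle hsum1.hasSum hbound).trans ?_
  have p1 := powSum_pow_le n hr hr1
  have p2 := powSum_pow_le (2 * n - 1) hr hr1
  rw [mul_div_assoc]
  refine mul_le_mul_of_nonneg_left ?_ (by positivity)
  rw [add_div]
  refine add_le_add p1 ?_
  calc _ ≤ 2 ^ (n - 1) * (1 - r) ^ (n - 1) *
        ((2 * n - 1).factorial / (1 - r) ^ (2 * n - 1 + 1)) := by gcongr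
    _ = _ := by
      rw [show 2 * n - 1 + 1 = (n - 1) + (n + 1) by omega, pow_add]
      field_simp

/-- A lower bound for the kernel: the terms at the pole are positive and sum to at least the first
term on the left, and the second one bounds the effect of turning `x` away from the pole. -/
theorem poissonH_ge_sub {x ξ : EuclideanSpace ℝ (Fin n)} (hξ : ‖ξ‖ = 1) (hx : ‖x‖ < 1) :
    1 / (1 - ‖x‖) ^ (n - 1) - (‖x‖ - ⟪x, ξ⟫) *
      (4 ^ (n - 1) * (n.factorial + 2 ^ (n - 1) * (2 * n - 1).factorial) / (1 - ‖x‖) ^ (n + 1))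
      ≤ poissonH δ x ξ := by
  set r := ‖x‖ with hrdef
  have hr : 0 ≤ r := norm_nonneg x
  have hlam := half_sub_pos hn
  obtain ⟨hsum2, hle2⟩ := tsum_sq_mul_le hn hδ hδ1 hr hx
  set τ := ⟪r⁻¹ • x, ξ⟫ with hτ
  have hτ1 : |τ| ≤ 1 := abs_inner_le_one hξ
  have hrτ : r * τ = ⟪x, ξ⟫ := by
    rcases eq_or_ne x 0 with rfl | hx0
    · simp [hrdef]
    · rw [hτ, real_inner_smul_left, mul_inv_cancel_left₀ (norm_ne_zero_iff.2 hx0)]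
  have hra : 0 ≤ r - ⟪x, ξ⟫ := by
    have h1 := real_inner_le_norm x ξ
    rw [hξ, mul_one] at h1
    linarith
  have hz := hasSum_zonal hlam (a := 1) (by simp) hr hx
  have hterm : ∀ l : ℕ, zonalOne n l * r ^ l - (r - ⟪x, ξ⟫) *
      (hypF n l (δ ^ 2 * r ^ 2) / hypF n l (δ ^ 2) * zonalOne n l * (l ^ 2 * r ^ (l - 1)))
      ≤ poissonHTerm δ x ξ l := by
    intro l
    obtain ⟨h1, -⟩ := hypF_ratio_bounds hn hδ hδ1 hx.le l
    have h2 := gegHom_one_sub_le hlam hτ1 l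
    have h3 := zonalOne_pos hn l
    rw [poissonHTerm_eq hn, ← pow_mul_gegenbauerC, gegenbauerC_eq, ← hrdef, ← hτ]
    rw [← hrdef] at h1
    set R := hypF n l (δ ^ 2 * r ^ 2) / hypF n l (δ ^ 2)
    set c := (l + ((n : ℝ) - 2) / 2) / (((n : ℝ) - 2) / 2)
    have hc : 0 < c := by positivity
    have hrl : (l : ℝ) ^ 2 * (1 - τ) * r ^ l = (r - ⟪x, ξ⟫) * (l ^ 2 * r ^ (l - 1)) := by
      rcases l with _ | l
      · simp
      · rw [Nat.add_sub_cancel, ← hrτ]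
        ring
    have hZ : zonalOne n l = c * gegHom (((n : ℝ) - 2) / 2) 1 1 l := rfl
    have h4 : R * (c * (r ^ l * (gegHom (((n : ℝ) - 2) / 2) 1 1 l -
        l ^ 2 * (1 - τ) * gegHom (((n : ℝ) - 2) / 2) 1 1 l))) ≤
        R * (c * (r ^ l * gegHom (((n : ℝ) - 2) / 2) τ 1 l)) := by
      have : 0 ≤ R := by linarith
      gcongr
      linarith
    refine le_trans ?_ h4
    have h5 : R * (c * (r ^ l * (gegHom (((n : ℝ) - 2) / 2) 1 1 l -
        l ^ 2 * (1 - τ) * gegHom (((n : ℝ) - 2) / 2) 1 1 l))) =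
        R * (zonalOne n l * r ^ l) - R * zonalOne n l * (l ^ 2 * (1 - τ) * r ^ l) := by
      rw [hZ]
      ring
    rw [h5, hrl]
    have h6 : zonalOne n l * r ^ l ≤ R * (zonalOne n l * r ^ l) :=
      le_mul_of_one_le_left (by positivity) h1
    linarith
  have hP : HasSum (poissonHTerm δ x ξ) (poissonH δ x ξ) :=
    (summable_abs_poissonHTerm hn hδ hδ1 hξ hx).of_abs.hasSum
  have key := hasSum_le hterm (hz.sub (hsum2.hasSum.mul_left (r - ⟪x, ξ⟫))) hP
  refine le_trans ?_ key
  refine sub_le_sub ?_ (mul_le_mul_of_nonneg_left hle2 hra)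
  have hy : 0 < 1 - r := by linarith
  have e1 : 1 - 2 * 1 * r + r ^ 2 = (1 - r) ^ 2 := by ring
  rw [e1, ← Real.rpow_natCast (1 - r) 2, ← Real.rpow_mul hy.le,
    show ((2 : ℕ) : ℝ) * (-(((n : ℝ) - 2) / 2 + 1)) = -(n : ℝ) by push_cast; ring,
    Real.rpow_neg hy.le, Real.rpow_natCast, ← div_eq_mul_inv, div_le_div_iff₀ (by positivity)
    (by positivity)]
  have e2 : (1 - r) ^ n = (1 - r) * (1 - r) ^ (n - 1) := by
    rw [← pow_succ', Nat.sub_add_cancel (by omega)]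
  rw [one_mul, e2]
  have : 1 - r ≤ 1 - r ^ 2 := by nlinarith
  gcongr

end Lower

theorem exists_poissonH_ge {n : ℕ} (hn : 3 ≤ n) :
    ∃ η : ℝ, 0 < η ∧ η < 1 ∧ ∃ C : ℝ, 0 < C ∧ ∀ δ : ℝ, 0 < δ → δ < 1 →
      ∀ ξ ∈ sphere (0 : EuclideanSpace ℝ (Fin n)) 1, ∀ x ∈ approachRegion η ξ,
        C / (1 - ‖x‖ ^ 2) ^ (n - 1) ≤ poissonH δ x ξ := by
  set A : ℝ := 4 ^ (n - 1) * (n.factorial + 2 ^ (n - 1) * (2 * n - 1).factorial) with hA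
  have hA0 : 0 < A := by positivity
  -- the aperture is such that the correction is at most half of the main term
  have hη0 : 0 < min (1 / 4) (1 / (16 * A)) := by positivity
  refine ⟨min (1 / 4) (1 / (16 * A)), hη0, by
    have := min_le_left (1 / 4 : ℝ) (1 / (16 * A)); linarith, 1 / 2, by norm_num, ?_⟩
  intro δ hδ hδ1 ξ hξ x hx
  have hξ' : ‖ξ‖ = 1 := by simpa using hξ
  set η := min (1 / 4 : ℝ) (1 / (16 * A))
  have h1 := norm_sub_inner_le hη0 (min_le_left _ _) hξ' hx
  have hη2 : η * (16 * A) ≤ 1 := by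
    have : η ≤ 1 / (16 * A) := min_le_right _ _
    rwa [le_div_iff₀ (by positivity)] at this
  have hη1 : η < 1 := (min_le_left _ _).trans_lt (by norm_num)
  obtain ⟨s, hs, hs1, h⟩ := (mem_approachRegion hη0 hη1 hξ').1 hx
  have hr := one_sub_norm_of_approach hξ' hs h
  have hy : 0 < 1 - ‖x‖ := by nlinarith
  refine le_trans ?_ (poissonH_ge_sub hn hδ hδ1 hξ' (by linarith : ‖x‖ < 1))
  rw [← hA]
  have h2 : (‖x‖ - ⟪x, ξ⟫) * (A / (1 - ‖x‖) ^ (n + 1)) ≤ 1 / 2 * (1 / (1 - ‖x‖) ^ (n - 1)) := by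
    calc _ ≤ (8 * η * (1 - ‖x‖) ^ 2) * (A / (1 - ‖x‖) ^ (n + 1)) := by gcongr
      _ = (η * (16 * A)) * (1 / 2 * (1 / (1 - ‖x‖) ^ (n - 1))) := by
        rw [show n + 1 = (n - 1) + 2 by omega, pow_add]
        field_simp
        ring
      _ ≤ 1 * (1 / 2 * (1 / (1 - ‖x‖) ^ (n - 1))) := by gcongr
      _ = _ := one_mul _
  have h3 : 1 / 2 / (1 - ‖x‖ ^ 2) ^ (n - 1) ≤ 1 / 2 / (1 - ‖x‖) ^ (n - 1) := by
    have : 1 - ‖x‖ ≤ 1 - ‖x‖ ^ 2 := by nlinarith [norm_nonneg x]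
    gcongr
  have h4 : 1 / 2 / (1 - ‖x‖) ^ (n - 1) = 1 / 2 * (1 / (1 - ‖x‖) ^ (n - 1)) := by ring
  linarith

/-! ### A maximal theorem by the method of `T T*` -/

theorem sq_lintegral_mul_le {X : Type*} [MeasurableSpace X] {μ : Measure X} {f g : X → ℝ≥0∞}
    (hf : AEMeasurable f μ) (hg : AEMeasurable g μ) :
    (∫⁻ x, f x * g x ∂μ) ^ 2 ≤ (∫⁻ x, f x ^ 2 ∂μ) * ∫⁻ x, g x ^ 2 ∂μ := by
  have h := ENNReal.lintegral_mul_le_Lp_mul_Lq μ Real.HolderConjugate.two_two hf hg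
  simp only [Pi.mul_apply] at h
  have h2 := pow_le_pow_left' h 2
  refine h2.trans (le_of_eq ?_)
  rw [mul_pow]
  simp only [← ENNReal.rpow_natCast, ← ENNReal.rpow_mul]
  norm_num

/-- The integral operator `T g = ∫ K(·, y) g(y) dy` improves its own bound: if `M` bounds the square
of its norm then so does `2 C √M`, because `T T*` has kernel at most `C (K(x, y) + K(y, x))`. -/
theorem lintegral_sq_kernel_step {X : Type*} [MeasurableSpace X] {μ : Measure X}
    [IsFiniteMeasure μ] {K : X → X → ℝ≥0∞} (hK : Measurable (Function.uncurry K))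
    {B : ℝ≥0∞} (hB : B ≠ ⊤) (hKB : ∀ x y, K x y ≤ B) {C : NNReal}
    (hC : ∀ x y, ∫⁻ z, K x z * K y z ∂μ ≤ C * (K x y + K y x)) {M : NNReal}
    (hM : ∀ g : X → ℝ≥0∞, Measurable g →
      ∫⁻ x, (∫⁻ y, K x y * g y ∂μ) ^ 2 ∂μ ≤ M * ∫⁻ x, g x ^ 2 ∂μ)
    {g : X → ℝ≥0∞} (hg : Measurable g) :
    ∫⁻ x, (∫⁻ y, K x y * g y ∂μ) ^ 2 ∂μ
      ≤ (2 * C * NNReal.sqrt M : NNReal) * ∫⁻ x, g x ^ 2 ∂μ := by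
  have hT : ∀ {u : X → ℝ≥0∞}, Measurable u → Measurable fun x => ∫⁻ y, K x y * u y ∂μ := by
    intro u hu
    exact Measurable.lintegral_prod_right' (f := fun p : X × X => K p.1 p.2 * u p.2)
      (hK.fun_mul (hu.comp measurable_snd))
  have hT' : ∀ {u : X → ℝ≥0∞}, Measurable u → Measurable fun y => ∫⁻ x, K x y * u x ∂μ := by
    intro u hu
    exact Measurable.lintegral_prod_right' (f := fun p : X × X => K p.2 p.1 * u p.2)
      ((hK.comp measurable_swap).fun_mul (hu.comp measurable_snd))
  have hKx : ∀ x, Measurable (K x) := fun x => hK.comp measurable_prodMk_left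
  have hKy : ∀ y, Measurable fun x => K x y := fun y => hK.comp measurable_prodMk_right
  set h : X → ℝ≥0∞ := fun x => ∫⁻ y, K x y * g y ∂μ with hhdef
  have hh : Measurable h := hT hg
  set I := ∫⁻ x, h x ^ 2 ∂μ with hIdef
  set G := ∫⁻ x, g x ^ 2 ∂μ with hGdef
  set D := ∫⁻ x, h x * (∫⁻ y, K x y * h y ∂μ) ∂μ with hDdef
  -- duality: `‖T g‖² = ⟨g, T* T g⟩`
  have h1 : I ^ 2 ≤ G * ∫⁻ y, (∫⁻ x, K x y * h x ∂μ) ^ 2 ∂μ := by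
    have : I = ∫⁻ y, g y * (∫⁻ x, K x y * h x ∂μ) ∂μ := by
      calc I = ∫⁻ x, ∫⁻ y, h x * (K x y * g y) ∂μ ∂μ := by
            refine lintegral_congr fun x => ?_
            rw [lintegral_const_mul _ ((hKx x).fun_mul hg), sq]
        _ = ∫⁻ y, ∫⁻ x, h x * (K x y * g y) ∂μ ∂μ := by
            refine lintegral_lintegral_swap (Measurable.aemeasurable ?_)
            exact (hh.comp measurable_fst).fun_mul (hK.fun_mul (hg.comp measurable_snd))
        _ = _ := by
            refine lintegral_congr fun y => ?_
            rw [← lintegral_const_mul _ ((hKy y).fun_mul hh)]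
            exact lintegral_congr fun x => by ring
    rw [this]
    exact sq_lintegral_mul_le hg.aemeasurable (hT' hh).aemeasurable
  -- `‖T* h‖² = ⟨h, T T* h⟩`
  have h2 : ∫⁻ y, (∫⁻ x, K x y * h x ∂μ) ^ 2 ∂μ ≤ 2 * C * D := by
    calc ∫⁻ y, (∫⁻ x, K x y * h x ∂μ) ^ 2 ∂μ
        = ∫⁻ y, ∫⁻ x, K x y * h x * (∫⁻ x', K x' y * h x' ∂μ) ∂μ ∂μ := by
          refine lintegral_congr fun y => ?_
          rw [lintegral_mul_const _ ((hKy y).fun_mul hh), sq]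
      _ = ∫⁻ x, ∫⁻ y, K x y * h x * (∫⁻ x', K x' y * h x' ∂μ) ∂μ ∂μ := by
          refine lintegral_lintegral_swap (Measurable.aemeasurable ?_)
          exact ((hK.comp measurable_swap).fun_mul (hh.comp measurable_snd)).mul
            ((hT' hh).comp measurable_fst)
      _ = ∫⁻ x, ∫⁻ y, ∫⁻ x', h x * h x' * (K x y * K x' y) ∂μ ∂μ ∂μ := by
          refine lintegral_congr fun x => lintegral_congr fun y => ?_
          rw [← lintegral_const_mul _ ((hKy y).fun_mul hh)]
          exact lintegral_congr fun x' => by ring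
      _ = ∫⁻ x, ∫⁻ x', ∫⁻ y, h x * h x' * (K x y * K x' y) ∂μ ∂μ ∂μ := by
          refine lintegral_congr fun x => lintegral_lintegral_swap (Measurable.aemeasurable ?_)
          exact ((hh.comp measurable_snd).const_mul (h x)).mul
            (((hKx x).comp measurable_fst).fun_mul (hK.comp measurable_swap))
      _ ≤ ∫⁻ x, ∫⁻ x', h x * h x' * (C * (K x x' + K x' x)) ∂μ ∂μ := by
          refine lintegral_mono fun x => lintegral_mono fun x' => ?_
          rw [lintegral_const_mul _ ((hKx x).fun_mul (hKx x'))]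
          gcongr
          exact hC x x'
      _ = ∫⁻ x, (∫⁻ x', C * (h x * (K x x' * h x')) ∂μ
            + ∫⁻ x', C * (h x' * (K x' x * h x)) ∂μ) ∂μ := by
          refine lintegral_congr fun x => ?_
          rw [← lintegral_add_left
            ((((hKx x).fun_mul hh).const_mul (h x)).const_mul (C : ℝ≥0∞))]
          exact lintegral_congr fun x' => by ring
      _ = ∫⁻ x, ∫⁻ x', C * (h x * (K x x' * h x')) ∂μ ∂μ
            + ∫⁻ x, ∫⁻ x', C * (h x' * (K x' x * h x)) ∂μ ∂μ := by
          refine lintegral_add_left ?_ _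
          refine Measurable.lintegral_prod_right'
            (f := fun p : X × X => (C : ℝ≥0∞) * (h p.1 * (K p.1 p.2 * h p.2))) ?_
          exact ((hh.comp measurable_fst).fun_mul (hK.fun_mul (hh.comp measurable_snd))).const_mul _
      _ = ∫⁻ x, ∫⁻ x', C * (h x * (K x x' * h x')) ∂μ ∂μ
            + ∫⁻ x', ∫⁻ x, C * (h x' * (K x' x * h x)) ∂μ ∂μ := by
          congr 1
          refine lintegral_lintegral_swap (Measurable.aemeasurable ?_)
          exact ((hh.comp measurable_snd).mul
            ((hK.comp measurable_swap).fun_mul (hh.comp measurable_fst))).const_mul _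
      _ = 2 * C * D := by
          have : ∫⁻ x, ∫⁻ x', C * (h x * (K x x' * h x')) ∂μ ∂μ = C * D := by
            rw [hDdef, ← lintegral_const_mul _ (hh.fun_mul (hT hh))]
            refine lintegral_congr fun x => ?_
            rw [lintegral_const_mul _ (((hKx x).fun_mul hh).const_mul (h x)),
              lintegral_const_mul _ ((hKx x).fun_mul hh)]
          rw [this]
          ring
  have h3 : D ^ 2 ≤ I * (M * I) :=
    (sq_lintegral_mul_le hh.aemeasurable (hT hh).aemeasurable).trans
      (mul_le_mul_right (hM h hh) I)
  rcases eq_or_ne I 0 with hI0 | hI0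
  · rw [hI0]
    exact zero_le
  rcases eq_or_ne G ⊤ with hG | hG
  · rcases eq_or_ne (2 * C * NNReal.sqrt M) 0 with h0 | h0
    · -- a vanishing constant forces `T = 0`
      exfalso
      apply hI0
      rcases mul_eq_zero.1 h0 with h0 | h0
      · have hC0 : C = 0 := by simpa using h0
        have h4 : I ^ 2 = 0 := by
          refine le_antisymm ?_ zero_le
          have h5 : ∫⁻ y, (∫⁻ x, K x y * h x ∂μ) ^ 2 ∂μ = 0 :=
            le_antisymm (by simpa [hC0] using h2) zero_le
          simpa [h5] using h1
        simpa using h4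
      · have hM0 : M = 0 := by simpa using h0
        have hD0 : D = 0 := by
          have : D ^ 2 ≤ 0 := by simpa [hM0] using h3
          simpa using this
        have h5 : ∫⁻ y, (∫⁻ x, K x y * h x ∂μ) ^ 2 ∂μ = 0 :=
          le_antisymm (by simpa [hD0] using h2) zero_le
        have h4 : I ^ 2 ≤ 0 := by simpa [h5] using h1
        simpa using h4
    · rw [hG, ENNReal.mul_top (by exact_mod_cast h0)]
      exact le_top
  have hI : I ≠ ⊤ := by
    have h4 : (∫⁻ y, g y ∂μ) ^ 2 ≤ μ Set.univ * G := by
      have := sq_lintegral_mul_le (μ := μ) (f := fun _ => 1) (g := g) aemeasurable_const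
        hg.aemeasurable
      simpa using this
    have h5 : ∀ x, h x ^ 2 ≤ B ^ 2 * (μ Set.univ * G) := by
      intro x
      calc h x ^ 2 ≤ (∫⁻ y, B * g y ∂μ) ^ 2 :=
            pow_le_pow_left' (lintegral_mono fun y => mul_le_mul_left (hKB x y) _) 2
        _ = B ^ 2 * (∫⁻ y, g y ∂μ) ^ 2 := by rw [lintegral_const_mul _ hg, mul_pow]
        _ ≤ _ := mul_le_mul_right h4 _
    refine ne_top_of_le_ne_top ?_ (lintegral_mono h5)
    rw [lintegral_const]
    finiteness
  have h4 : I ^ 2 ≤ ((2 * C * NNReal.sqrt M : NNReal) * G) ^ 2 := by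
    have h5 : I ^ 2 * I ^ 2 ≤ I ^ 2 * ((2 * C * NNReal.sqrt M : NNReal) * G) ^ 2 := by
      calc I ^ 2 * I ^ 2 ≤ (G * (2 * C * D)) * (G * (2 * C * D)) := by
            gcongr <;> exact h1.trans (mul_le_mul_right h2 G)
        _ = G ^ 2 * (2 * C) ^ 2 * D ^ 2 := by ring
        _ ≤ G ^ 2 * (2 * C) ^ 2 * (I * (M * I)) := mul_le_mul_right h3 _
        _ = I ^ 2 * (((2 * C) ^ 2 * M) * G ^ 2) := by ring
        _ = _ := by
          have : (M : ℝ≥0∞) = (NNReal.sqrt M : ℝ≥0∞) ^ 2 := by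
            rw [← ENNReal.coe_pow, NNReal.sq_sqrt]
          push_cast
          rw [this]
          ring
    exact (ENNReal.mul_le_mul_iff_right (pow_ne_zero 2 hI0) (ENNReal.pow_ne_top hI)).1 h5
  exact (ENNReal.pow_le_pow_left_iff two_ne_zero).1 h4

/-- The `L²` bound obtained by iterating `lintegral_sq_kernel_step`. -/
theorem lintegral_sq_kernel_le {X : Type*} [MeasurableSpace X] {μ : Measure X}
    [IsFiniteMeasure μ] {K : X → X → ℝ≥0∞} (hK : Measurable (Function.uncurry K))
    {B : NNReal} (hKB : ∀ x y, K x y ≤ B) {C : NNReal} (hC0 : 0 < C)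
    (hC : ∀ x y, ∫⁻ z, K x z * K y z ∂μ ≤ C * (K x y + K y x))
    {g : X → ℝ≥0∞} (hg : Measurable g) :
    ∫⁻ x, (∫⁻ y, K x y * g y ∂μ) ^ 2 ∂μ ≤ (5 * C ^ 2 : NNReal) * ∫⁻ x, g x ^ 2 ∂μ := by
  set S : Set NNReal := {M | ∀ g : X → ℝ≥0∞, Measurable g →
      ∫⁻ x, (∫⁻ y, K x y * g y ∂μ) ^ 2 ∂μ ≤ M * ∫⁻ x, g x ^ 2 ∂μ} with hS
  have hne : S.Nonempty := by
    refine ⟨B ^ 2 * (μ Set.univ).toNNReal ^ 2, fun g hg => ?_⟩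
    have h4 : (∫⁻ y, g y ∂μ) ^ 2 ≤ μ Set.univ * ∫⁻ x, g x ^ 2 ∂μ := by
      have := sq_lintegral_mul_le (μ := μ) (f := fun _ => 1) (g := g) aemeasurable_const
        hg.aemeasurable
      simpa using this
    have h5 : ∀ x, (∫⁻ y, K x y * g y ∂μ) ^ 2 ≤ B ^ 2 * (μ Set.univ * ∫⁻ x, g x ^ 2 ∂μ) := by
      intro x
      calc (∫⁻ y, K x y * g y ∂μ) ^ 2 ≤ (∫⁻ y, B * g y ∂μ) ^ 2 :=
            pow_le_pow_left' (lintegral_mono fun y => mul_le_mul_left (hKB x y) _) 2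
        _ = B ^ 2 * (∫⁻ y, g y ∂μ) ^ 2 := by rw [lintegral_const_mul _ hg, mul_pow]
        _ ≤ _ := mul_le_mul_right h4 _
    refine (lintegral_mono h5).trans (le_of_eq ?_)
    rw [lintegral_const]
    push_cast
    rw [ENNReal.coe_toNNReal (measure_ne_top μ _)]
    ring
  have hstep : ∀ M ∈ S, 2 * C * NNReal.sqrt M ∈ S := fun M hM g hg =>
    lintegral_sq_kernel_step hK ENNReal.coe_ne_top hKB hC hM hg
  -- the fixed point of `M ↦ 2 C √M` is `4 C²`, so the least bound lies below `5 C²`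
  obtain ⟨M, hM, hlt⟩ : ∃ M ∈ S, M < 5 * C ^ 2 := by
    by_contra! hcon
    have hm : 5 * C ^ 2 ≤ sInf S := le_csInf hne hcon
    set m := sInf S
    have hC2 : 0 < C ^ 2 := by positivity
    have hm0 : 0 < m := lt_of_lt_of_le (by positivity) hm
    have h1 : m < m ^ 2 / (4 * C ^ 2) := by
      rw [lt_div_iff₀ (by positivity), sq m]
      refine mul_lt_mul_of_pos_left (lt_of_lt_of_le ?_ hm) hm0
      exact mul_lt_mul_of_pos_right (by norm_num) hC2
    obtain ⟨M, hM, hMm⟩ := exists_lt_of_csInf_lt hne h1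
    have h2 : m ≤ 2 * C * NNReal.sqrt M := csInf_le (OrderBot.bddBelow S) (hstep M hM)
    have h3 : m ^ 2 ≤ 4 * C ^ 2 * M := by
      calc m ^ 2 ≤ (2 * C * NNReal.sqrt M) ^ 2 := pow_le_pow_left' h2 2
        _ = 4 * C ^ 2 * (NNReal.sqrt M) ^ 2 := by ring
        _ = _ := by rw [NNReal.sq_sqrt]
    rw [lt_div_iff₀ (by positivity)] at hMm
    exact absurd h3 (not_le.2 (by rwa [mul_comm]))
  refine (hM g hg).trans (mul_le_mul_left ?_ _)
  exact_mod_cast hlt.le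

theorem exists_measurable_argmax {X : Type*} [MeasurableSpace X] {φ : ℕ → X → ℝ≥0∞}
    (hφ : ∀ i, Measurable (φ i)) (J : ℕ) :
    ∃ j : X → ℕ, Measurable j ∧ (∀ x, j x ≤ J) ∧ ∀ x, ∀ i ≤ J, φ i x ≤ φ (j x) x := by
  classical
  induction J with
  | zero => exact ⟨fun _ => 0, measurable_const, fun _ => le_rfl, fun x i hi => by
      rw [Nat.le_zero.1 hi]⟩
  | succ J ih =>
    obtain ⟨j, hj, hjJ, hmax⟩ := ih
    have hφj : Measurable fun x => φ (j x) x :=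
      (measurable_from_prod_countable_right (f := fun p : ℕ × X => φ p.1 p.2) hφ).comp
        (hj.prodMk measurable_id)
    refine ⟨fun x => if φ (j x) x < φ (J + 1) x then J + 1 else j x,
      Measurable.ite (measurableSet_lt hφj (hφ _)) measurable_const hj, fun x => ?_,
      fun x i hi => ?_⟩
    · have := hjJ x
      dsimp only
      split_ifs <;> omega
    · dsimp only
      split_ifs with h
      · rcases Nat.le_succ_iff.1 hi with hi | rfl
        · exact (hmax x i hi).trans h.le
        · exact le_rfl
      · rcases Nat.le_succ_iff.1 hi with hi | rfl
        · exact hmax x i hi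
        · exact not_lt.1 h

/-- An `L²` bound for the maximal operator of a sequence of positive kernels, from the almost
idempotency of the compositions of the kernels with their transposes.  The supremum is linearized
by a measurable choice of the index, which keeps the hypothesis. -/
theorem lintegral_sq_iSup_kernel_le {X : Type*} [MeasurableSpace X] {μ : Measure X}
    [IsFiniteMeasure μ] {k : ℕ → X → X → ℝ≥0∞} (hk : ∀ j, Measurable (Function.uncurry (k j)))
    {B : ℕ → NNReal} (hkB : ∀ j x y, k j x y ≤ B j) {C : NNReal} (hC0 : 0 < C)
    (hC : ∀ i j x y, ∫⁻ z, k i x z * k j y z ∂μ ≤ C * (k i x y + k j y x))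
    {g : X → ℝ≥0∞} (hg : Measurable g) :
    ∫⁻ x, (⨆ j, ∫⁻ y, k j x y * g y ∂μ) ^ 2 ∂μ ≤ (5 * C ^ 2 : NNReal) * ∫⁻ x, g x ^ 2 ∂μ := by
  have hT : ∀ j, Measurable fun x => ∫⁻ y, k j x y * g y ∂μ := fun j =>
    Measurable.lintegral_prod_right' (f := fun p : X × X => k j p.1 p.2 * g p.2)
      ((hk j).fun_mul (hg.comp measurable_snd))
  have hJ : ∀ J : ℕ, ∫⁻ x, (⨆ j ≤ J, ∫⁻ y, k j x y * g y ∂μ) ^ 2 ∂μ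
      ≤ (5 * C ^ 2 : NNReal) * ∫⁻ x, g x ^ 2 ∂μ := by
    intro J
    obtain ⟨j, hj, hjJ, hmax⟩ := exists_measurable_argmax hT J
    have hK : Measurable (Function.uncurry fun x y => k (j x) x y) :=
      (measurable_from_prod_countable_right (f := fun p : ℕ × (X × X) => k p.1 p.2.1 p.2.2)
        hk).comp ((hj.comp measurable_fst).prodMk measurable_id)
    have hKB : ∀ x y, k (j x) x y ≤ ((∑ i ∈ Finset.range (J + 1), B i : NNReal) : ℝ≥0∞) := by
      intro x y
      refine (hkB _ _ _).trans (ENNReal.coe_le_coe.2 ?_)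
      exact Finset.single_le_sum (f := B) (fun _ _ => zero_le)
        (Finset.mem_range.2 (Nat.lt_succ_of_le (hjJ x)))
    refine le_trans (lintegral_mono fun x => ?_)
      (lintegral_sq_kernel_le hK hKB hC0 (fun x y => hC _ _ x y) hg)
    exact pow_le_pow_left' (iSup₂_le fun i hi => hmax x i hi) 2
  have hsup : ∀ x, (⨆ j, ∫⁻ y, k j x y * g y ∂μ) ^ 2
      = ⨆ J : ℕ, (⨆ j ≤ J, ∫⁻ y, k j x y * g y ∂μ) ^ 2 := by
    intro x
    rw [← ENNReal.iSup_pow]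
    congr 1
    refine le_antisymm (iSup_le fun j => ?_) (iSup_le fun J => iSup₂_le fun j _ => ?_)
    · exact le_iSup_of_le j (le_iSup₂_of_le j le_rfl le_rfl)
    · exact le_iSup (fun j => ∫⁻ y, k j x y * g y ∂μ) j
  simp only [hsup]
  rw [lintegral_iSup]
  · exact iSup_le hJ
  · exact fun J => (Measurable.iSup fun i => Measurable.iSup fun _ => hT i).pow_const 2
  · intro J J' hJJ x
    refine pow_le_pow_left' (iSup₂_le fun i hi => ?_) 2
    exact le_iSup₂_of_le i (hi.trans hJJ) le_rfl

/-! ### Caps of the sphere and dyadic kernels -/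

open scoped Pointwise in
theorem sphereMeasure_eq {n : ℕ} (hn : 0 < n)
    {s : Set (sphere (0 : EuclideanSpace ℝ (Fin n)) 1)} (hs : MeasurableSet s) :
    sphereMeasure n s = (volume (ball (0 : EuclideanSpace ℝ (Fin n)) 1))⁻¹
      * volume (Set.Ioo (0 : ℝ) 1 • ((↑) '' s : Set (EuclideanSpace ℝ (Fin n)))) := by
  rw [sphereMeasure, Measure.smul_apply, smul_eq_mul, Measure.toSphere_apply_univ,
    Measure.toSphere_apply' _ hs, finrank_euclideanSpace_fin,
    ENNReal.mul_inv (Or.inr measure_ball_lt_top.ne) (Or.inl (by simp)), ← mul_assoc,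
    mul_right_comm _ _ (n : ℝ≥0∞), ENNReal.inv_mul_cancel (by simpa using hn.ne') (by simp),
    one_mul]

theorem isProbabilityMeasure_sphereMeasure {n : ℕ} (hn : 0 < n) :
    IsProbabilityMeasure (sphereMeasure n) := by
  have : Nonempty (Fin n) := ⟨⟨0, hn⟩⟩
  refine ⟨?_⟩
  rw [sphereMeasure, Measure.smul_apply, smul_eq_mul]
  refine ENNReal.inv_mul_cancel ?_ (measure_ne_top _ _)
  rw [Measure.toSphere_apply_univ, finrank_euclideanSpace_fin]
  exact mul_ne_zero (by simpa using hn.ne') (measure_ball_pos _ _ one_pos).ne'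

open scoped Pointwise in
/-- The cone over a cap of radius `ρ` is covered by about `1 / ρ` balls of radius `2 ρ`. -/
theorem sphereMeasure_closedBall_le {n : ℕ} (hn : 0 < n)
    (ξ : sphere (0 : EuclideanSpace ℝ (Fin n)) 1) {ρ : ℝ} (hρ : 0 < ρ) :
    sphereMeasure n (closedBall ξ ρ) ≤ ENNReal.ofReal (2 ^ (n + 1) * ρ ^ (n - 1)) := by
  have := isProbabilityMeasure_sphereMeasure hn
  rcases lt_or_ge 1 ρ with h1 | h1
  · refine prob_le_one.trans ?_
    rw [← ENNReal.ofReal_one]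
    refine ENNReal.ofReal_le_ofReal ?_
    exact one_le_mul_of_one_le_of_one_le (one_le_pow₀ one_le_two) (one_le_pow₀ h1.le)
  have : Nonempty (Fin n) := ⟨⟨0, hn⟩⟩
  set N := ⌈1 / ρ⌉₊ with hN
  have hcover : Set.Ioo (0 : ℝ) 1 • ((↑) '' closedBall ξ ρ : Set (EuclideanSpace ℝ (Fin n)))
      ⊆ ⋃ j ∈ Finset.range N,
        closedBall (((j : ℝ) * ρ) • (ξ : EuclideanSpace ℝ (Fin n))) (2 * ρ) := by
    rintro _ ⟨t, ht, _, ⟨η, hη, rfl⟩, rfl⟩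
    have hη1 : ‖(η : EuclideanSpace ℝ (Fin n)) - ξ‖ ≤ ρ := by
      rw [← dist_eq_norm]
      exact hη
    have hξ1 : ‖(ξ : EuclideanSpace ℝ (Fin n))‖ = 1 := norm_eq_of_mem_sphere ξ
    have htρ : 0 ≤ t / ρ := div_nonneg ht.1.le hρ.le
    have hfl := Nat.floor_le htρ
    have hfl2 := Nat.lt_floor_add_one (t / ρ)
    rw [le_div_iff₀ hρ] at hfl
    rw [div_lt_iff₀ hρ] at hfl2
    refine Set.mem_iUnion₂.2 ⟨⌊t / ρ⌋₊, Finset.mem_range.2 ?_, ?_⟩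
    · refine (Nat.floor_lt htρ).2 (lt_of_lt_of_le ?_ (Nat.le_ceil _))
      exact div_lt_div_of_pos_right ht.2 hρ
    · rw [mem_closedBall, dist_eq_norm]
      have : t • (η : EuclideanSpace ℝ (Fin n))
            - ((⌊t / ρ⌋₊ : ℝ) * ρ) • (ξ : EuclideanSpace ℝ (Fin n))
          = t • ((η : EuclideanSpace ℝ (Fin n)) - ξ)
            + (t - (⌊t / ρ⌋₊ : ℝ) * ρ) • (ξ : EuclideanSpace ℝ (Fin n)) := by
        rw [smul_sub, sub_smul]
        abel
      beta_reduce
      rw [this]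
      refine (norm_add_le _ _).trans ?_
      rw [norm_smul, norm_smul, hξ1, Real.norm_of_nonneg ht.1.le,
        Real.norm_of_nonneg (by linarith)]
      have : t * ‖(η : EuclideanSpace ℝ (Fin n)) - ξ‖ ≤ 1 * ρ :=
        mul_le_mul ht.2.le hη1 (norm_nonneg _) zero_le_one
      linarith
  have hV0 : volume (ball (0 : EuclideanSpace ℝ (Fin n)) 1) ≠ 0 :=
    (measure_ball_pos _ _ one_pos).ne'
  have hvol : volume (Set.Ioo (0 : ℝ) 1 •
      ((↑) '' closedBall ξ ρ : Set (EuclideanSpace ℝ (Fin n))))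
      ≤ ENNReal.ofReal (2 ^ (n + 1) * ρ ^ (n - 1))
        * volume (ball (0 : EuclideanSpace ℝ (Fin n)) 1) := by
    refine (measure_mono hcover).trans ((measure_biUnion_finset_le _ _).trans ?_)
    simp only [Measure.addHaar_closedBall volume _ (by positivity : (0 : ℝ) ≤ 2 * ρ),
      finrank_euclideanSpace_fin, Finset.sum_const, Finset.card_range, nsmul_eq_mul]
    rw [← mul_assoc, ← ENNReal.ofReal_natCast, ← ENNReal.ofReal_mul (Nat.cast_nonneg _)]
    refine mul_le_mul_left (ENNReal.ofReal_le_ofReal ?_) _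
    have hN2 : (N : ℝ) ≤ 2 / ρ := by
      have := (Nat.ceil_lt_add_one (one_div_pos.2 hρ).le).le
      have h2 : 1 ≤ 1 / ρ := by rwa [le_div_iff₀ hρ, one_mul]
      calc (N : ℝ) ≤ 1 / ρ + 1 := this
        _ ≤ 1 / ρ + 1 / ρ := by linarith
        _ = _ := by ring
    calc (N : ℝ) * (2 * ρ) ^ n ≤ 2 / ρ * (2 * ρ) ^ n := by gcongr
      _ = _ := by
        obtain ⟨m, rfl⟩ : ∃ m, n = m + 1 := ⟨n - 1, by omega⟩
        rw [Nat.add_sub_cancel, mul_pow, pow_succ ρ]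
        field_simp
        ring
  rw [sphereMeasure_eq hn isClosed_closedBall.measurableSet]
  refine (mul_le_mul_right hvol _).trans (le_of_eq ?_)
  rw [mul_comm, mul_assoc, ENNReal.mul_inv_cancel hV0 measure_ball_lt_top.ne, mul_one]

/-- The model `ε / (ε + d) ^ n` of the Poisson kernel of the ball at distance `ε` from the sphere,
as a function of the distance `d` of the boundary points. -/
noncomputable def modelKernel (n : ℕ) (ε d : ℝ) : ℝ := ε / (ε + d) ^ n

theorem modelKernel_nonneg {n : ℕ} {ε d : ℝ} (hε : 0 ≤ ε) (hd : 0 ≤ d) :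
    0 ≤ modelKernel n ε d := by
  unfold modelKernel
  positivity

theorem modelKernel_mul_le_of_le {n : ℕ} {ε ε' d d₁ d₂ : ℝ} (hε' : 0 < ε') (hle : ε' ≤ ε)
    (hd : 0 ≤ d) (hd₁ : 0 ≤ d₁) (hd₂ : 0 ≤ d₂) (h : d ≤ d₁ + d₂) :
    modelKernel n ε d₁ * modelKernel n ε' d₂
      ≤ 4 ^ n * modelKernel n ε d * (modelKernel n ε d₁ + modelKernel n ε' d₂) := by
  have hε : 0 < ε := hε'.trans_le hle
  have k1 := modelKernel_nonneg (n := n) hε.le hd₁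
  have k2 := modelKernel_nonneg (n := n) hε'.le hd₂
  have aux : ∀ {a e : ℝ}, 0 < a → 0 ≤ e → a ≤ ε → ε + d ≤ 4 * (a + e) →
      modelKernel n a e ≤ 4 ^ n * modelKernel n ε d := by
    intro a e ha he hae h4
    unfold modelKernel
    rw [div_le_iff₀ (by positivity)]
    calc a ≤ ε := hae
      _ = 4 ^ n * (ε / (ε + d) ^ n) * ((ε + d) / 4) ^ n := by
        rw [div_pow]
        field_simp
      _ ≤ _ := by
        gcongr
        linarith
  rcases le_or_gt (ε + d) (4 * (ε + d₁)) with h4 | h4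
  · have := aux hε hd₁ le_rfl h4
    calc modelKernel n ε d₁ * modelKernel n ε' d₂
        ≤ 4 ^ n * modelKernel n ε d * modelKernel n ε' d₂ := by gcongr
      _ ≤ _ := by
        gcongr
        · exact mul_nonneg (by positivity) (modelKernel_nonneg hε.le hd)
        · linarith
  · have := aux hε' hd₂ hle (by linarith)
    calc modelKernel n ε d₁ * modelKernel n ε' d₂
        ≤ modelKernel n ε d₁ * (4 ^ n * modelKernel n ε d) := by gcongr
      _ = 4 ^ n * modelKernel n ε d * modelKernel n ε d₁ := by ring
      _ ≤ _ := by
        gcongr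
        · exact mul_nonneg (by positivity) (modelKernel_nonneg hε.le hd)
        · linarith

/-- The pointwise form of the semigroup-like bound `k_ε * k_ε' ≲ k_ε + k_ε'`. -/
theorem modelKernel_mul_le {n : ℕ} {ε ε' d d₁ d₂ : ℝ} (hε : 0 < ε) (hε' : 0 < ε')
    (hd : 0 ≤ d) (hd₁ : 0 ≤ d₁) (hd₂ : 0 ≤ d₂) (h : d ≤ d₁ + d₂) :
    modelKernel n ε d₁ * modelKernel n ε' d₂
      ≤ 4 ^ n * (modelKernel n ε d + modelKernel n ε' d)
        * (modelKernel n ε d₁ + modelKernel n ε' d₂) := by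
  have k1 := modelKernel_nonneg (n := n) hε.le hd₁
  have k2 := modelKernel_nonneg (n := n) hε'.le hd₂
  have k3 := modelKernel_nonneg (n := n) hε.le hd
  have k4 := modelKernel_nonneg (n := n) hε'.le hd
  rcases le_total ε' ε with hle | hle
  · refine (modelKernel_mul_le_of_le hε' hle hd hd₁ hd₂ h).trans ?_
    gcongr
    linarith
  · rw [mul_comm (modelKernel n ε d₁), add_comm (modelKernel n ε d₁)]
    refine (modelKernel_mul_le_of_le hε hle hd hd₂ hd₁ (by linarith)).trans ?_
    gcongr
    linarith

/-- Summation over the dyadic annuli `dist ξ η ∼ 2 ^ m ε`. -/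
theorem lintegral_modelKernel_le {n : ℕ} (hn : 0 < n) {ε : ℝ} (hε : 0 < ε)
    (ξ : sphere (0 : EuclideanSpace ℝ (Fin n)) 1) :
    ∫⁻ η, ENNReal.ofReal (modelKernel n ε (dist ξ η)) ∂(sphereMeasure n)
      ≤ ENNReal.ofReal (2 ^ (2 * n + 2)) := by
  set c : ℕ → ℝ := fun m => 2 ^ n * ε / (2 ^ m * ε) ^ n with hc
  have hpt : ∀ η, ENNReal.ofReal (modelKernel n ε (dist ξ η))
      ≤ ∑' m, (closedBall ξ (2 ^ m * ε)).indicator (fun _ => ENNReal.ofReal (c m)) η := by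
    intro η
    have hex : ∃ m : ℕ, dist ξ η ≤ 2 ^ m * ε := by
      obtain ⟨m, hm⟩ := pow_unbounded_of_one_lt (dist ξ η / ε) one_lt_two
      exact ⟨m, ((div_lt_iff₀ hε).1 hm).le⟩
    classical
    obtain ⟨m, hm, hmin⟩ : ∃ m : ℕ, dist ξ η ≤ 2 ^ m * ε ∧
        2 ^ m * ε ≤ 2 * (ε + dist ξ η) := by
      refine ⟨Nat.find hex, Nat.find_spec hex, ?_⟩
      rcases h0 : Nat.find hex with _ | k
      · have : 0 ≤ dist ξ η := dist_nonneg
        rw [pow_zero]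
        linarith
      · have := Nat.find_min hex (m := k) (by omega)
        rw [not_le] at this
        rw [pow_succ]
        linarith
    refine le_trans ?_ (ENNReal.le_tsum m)
    rw [Set.indicator_of_mem (by rwa [mem_closedBall, dist_comm])]
    refine ENNReal.ofReal_le_ofReal ?_
    have hd : 0 ≤ dist ξ η := dist_nonneg
    rw [modelKernel, hc]
    beta_reduce
    rw [div_le_div_iff₀ (by positivity) (by positivity)]
    calc ε * (2 ^ m * ε) ^ n ≤ ε * (2 * (ε + dist ξ η)) ^ n := by gcongr
      _ = _ := by rw [mul_pow]; ring
  have hterm : ∀ m, ENNReal.ofReal (c m) * sphereMeasure n (closedBall ξ (2 ^ m * ε))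
      ≤ ENNReal.ofReal (2 ^ (2 * n + 1) * (1 / 2) ^ m) := by
    intro m
    refine (mul_le_mul_right (sphereMeasure_closedBall_le hn ξ (by positivity)) _).trans ?_
    rw [← ENNReal.ofReal_mul (by positivity)]
    refine ENNReal.ofReal_le_ofReal (le_of_eq ?_)
    obtain ⟨k, rfl⟩ : ∃ k, n = k + 1 := ⟨n - 1, by omega⟩
    rw [hc, Nat.add_sub_cancel, div_pow, one_pow]
    beta_reduce
    rw [pow_succ (2 ^ m * ε) k]
    field_simp
    ring
  calc ∫⁻ η, ENNReal.ofReal (modelKernel n ε (dist ξ η)) ∂(sphereMeasure n)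
      ≤ ∫⁻ η, ∑' m, (closedBall ξ (2 ^ m * ε)).indicator (fun _ => ENNReal.ofReal (c m)) η
          ∂(sphereMeasure n) := lintegral_mono hpt
    _ = ∑' m, ENNReal.ofReal (c m) * sphereMeasure n (closedBall ξ (2 ^ m * ε)) := by
      rw [lintegral_tsum fun m =>
        (measurable_const.indicator isClosed_closedBall.measurableSet).aemeasurable]
      exact tsum_congr fun m => lintegral_indicator_const isClosed_closedBall.measurableSet _
    _ ≤ ∑' m, ENNReal.ofReal (2 ^ (2 * n + 1) * (1 / 2) ^ m) := ENNReal.tsum_le_tsum hterm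
    _ = _ := by
      rw [← ENNReal.ofReal_tsum_of_nonneg (fun m => by positivity)
        (summable_geometric_two.mul_left _), tsum_mul_left, tsum_geometric_two, ← pow_succ]

/-- The kernels of the maximal operator on the sphere, at the dyadic scales `2 ^ (-j)`. -/
noncomputable def dyadicKernel {n : ℕ} (j : ℕ) (ξ η : sphere (0 : EuclideanSpace ℝ (Fin n)) 1) :
    ℝ≥0∞ :=
  ENNReal.ofReal (modelKernel n ((1 / 2) ^ j) (dist ξ η))

theorem measurable_dyadicKernel {n : ℕ} (j : ℕ) :
    Measurable (Function.uncurry (dyadicKernel (n := n) j)) := by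
  have h : Measurable fun p : sphere (0 : EuclideanSpace ℝ (Fin n)) 1 ×
      sphere (0 : EuclideanSpace ℝ (Fin n)) 1 => dist p.1 p.2 := continuous_dist.measurable
  exact (measurable_const.div ((measurable_const.add h).pow_const n)).ennreal_ofReal

/-- The composition of two dyadic kernels is dominated by the kernels themselves. -/
theorem lintegral_dyadicKernel_mul_le {n : ℕ} (hn : 0 < n) (i j : ℕ)
    (ξ η : sphere (0 : EuclideanSpace ℝ (Fin n)) 1) :
    ∫⁻ ζ, dyadicKernel i ξ ζ * dyadicKernel j η ζ ∂(sphereMeasure n)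
      ≤ (2 ^ (4 * n + 3) : NNReal) * (dyadicKernel i ξ η + dyadicKernel j η ξ) := by
  have hi : (0 : ℝ) < (1 / 2) ^ i := by positivity
  have hj : (0 : ℝ) < (1 / 2) ^ j := by positivity
  have hm : ∀ l (x : sphere (0 : EuclideanSpace ℝ (Fin n)) 1), Measurable (dyadicKernel l x) :=
    fun l x => (measurable_dyadicKernel l).of_uncurry_left
  have hpt : ∀ ζ, dyadicKernel i ξ ζ * dyadicKernel j η ζ
      ≤ ENNReal.ofReal (4 ^ n) * (dyadicKernel i ξ η + dyadicKernel j η ξ)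
        * (dyadicKernel i ξ ζ + dyadicKernel j η ζ) := by
    intro ζ
    unfold dyadicKernel
    have h1 := modelKernel_nonneg (n := n) hi.le (dist_nonneg (x := ξ) (y := η))
    have h2 := modelKernel_nonneg (n := n) hj.le (dist_nonneg (x := η) (y := ξ))
    have h3 := modelKernel_nonneg (n := n) hi.le (dist_nonneg (x := ξ) (y := ζ))
    have h4 := modelKernel_nonneg (n := n) hj.le (dist_nonneg (x := η) (y := ζ))
    rw [← ENNReal.ofReal_add h1 h2, ← ENNReal.ofReal_add h3 h4, ← ENNReal.ofReal_mul h3,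
      ← ENNReal.ofReal_mul (by positivity), ← ENNReal.ofReal_mul (by positivity)]
    refine ENNReal.ofReal_le_ofReal ?_
    rw [dist_comm η ξ]
    refine modelKernel_mul_le hi hj dist_nonneg dist_nonneg dist_nonneg ?_
    rw [dist_comm η ζ]
    exact dist_triangle _ _ _
  refine (lintegral_mono hpt).trans ?_
  rw [lintegral_const_mul _ ((hm i ξ).fun_add (hm j η)), lintegral_add_left (hm i ξ)]
  refine (mul_le_mul_right (add_le_add (lintegral_modelKernel_le hn hi ξ)
    (lintegral_modelKernel_le hn hj η)) _).trans (le_of_eq ?_)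
  have hconst : ENNReal.ofReal (4 ^ n)
      * (ENNReal.ofReal (2 ^ (2 * n + 2)) + ENNReal.ofReal (2 ^ (2 * n + 2)))
      = (2 ^ (4 * n + 3) : NNReal) := by
    rw [← ENNReal.ofReal_add (by positivity) (by positivity),
      ← ENNReal.ofReal_mul (by positivity), ← ENNReal.ofReal_coe_nnreal]
    refine congrArg ENNReal.ofReal ?_
    rw [NNReal.coe_pow, NNReal.coe_ofNat, show (4 : ℝ) = 2 ^ 2 by norm_num, ← pow_mul]
    ring
  rw [mul_right_comm, hconst]

theorem lintegral_sq_iSup_dyadicKernel_le {n : ℕ} (hn : 0 < n)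
    {g : sphere (0 : EuclideanSpace ℝ (Fin n)) 1 → ℝ≥0∞} (hg : Measurable g) :
    ∫⁻ ξ, (⨆ j, ∫⁻ η, dyadicKernel j ξ η * g η ∂(sphereMeasure n)) ^ 2 ∂(sphereMeasure n)
      ≤ (5 * (2 ^ (4 * n + 3)) ^ 2 : NNReal) * ∫⁻ η, g η ^ 2 ∂(sphereMeasure n) := by
  have := isProbabilityMeasure_sphereMeasure hn
  refine lintegral_sq_iSup_kernel_le (k := dyadicKernel) measurable_dyadicKernel
    (B := fun j => Real.toNNReal ((1 / 2) ^ j / ((1 / 2) ^ j) ^ n)) (fun j ξ η => ?_)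
    (by positivity) (lintegral_dyadicKernel_mul_le hn) hg
  refine ENNReal.ofReal_le_ofReal ?_
  unfold modelKernel
  have : 0 ≤ dist ξ η := dist_nonneg
  gcongr
  linarith

/-! ### The maximal theorem for the Poisson integral -/

theorem measurable_poissonH {n : ℕ} (hn : 3 ≤ n) {δ : ℝ} (hδ : 0 < δ) (hδ1 : δ < 1)
    {x : EuclideanSpace ℝ (Fin n)} (hx : ‖x‖ < 1) :
    Measurable fun ξ : sphere (0 : EuclideanSpace ℝ (Fin n)) 1 => poissonH δ x ξ := by
  refine measurable_of_tendsto_metrizable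
    (f := fun N (ξ : sphere (0 : EuclideanSpace ℝ (Fin n)) 1) =>
      ∑ l ∈ Finset.range N, poissonHTerm δ x ξ l) (fun N => ?_) (tendsto_pi_nhds.2 fun ξ => ?_)
  · refine Continuous.measurable (continuous_finsetSum _ fun l _ => ?_)
    unfold poissonHTerm zonal gegenbauerC
    fun_prop
  · exact (Summable.of_abs (summable_abs_poissonHTerm hn hδ hδ1
      (norm_eq_of_mem_sphere ξ) hx)).hasSum.tendsto_sum_nat

theorem norm_lt_one_of_mem_approachRegion {n : ℕ} {α : ℝ} (hα : 0 < α) (hα1 : α < 1)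
    {x ξ : EuclideanSpace ℝ (Fin n)} (hξ : ‖ξ‖ = 1) (hx : x ∈ approachRegion α ξ) : ‖x‖ < 1 := by
  obtain ⟨s, hs, hs1, h⟩ := (mem_approachRegion hα hα1 hξ).1 hx
  have := one_sub_norm_of_approach hξ hs h
  have := mul_pos (sub_pos.2 hs1) (sub_pos.2 hα1)
  linarith

/-- In an approach region at distance `y` from the sphere the Poisson kernel is controlled by the
model kernel at the scale `2 ^ (-j) ∼ y`, centred at the vertex. -/
theorem exists_poissonE_le_modelKernel {n : ℕ} {α : ℝ} (hα : 0 < α) (hα1 : α < 1)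
    {x ξ : EuclideanSpace ℝ (Fin n)} (hξ : ‖ξ‖ = 1) (hx : x ∈ approachRegion α ξ) :
    ∃ j : ℕ, ∀ η : EuclideanSpace ℝ (Fin n), ‖η‖ = 1 →
      poissonE x η ≤ 2 * (2 * (2 + (1 + α) / (1 - α))) ^ n
        * modelKernel n ((1 / 2) ^ j) (dist ξ η) := by
  have hx1 := norm_lt_one_of_mem_approachRegion hα hα1 hξ hx
  obtain ⟨s, hs, hs1, h⟩ := (mem_approachRegion hα hα1 hξ).1 hx
  have hr := one_sub_norm_of_approach hξ hs h
  have hα' : 0 < 1 - α := by linarith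
  set y := 1 - ‖x‖ with hy
  have hy0 : 0 < y := by linarith
  have hy1 : y ≤ 1 := by linarith [norm_nonneg x]
  set κ := (1 + α) / (1 - α) with hκ
  have hκ0 : 0 < κ := by positivity
  have hxξ : ‖x - ξ‖ ≤ κ * y := by
    have h1 : ‖x - ξ‖ ≤ ‖x - s • ξ‖ + ‖(s - 1) • ξ‖ := by
      have := norm_add_le (x - s • ξ) ((s - 1) • ξ)
      rwa [show x - s • ξ + (s - 1) • ξ = x - ξ by rw [sub_smul, one_smul]; abel] at this
    rw [norm_smul, hξ, mul_one, Real.norm_of_nonpos (by linarith)] at h1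
    have h2 : 1 - s ≤ y / (1 - α) := by
      rw [le_div_iff₀ hα']
      exact hr.le
    calc ‖x - ξ‖ ≤ (1 + α) * (1 - s) := by linarith
      _ ≤ (1 + α) * (y / (1 - α)) := by gcongr
      _ = κ * y := by rw [hκ]; ring
  obtain ⟨j, hj1, hj2⟩ := exists_nat_pow_near_of_lt_one hy0 hy1
    (by norm_num : (0 : ℝ) < 1 / 2) (by norm_num)
  refine ⟨j, fun η hη => ?_⟩
  set ε : ℝ := (1 / 2) ^ j with hε
  have hε0 : 0 < ε := by positivity
  rw [pow_succ] at hj1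
  have hd0 : 0 ≤ dist ξ η := dist_nonneg
  have hyη : y ≤ ‖x - η‖ := by
    have := norm_sub_norm_le η x
    rw [hη, norm_sub_rev] at this
    exact this
  have hyd : ε + dist ξ η ≤ 2 * (2 + κ) * ‖x - η‖ := by
    have h1 : dist ξ η ≤ ‖x - ξ‖ + ‖x - η‖ := by
      rw [← dist_eq_norm, ← dist_eq_norm, dist_comm x ξ]
      exact dist_triangle _ _ _
    have h2 : κ * y ≤ κ * ‖x - η‖ := by gcongr
    nlinarith
  have hpos : 0 < ‖x - η‖ := hy0.trans_le hyη
  unfold poissonE modelKernel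
  rw [div_le_iff₀ (by positivity)]
  calc 1 - ‖x‖ ^ 2 ≤ 2 * y := by nlinarith [norm_nonneg x]
    _ ≤ 2 * ε := by linarith
    _ = 2 * (ε / (ε + dist ξ η) ^ n) * (ε + dist ξ η) ^ n := by field_simp
    _ ≤ 2 * (ε / (ε + dist ξ η) ^ n) * (2 * (2 + κ) * ‖x - η‖) ^ n := by gcongr
    _ = _ := by rw [mul_pow]; ring

theorem lowerSemicontinuous_ntMaximal {n : ℕ} {α : ℝ} (hα : 0 < α) (hα1 : α < 1)
    (u : EuclideanSpace ℝ (Fin n) → ℝ) : LowerSemicontinuous (ntMaximal α u) := by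
  refine lowerSemicontinuous_iff_isOpen_preimage.2 fun c => ?_
  refine isOpen_iff_mem_nhds.2 fun ξ hξ => ?_
  rw [Set.mem_preimage, Set.mem_Ioi, ntMaximal] at hξ
  simp only [lt_iSup_iff] at hξ
  obtain ⟨x, hx, hc⟩ := hξ
  obtain ⟨s, hs, hs1, h⟩ := (mem_approachRegion hα hα1 (norm_eq_of_mem_sphere ξ)).1 hx
  have hopen : IsOpen {η : sphere (0 : EuclideanSpace ℝ (Fin n)) 1 |
      ‖x - s • (η : EuclideanSpace ℝ (Fin n))‖ < (1 - s) * α} :=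
    isOpen_lt (by fun_prop) continuous_const
  filter_upwards [hopen.mem_nhds h] with η hη
  refine hc.trans_le (le_iSup₂_of_le (f := fun y (_ : y ∈ approachRegion α
    (η : EuclideanSpace ℝ (Fin n))) => ‖u y‖ₑ) x ?_ le_rfl)
  exact (mem_approachRegion hα hα1 (norm_eq_of_mem_sphere η)).2 ⟨s, hs, hs1, hη⟩

theorem integrable_poissonH_mul {n : ℕ} (hn : 3 ≤ n) {δ : ℝ} (hδ : 0 < δ) (hδ1 : δ < 1)
    {f : sphere (0 : EuclideanSpace ℝ (Fin n)) 1 → ℝ} (hf : MemLp f 2 (sphereMeasure n))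
    {x : EuclideanSpace ℝ (Fin n)} (hx : ‖x‖ < 1) :
    Integrable (fun ξ : sphere (0 : EuclideanSpace ℝ (Fin n)) 1 => poissonH δ x ξ * f ξ)
      (sphereMeasure n) := by
  have := isProbabilityMeasure_sphereMeasure (n := n) (by omega)
  have hf1 : Integrable f (sphereMeasure n) := hf.integrable (by norm_num)
  refine hf1.bdd_mul (measurable_poissonH hn hδ hδ1 hx).aestronglyMeasurable
    (c := ((4 : ℝ) ^ ((n : ℝ) / 2 - 1) * 2 * 8 ^ (n - 1) * 16 ^ (n - 1))
      * ((1 - ‖x‖ ^ 2) / (1 - ‖x‖) ^ n)) (Eventually.of_forall fun ξ => ?_)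
  have hξ : ‖(ξ : EuclideanSpace ℝ (Fin n))‖ = 1 := norm_eq_of_mem_sphere ξ
  rw [Real.norm_of_nonneg (poissonH_nonneg hn hδ hδ1 hξ hx)]
  refine (poissonH_le hn hδ hδ1 hξ hx).trans ?_
  have h1 : 0 < 1 - ‖x‖ := by linarith
  have h2 : 0 ≤ 1 - ‖x‖ ^ 2 := by nlinarith [norm_nonneg x]
  have h3 : 1 - ‖x‖ ≤ ‖x - ξ‖ := by
    have := norm_sub_norm_le (ξ : EuclideanSpace ℝ (Fin n)) x
    rwa [hξ, norm_sub_rev] at this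
  unfold poissonE
  gcongr

theorem exists_ntMaximal_poissonHIntegral_le {n : ℕ} (hn : 3 ≤ n) {α : ℝ} (hα : 0 < α)
    (hα1 : α < 1) : ∃ C : ℝ, 0 ≤ C ∧ ∀ δ : ℝ, 0 < δ → δ < 1 →
      ∀ f : sphere (0 : EuclideanSpace ℝ (Fin n)) 1 → ℝ, MemLp f 2 (sphereMeasure n) →
        MemLp (ntMaximal α (poissonHIntegral δ f)) 2 (sphereMeasure n) ∧
        eLpNorm (ntMaximal α (poissonHIntegral δ f)) 2 (sphereMeasure n) ≤
          ENNReal.ofReal C * eLpNorm f 2 (sphereMeasure n) := by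
  set C₁ : ℝ := (4 : ℝ) ^ ((n : ℝ) / 2 - 1) * 2 * 8 ^ (n - 1) * 16 ^ (n - 1) with hC₁
  set C₂ : ℝ := 2 * (2 * (2 + (1 + α) / (1 - α))) ^ n with hC₂
  have hα' : 0 < 1 - α := by linarith
  have hC₁0 : 0 ≤ C₁ := by positivity
  have hC₂0 : 0 ≤ C₂ := by positivity
  set C₃ : ℝ := √(5 * (2 ^ (4 * n + 3)) ^ 2) with hC₃
  refine ⟨C₁ * C₂ * C₃, by positivity, fun δ hδ hδ1 f hf => ?_⟩
  have hprob := isProbabilityMeasure_sphereMeasure (n := n) (by omega)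
  obtain ⟨g, hg, hfg⟩ := hf.1.enorm
  set u := poissonHIntegral δ f with hu
  have hpt : ∀ ξ, ntMaximal α u ξ ≤ ENNReal.ofReal (C₁ * C₂)
      * ⨆ j, ∫⁻ η, dyadicKernel j ξ η * g η ∂(sphereMeasure n) := by
    intro ξ
    have hξ : ‖(ξ : EuclideanSpace ℝ (Fin n))‖ = 1 := norm_eq_of_mem_sphere ξ
    refine iSup₂_le fun x hx => ?_
    have hx1 := norm_lt_one_of_mem_approachRegion hα hα1 hξ hx
    obtain ⟨j, hj⟩ := exists_poissonE_le_modelKernel hα hα1 hξ hx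
    calc ‖u x‖ₑ ≤ ∫⁻ η, ‖poissonH δ x η * f η‖ₑ ∂(sphereMeasure n) :=
          enorm_integral_le_lintegral_enorm _
      _ ≤ ∫⁻ η, ENNReal.ofReal (C₁ * C₂) * (dyadicKernel j ξ η * g η) ∂(sphereMeasure n) := by
          refine lintegral_mono_ae ?_
          filter_upwards [hfg] with η hη
          have hη1 : ‖(η : EuclideanSpace ℝ (Fin n))‖ = 1 := norm_eq_of_mem_sphere η
          rw [enorm_mul, hη, ← mul_assoc]
          refine mul_le_mul_left ?_ _
          rw [Real.enorm_of_nonneg (poissonH_nonneg hn hδ hδ1 hη1 hx1), dyadicKernel,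
            ← ENNReal.ofReal_mul (by positivity)]
          refine ENNReal.ofReal_le_ofReal ((poissonH_le hn hδ hδ1 hη1 hx1).trans ?_)
          exact (mul_le_mul_of_nonneg_left (hj η hη1) hC₁0).trans_eq (mul_assoc _ _ _).symm
      _ = ENNReal.ofReal (C₁ * C₂) * ∫⁻ η, dyadicKernel j ξ η * g η ∂(sphereMeasure n) :=
          lintegral_const_mul _ ((measurable_dyadicKernel j).of_uncurry_left.fun_mul hg)
      _ ≤ _ := mul_le_mul_right (le_iSup (fun j => ∫⁻ η, dyadicKernel j ξ η * g η
          ∂(sphereMeasure n)) j) _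
  have hmeas : Measurable (ntMaximal α u) := (lowerSemicontinuous_ntMaximal hα hα1 u).measurable
  have hT : ∀ j, Measurable fun ξ : sphere (0 : EuclideanSpace ℝ (Fin n)) 1 =>
      ∫⁻ η, dyadicKernel j ξ η * g η ∂(sphereMeasure n) := fun j =>
    Measurable.lintegral_prod_right'
      (f := fun p : sphere (0 : EuclideanSpace ℝ (Fin n)) 1 ×
        sphere (0 : EuclideanSpace ℝ (Fin n)) 1 => dyadicKernel j p.1 p.2 * g p.2)
      ((measurable_dyadicKernel j).fun_mul (hg.comp measurable_snd))
  have hsq : eLpNorm (ntMaximal α u) 2 (sphereMeasure n) ^ 2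
      ≤ (ENNReal.ofReal (C₁ * C₂ * C₃) * eLpNorm f 2 (sphereMeasure n)) ^ 2 := by
    have e1 : eLpNorm (ntMaximal α u) 2 (sphereMeasure n) ^ 2
        = ∫⁻ ξ, ntMaximal α u ξ ^ 2 ∂(sphereMeasure n) := by
      have := eLpNorm_nnreal_pow_eq_lintegral (μ := sphereMeasure n) (f := ntMaximal α u)
        (p := 2) two_ne_zero
      simpa using this
    have e2 : eLpNorm f 2 (sphereMeasure n) ^ 2 = ∫⁻ ξ, g ξ ^ 2 ∂(sphereMeasure n) := by
      have := eLpNorm_nnreal_pow_eq_lintegral (μ := sphereMeasure n) (f := f)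
        (p := 2) two_ne_zero
      have h2 : ∫⁻ ξ, g ξ ^ 2 ∂(sphereMeasure n) = ∫⁻ ξ, ‖f ξ‖ₑ ^ 2 ∂(sphereMeasure n) := by
        refine lintegral_congr_ae ?_
        filter_upwards [hfg] with η hη
        rw [hη]
      rw [h2]
      simpa using this
    rw [e1, mul_pow, e2]
    calc ∫⁻ ξ, ntMaximal α u ξ ^ 2 ∂(sphereMeasure n)
        ≤ ∫⁻ ξ, ENNReal.ofReal (C₁ * C₂) ^ 2
          * (⨆ j, ∫⁻ η, dyadicKernel j ξ η * g η ∂(sphereMeasure n)) ^ 2 ∂(sphereMeasure n) := by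
          refine lintegral_mono fun ξ => ?_
          rw [← mul_pow]
          exact pow_le_pow_left' (hpt ξ) 2
      _ = ENNReal.ofReal (C₁ * C₂) ^ 2 * ∫⁻ ξ,
          (⨆ j, ∫⁻ η, dyadicKernel j ξ η * g η ∂(sphereMeasure n)) ^ 2 ∂(sphereMeasure n) :=
          lintegral_const_mul _ ((Measurable.iSup hT).pow_const 2)
      _ ≤ ENNReal.ofReal (C₁ * C₂) ^ 2 * ((5 * (2 ^ (4 * n + 3)) ^ 2 : NNReal)
          * ∫⁻ η, g η ^ 2 ∂(sphereMeasure n)) :=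
          mul_le_mul_right (lintegral_sq_iSup_dyadicKernel_le (by omega) hg) _
      _ = _ := by
          rw [← mul_assoc]
          congr 1
          rw [ENNReal.ofReal_mul (q := C₃) (by positivity), mul_pow]
          congr 1
          rw [← ENNReal.ofReal_pow (by positivity), hC₃, Real.sq_sqrt (by positivity),
            ← ENNReal.ofReal_coe_nnreal]
          refine congrArg ENNReal.ofReal ?_
          push_cast
          ring
  have hle := (ENNReal.pow_le_pow_left_iff two_ne_zero).1 hsq
  exact ⟨⟨hmeas.aestronglyMeasurable,
    hle.trans_lt (ENNReal.mul_lt_top ENNReal.ofReal_lt_top hf.2)⟩, hle⟩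

theorem proposition18 (n : ℕ) (hn : 3 ≤ n) :
    (∀ δ : ℝ, 0 < δ → δ < 1 → ∀ x ∈ ball (0 : EuclideanSpace ℝ (Fin n)) 1,
      ∀ ξ ∈ sphere (0 : EuclideanSpace ℝ (Fin n)) 1, Summable (poissonHTerm δ x ξ)) ∧
    (∃ C : ℝ, ∀ δ : ℝ, 0 < δ → δ < 1 → ∀ x ∈ ball (0 : EuclideanSpace ℝ (Fin n)) 1,
      ∀ ξ ∈ sphere (0 : EuclideanSpace ℝ (Fin n)) 1,
        0 ≤ poissonH δ x ξ ∧ poissonH δ x ξ ≤ C * poissonE x ξ) ∧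
    (∀ α : ℝ, 0 < α → α < 1 → ∃ C : ℝ, 0 ≤ C ∧ ∀ δ : ℝ, 0 < δ → δ < 1 →
      ∀ f : sphere (0 : EuclideanSpace ℝ (Fin n)) 1 → ℝ, MemLp f 2 (sphereMeasure n) →
        (∀ x ∈ ball (0 : EuclideanSpace ℝ (Fin n)) 1,
          Integrable (fun ξ : sphere (0 : EuclideanSpace ℝ (Fin n)) 1 => poissonH δ x ξ * f ξ) (sphereMeasure n)) ∧
        MemLp (ntMaximal α (poissonHIntegral δ f)) 2 (sphereMeasure n) ∧
        eLpNorm (ntMaximal α (poissonHIntegral δ f)) 2 (sphereMeasure n) ≤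
          ENNReal.ofReal C * eLpNorm f 2 (sphereMeasure n)) ∧
    (∃ η : ℝ, 0 < η ∧ η < 1 ∧ ∃ C : ℝ, 0 < C ∧ ∀ δ : ℝ, 0 < δ → δ < 1 →
      ∀ ξ ∈ sphere (0 : EuclideanSpace ℝ (Fin n)) 1, ∀ x ∈ approachRegion η ξ,
        C / (1 - ‖x‖ ^ 2) ^ (n - 1) ≤ poissonH δ x ξ) := by
  refine ⟨fun δ hδ hδ1 x hx ξ hξ => ?_,
    ⟨(4 : ℝ) ^ ((n : ℝ) / 2 - 1) * 2 * 8 ^ (n - 1) * 16 ^ (n - 1),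
      fun δ hδ hδ1 x hx ξ hξ => ?_⟩,
    fun α hα hα1 => ?_, exists_poissonH_ge hn⟩
  · rw [mem_ball_zero_iff] at hx
    exact Summable.of_abs (summable_abs_poissonHTerm hn hδ hδ1 (mem_sphere_zero_iff_norm.1 hξ) hx)
  · rw [mem_ball_zero_iff] at hx
    rw [mem_sphere_zero_iff_norm] at hξ
    exact ⟨poissonH_nonneg hn hδ hδ1 hξ hx, poissonH_le hn hδ hδ1 hξ hx⟩
  · obtain ⟨C, hC, h⟩ := exists_ntMaximal_poissonHIntegral_le hn hα hα1
    exact ⟨C, hC, fun δ hδ hδ1 f hf =>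
      ⟨fun x hx => integrable_poissonH_mul hn hδ hδ1 hf (mem_ball_zero_iff.1 hx),
        h δ hδ hδ1 f hf⟩⟩
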